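/- Let $X$ be a real random variable with $\mathsf{E}[X^2]=\sigma^2$, $\zeta:=\mathsf{E}[X^4]<\infty$ and $\mathsf{E}[X^6]<\infty$, let $0<D<\sigma^2$, and let $X^n$ be a vector of $n$ i.i.d. copies of $X$. A random codebook consists of $M\ge 1$ codewords in $\mathbb{R}^n$ drawn independently of each other and of $X^n$, each one either uniformly from the sphere of radius $\sqrt{n(\sigma^2-D)}$ centred at the origin (spherical codebook) or with i.i.d. $\mathcal{N}(0,\sigma^2-D)$ entries (i.i.d. Gaussian codebook). The encoder picks a codeword $Y^n(i)$ that minimizes $d(X^n,Y^n(i))=\frac1n\|X^n-Y^n(i)\|^2$, and the excess-distortion probability is the probability, over both source and codebook, that the distortion of the chosen codeword exceeds $D$. Let $M^*_{\mathrm{sp}}(n,\varepsilon)$ and $M^*_{\mathrm{iid}}(n,\varepsilon)$ be the smallest $M$ for which this probability is at most $\varepsilon$ (with the value $\infty$ if there is none), for the spherical and the i.i.d. Gaussian codebook respectively, and let, for $\dagger\in\{\mathrm{sp},\mathrm{iid}\}$, $$L^*_\dagger(\varepsilon):=\limsup_{n\to\infty}\frac{1}{\sqrt n}\Big(\log M^*_\dagger(n,\varepsilon)-\frac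 n2\log\frac{\sigma^2}{D}\Big).$$ Put $\mathrm{V}:=\frac{\zeta-\sigma^4}{4\sigma^4}$ and let $\mathrm{Q}^{-1}$ be the inverse of the complementary distribution function of the standard Gaussian, with $\mathrm{Q}^{-1}(0)=+\infty$. Then for every $\varepsilon\in[0,1)$ (with $\mathrm{V}>0$ in the case $\varepsilon=0$), $$L^*_{\mathrm{sp}}(\varepsilon)=L^*_{\mathrm{iid}}(\varepsilon)=\sqrt{\mathrm{V}}\,\mathrm{Q}^{-1}(\varepsilon).$$ More precisely, for every $\varepsilon\in(0,1)$ and each $\dagger\in\{\mathrm{sp},\mathrm{iid}\}$, $M^*_\dagger(n,\varepsilon)$ is finite for all sufficiently large $n$, and as $n\to\infty$ $$\log M^*_\dagger(n,\varepsilon)=\frac n2\log\frac{\sigma^2}{D}+\sqrt{n\mathrm{V}}\,\mathrm{Q}^{-1}(\varepsilon)+O(\log n).$$ -/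

import Mathlib

open MeasureTheory ProbabilityTheory Filter Asymptotics Topology

noncomputable section

namespace GaussianCodebook

/-- The quadratic distortion `d(xⁿ, yⁿ) = (1/n) ∑ (xᵢ - yᵢ)²`. -/
def distortion {n : ℕ} (x y : Fin n → ℝ) : ℝ :=
  (1 / (n : ℝ)) * ∑ i, (x i - y i) ^ 2

/-- The minimum distortion encoder for the codebook `c`: it maps a source sequence to the index of
a codeword that minimizes the distortion. (Ties do not affect the resulting distortion.) -/
def encoder {n M : ℕ} [NeZero M] (c : Fin M → Fin n → ℝ) (x : Fin n → ℝ) : Fin M :=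
  Classical.choose (Finite.exists_min (fun i : Fin M => distortion x (c i)))

/-- The decoder returns the codeword with the received index. -/
def decoder {n M : ℕ} (c : Fin M → Fin n → ℝ) (i : Fin M) : Fin n → ℝ := c i

/-- The law of `n` i.i.d. letters of a memoryless source with single-letter law `μ`. -/
def sourceLaw (μ : Measure ℝ) (n : ℕ) : Measure (Fin n → ℝ) :=
  Measure.pi (fun _ => μ)

/-- The uniform distribution on the centred sphere of radius `√(n P)` in `ℝⁿ` (for `n ≥ 1`):
the normalized surface measure of the unit sphere, scaled by the factor `√(n P)`. -/
def sphericalLaw (P : ℝ) (n : ℕ) : Measure (Fin n → ℝ) :=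
  let S : Measure (Metric.sphere (0 : EuclideanSpace ℝ (Fin n)) 1) :=
    (volume : Measure (EuclideanSpace ℝ (Fin n))).toSphere
  ((S Set.univ)⁻¹ • S).map
    (fun (u : Metric.sphere (0 : EuclideanSpace ℝ (Fin n)) 1) (i : Fin n) =>
      Real.sqrt (n * P) * u.1 i)

/-- The law of a vector of `n` i.i.d. centred Gaussians with variance `P`. -/
def iidGaussianLaw (P : ℝ) (n : ℕ) : Measure (Fin n → ℝ) :=
  Measure.pi (fun _ => gaussianReal 0 P.toNNReal)

/-- The ensemble excess-distortion probability: the source sequence has i.i.d. letters of law `μ`,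
the `M` codewords are drawn independently from `ν n`, independently of the source, and the
probability is over both. -/
def excessDistortionProb (μ : Measure ℝ) (ν : (n : ℕ) → Measure (Fin n → ℝ)) (D : ℝ)
    (n M : ℕ) [NeZero M] : ℝ :=
  ((sourceLaw μ n).prod (Measure.pi (fun _ : Fin M => ν n))).real
    {p | D < distortion p.1 (decoder p.2 (encoder p.2 p.1))}

/-- The minimum number `M*` of codewords for which the ensemble excess-distortion probability is at
most `ε`; it is `⊤` if there is no such number. -/
def minCodewords (μ : Measure ℝ) (ν : (n : ℕ) → Measure (Fin n → ℝ)) (D ε : ℝ) (n : ℕ) : ℕ∞ :=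
  sInf {m : ℕ∞ | ∃ (M : ℕ) (_ : NeZero M), m = M ∧ excessDistortionProb μ ν D n M ≤ ε}

/-- The first-order coding rate `(1/2) log (σ²/D)` for source power `s = σ²`. -/
def firstOrderRate (s D : ℝ) : ℝ := 1 / 2 * Real.log (s / D)

/-- The second-order coding rate `limsup (log M* - n R*) / √n`, in the extended reals. -/
def secondOrderRate (μ : Measure ℝ) (ν : (n : ℕ) → Measure (Fin n → ℝ)) (s D ε : ℝ) : EReal :=
  limsup (fun n : ℕ => ((1 / Real.sqrt n : ℝ) : EReal) *
    (ENNReal.log ((minCodewords μ ν D ε n : ℕ∞) : ENNReal) -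
      ((n * firstOrderRate s D : ℝ) : EReal))) atTop

/-- The mismatched dispersion `V(σ², ζ) = (ζ - σ⁴) / (4 σ⁴)` for `s = σ²`. -/
def dispersion (s ζ : ℝ) : ℝ := (ζ - s ^ 2) / (4 * s ^ 2)

/-- The complementary cdf of the standard Gaussian. -/
def gaussianQ (x : ℝ) : ℝ := (gaussianReal 0 1).real (Set.Ioi x)

/-- The inverse of `gaussianQ`, in the extended reals, so that `Q⁻¹(0) = ⊤`. -/
def gaussianQInv (ε : ℝ) : EReal := sSup ((fun x : ℝ => (x : EReal)) '' {x | ε ≤ gaussianQ x})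

/-- `M*` is finite for all large `n` and
`log M* = (n/2) log (σ²/D) + √(n V) Q⁻¹(ε) + O(log n)`. -/
def HasSecondOrderExpansion (μ : Measure ℝ) (ν : (n : ℕ) → Measure (Fin n → ℝ))
    (s ζ D ε : ℝ) : Prop :=
  (∀ᶠ n : ℕ in atTop, minCodewords μ ν D ε n ≠ ⊤) ∧
  (fun n : ℕ => Real.log ((minCodewords μ ν D ε n).toNat : ℝ) -
      ((n : ℝ) / 2 * Real.log (s / D) +
        Real.sqrt (n * dispersion s ζ) * (gaussianQInv ε).toReal))
    =O[atTop] (fun n : ℕ => Real.log n)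

end GaussianCodebook

end

/-!
The source enters only through its power. Put `s = σ²`, `R = (1/2) log (s/D)` and let
`logDev s x = ∑ (xᵢ² - s) / (2 s)` be the fluctuation of the power of the source sequence `x`,
a sum of i.i.d. centred terms of variance `V`. For both codebooks a single random codeword covers
`x` within distortion `D` with probability
`exp (-(n R + logDev s x) + O(logDev s x ^ 2 / n + log n))` (`HasCoverEstimate`). Given `x` the `M`
codewords are independent, so the excess-distortion probability is `E[(1 - p(X))^M]` with `p` the
covering probability (`excessDistortionProb_eq`); up to `O(1/√n)` it is
`P[logDev s X > log M - n R + O(log n)]`. The Berry–Esseen theorem and the local linearity of `Q`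
turn this into the expansion of `log M*` (`exists_minCodewords_bounds`). The case `ε = 0` follows
by monotonicity in `ε`, since then `√V Q⁻¹(ε)` is unbounded as `ε → 0`.

The Berry–Esseen theorem is proved by Stein's method (`SteinMethod.berryEsseen`), the indicator
terms being controlled by a concentration inequality for sums of independent variables
(`SteinMethod.measureReal_sum_mem_Icc_le`). It is applied to the squared letters, whose third moment
is the sixth moment of the source; its error `O(1/√n)` shifts `log M*` by `O(1)` only.

The covering estimates are obtained from one standard Gaussian vector `Y`: an i.i.d. codeword is
`√(s - D) Y`, a spherical one is `√(n (s - D)) Y / ‖Y‖` (`sphericalLaw_eq_map`), and by rotation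
invariance only the coordinate `Y₀` along `x` and `‖Y‖²` matter
(`map_inner_normSq_stdGaussianVec`). For the lower bound the covering event contains a window, in
which `Y₀` lies in an interval of length `1/√n` at `√n a` and the other coordinates lie in a ball of
squared radius `n b`. Its probability is `exp ((n/2)(1 - a² - b + log b) + O(log n))`
(`le_stdGaussianVec_window`), and the fixed choice `a² = (s - D)/s`, together with the largest
admissible radius `b`, has the exponent `-(n R + logDev s x)` to first order
(`hasCoverEstimate_of_window`). The upper bounds are Chernoff bounds, for the distortion of an
i.i.d. codeword (`coverProb_iidGaussianLaw_le`) and for a cone around `x` in the spherical case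
(`stdGaussianVec_cone_le`).
-/

namespace SteinMethod

/-! ### Moments and concentration of sums of independent variables -/

section Moments

variable {Ω : Type*} [MeasurableSpace Ω] {P : Measure Ω} [IsProbabilityMeasure P]

lemma integrable_sq_of_integrable_abs_cube {Y : Ω → ℝ} (hY : Measurable Y)
    (h3 : Integrable (fun ω => |Y ω| ^ 3) P) : Integrable (fun ω => Y ω ^ 2) P := by
  refine ((integrable_const (1 : ℝ)).add h3).mono' (by fun_prop) (ae_of_all _ fun ω => ?_)
  simp only [Pi.add_apply, Real.norm_eq_abs, abs_pow]
  have h := abs_nonneg (Y ω)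
  nlinarith [mul_nonneg h (sq_nonneg (|Y ω| - 1)), sq_nonneg (|Y ω| - 1)]

lemma integrable_of_integrable_abs_cube {Y : Ω → ℝ} (hY : Measurable Y)
    (h3 : Integrable (fun ω => |Y ω| ^ 3) P) : Integrable Y P := by
  refine ((integrable_const (1 : ℝ)).add (integrable_sq_of_integrable_abs_cube hY h3)).mono'
    (by fun_prop) (ae_of_all _ fun ω => ?_)
  simp only [Pi.add_apply, Real.norm_eq_abs]
  nlinarith [sq_abs (Y ω), sq_nonneg (|Y ω| - 1)]

lemma memLp_two_of_integrable_abs_cube {Y : Ω → ℝ} (hY : Measurable Y)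
    (h3 : Integrable (fun ω => |Y ω| ^ 3) P) : MemLp Y 2 P :=
  (memLp_two_iff_integrable_sq hY.aestronglyMeasurable).2
    (integrable_sq_of_integrable_abs_cube hY h3)

/-- A special case of Hölder's inequality: `E[Y²] E|Y| ≤ E|Y|³`. -/
lemma integral_sq_mul_integral_abs_le {Y : Ω → ℝ} (hY : Measurable Y)
    (h3 : Integrable (fun ω => |Y ω| ^ 3) P) :
    (∫ ω, Y ω ^ 2 ∂P) * ∫ ω, |Y ω| ∂P ≤ ∫ ω, |Y ω| ^ 3 ∂P := by
  have h2 := integrable_sq_of_integrable_abs_cube hY h3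
  have h1 := integrable_of_integrable_abs_cube hY h3
  set m := ∫ ω, Y ω ^ 2 ∂P with hm
  have hm0 : 0 ≤ m := integral_nonneg fun ω => sq_nonneg _
  obtain ⟨s, hs0, hs⟩ : ∃ s : ℝ, 0 ≤ s ∧ m = s ^ 2 :=
    ⟨√m, Real.sqrt_nonneg _, (Real.sq_sqrt hm0).symm⟩
  -- With `s² = m`: `2 s |Y| ≤ Y² + s²` and `2 |Y|³ ≥ 3 s Y² - s³` pointwise.
  have e1 : ∫ ω, 2 * s * |Y ω| ∂P ≤ ∫ ω, (Y ω ^ 2 + s ^ 2) ∂P := by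
    refine integral_mono (h1.abs.const_mul _) (h2.add (integrable_const _)) fun ω => ?_
    simp only
    nlinarith [sq_nonneg (|Y ω| - s), sq_abs (Y ω)]
  have e2 : ∫ ω, (3 * s * Y ω ^ 2 - s ^ 3) ∂P ≤ ∫ ω, 2 * |Y ω| ^ 3 ∂P := by
    refine integral_mono ((h2.const_mul _).sub (integrable_const _)) (h3.const_mul _) fun ω => ?_
    simp only
    have h := abs_nonneg (Y ω)
    rw [← sq_abs (Y ω)]
    nlinarith [mul_nonneg h (sq_nonneg (|Y ω| - s)), mul_nonneg hs0 (sq_nonneg (|Y ω| - s))]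
  rw [integral_const_mul, integral_add h2 (integrable_const _)] at e1
  rw [integral_const_mul, integral_sub (h2.const_mul _) (integrable_const _),
    integral_const_mul] at e2
  simp only [integral_const, probReal_univ, smul_eq_mul, one_mul, ← hm] at e1 e2
  rw [hs] at e1 e2 ⊢
  nlinarith

end Moments

section Independent

variable {Ω : Type*} [MeasurableSpace Ω] {P : Measure Ω} {ι : Type*} {ξ : ι → Ω → ℝ}

lemma indepFun_sum_erase [DecidableEq ι] (hm : ∀ i, Measurable (ξ i)) (hind : iIndepFun ξ P)
    (s : Finset ι) (i : ι) : IndepFun (ξ i) (fun ω => ∑ j ∈ s.erase i, ξ j ω) P := by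
  have h := (hind.indepFun_finsetSum_of_notMem hm (s := s.erase i) (i := i) (by simp)).symm
  convert h using 1
  ext ω
  simp

/-- An independent centred summand is uncorrelated with a function of the other summands. -/
lemma integral_mul_comp_sum_erase [DecidableEq ι] (hm : ∀ i, Measurable (ξ i))
    (hind : iIndepFun ξ P) (h0 : ∀ i, ∫ ω, ξ i ω ∂P = 0) (s : Finset ι) (i : ι)
    {f : ℝ → ℝ} (hf : Measurable f) :
    ∫ ω, ξ i ω * f (∑ j ∈ s.erase i, ξ j ω) ∂P = 0 := by
  have h := ((indepFun_sum_erase hm hind s i).comp measurable_id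
    hf).integral_fun_mul_eq_mul_integral (hm i).aestronglyMeasurable
    (hf.comp (Finset.measurable_fun_sum _ fun j _ => hm j)).aestronglyMeasurable
  simpa [h0] using h

variable [IsProbabilityMeasure P]

lemma integral_sum_sq (hm : ∀ i, Measurable (ξ i)) (hind : iIndepFun ξ P)
    (h0 : ∀ i, ∫ ω, ξ i ω ∂P = 0) (h3 : ∀ i, Integrable (fun ω => |ξ i ω| ^ 3) P)
    (s : Finset ι) : ∫ ω, (∑ i ∈ s, ξ i ω) ^ 2 ∂P = ∑ i ∈ s, ∫ ω, ξ i ω ^ 2 ∂P := by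
  have hL : ∀ i, MemLp (ξ i) 2 P := fun i => memLp_two_of_integrable_abs_cube (hm i) (h3 i)
  have hv := IndepFun.variance_sum (s := s) (X := ξ) (μ := P) (fun i _ => hL i)
    (fun i _ j _ hij => hind.indepFun hij)
  have hS : MemLp (∑ i ∈ s, ξ i) 2 P := memLp_finsetSum' s fun i _ => hL i
  rw [variance_eq_sub hS] at hv
  have hz : ∫ ω, (∑ i ∈ s, ξ i) ω ∂P = 0 := by
    simp only [Finset.sum_apply]
    rw [integral_finsetSum _ fun i _ => integrable_of_integrable_abs_cube (hm i) (h3 i)]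
    simp [h0]
  rw [hz] at hv
  simp only [variance_eq_sub (hL _), h0] at hv
  simpa using hv

lemma integrable_sum_sq (hm : ∀ i, Measurable (ξ i))
    (h3 : ∀ i, Integrable (fun ω => |ξ i ω| ^ 3) P) (s : Finset ι) :
    Integrable (fun ω => (∑ i ∈ s, ξ i ω) ^ 2) P := by
  have hS : MemLp (fun ω => ∑ i ∈ s, ξ i ω) 2 P :=
    memLp_finsetSum s fun i _ => memLp_two_of_integrable_abs_cube (hm i) (h3 i)
  exact hS.integrable_sq

lemma integral_abs_sum_le_one (hm : ∀ i, Measurable (ξ i)) (hind : iIndepFun ξ P)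
    (h0 : ∀ i, ∫ ω, ξ i ω ∂P = 0) (h3 : ∀ i, Integrable (fun ω => |ξ i ω| ^ 3) P)
    (s : Finset ι) (hv : ∑ i ∈ s, ∫ ω, ξ i ω ^ 2 ∂P ≤ 1) :
    ∫ ω, |∑ i ∈ s, ξ i ω| ∂P ≤ 1 := by
  have hi := integrable_sum_sq hm h3 s
  have h : ∫ ω, |∑ i ∈ s, ξ i ω| ∂P ≤ ∫ ω, (1 / 2 + 1 / 2 * (∑ i ∈ s, ξ i ω) ^ 2) ∂P := by
    refine integral_mono (integrable_finsetSum _ fun i _ =>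
      integrable_of_integrable_abs_cube (hm i) (h3 i)).abs
      ((integrable_const _).add (hi.const_mul _)) fun ω => ?_
    simp only
    nlinarith [sq_abs (∑ i ∈ s, ξ i ω), sq_nonneg (|∑ i ∈ s, ξ i ω| - 1)]
  rw [integral_add (integrable_const _) (hi.const_mul _), integral_const_mul,
    integral_sum_sq hm hind h0 h3] at h
  simp at h
  linarith

variable [DecidableEq ι]

/-- `E[W f(W)]` as a sum of increments of `f`: the starting point of Stein's method. -/
lemma integral_sum_mul_comp (hm : ∀ i, Measurable (ξ i)) (hind : iIndepFun ξ P)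
    (h0 : ∀ i, ∫ ω, ξ i ω ∂P = 0) (h3 : ∀ i, Integrable (fun ω => |ξ i ω| ^ 3) P)
    (s : Finset ι) {f : ℝ → ℝ} (hf : Measurable f) {c : ℝ} (hc : ∀ x, |f x| ≤ c) :
    ∫ ω, (∑ i ∈ s, ξ i ω) * f (∑ i ∈ s, ξ i ω) ∂P =
      ∑ i ∈ s, ∫ ω, ξ i ω * (f (∑ j ∈ s, ξ j ω) - f (∑ j ∈ s.erase i, ξ j ω)) ∂P := by
  have hS : ∀ s : Finset ι, Measurable fun ω => ∑ j ∈ s, ξ j ω :=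
    fun s => Finset.measurable_fun_sum _ fun j _ => hm j
  have hint : ∀ i (t : Finset ι), Integrable (fun ω => ξ i ω * f (∑ j ∈ t, ξ j ω)) P :=
    fun i t => (integrable_of_integrable_abs_cube (hm i) (h3 i)).mul_bdd
      (hf.comp (hS t)).aestronglyMeasurable (ae_of_all _ fun ω => hc _)
  simp only [Finset.sum_mul]
  rw [integral_finsetSum _ fun i _ => hint i s]
  refine Finset.sum_congr rfl fun i _ => ?_
  simp only [mul_sub]
  rw [integral_sub (hint i s) (hint i _), integral_mul_comp_sum_erase hm hind h0 s i hf, sub_zero]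

/-- The mass that a sum of independent variables puts on an interval is at most of the order of the
length of the interval plus the sum of the third absolute moments. On the event that the sum `W`
lies in the interval, `E[W f(W)]` for a function `f` that is increasing with slope one near the
interval picks up the truncated second moments of all summands, whose sum concentrates by
Chebyshev's inequality; and `|f|` is bounded by about half the length of the interval. -/
theorem measureReal_sum_mem_Icc_le (hm : ∀ i, Measurable (ξ i)) (hind : iIndepFun ξ P)
    (h0 : ∀ i, ∫ ω, ξ i ω ∂P = 0) (h3 : ∀ i, Integrable (fun ω => |ξ i ω| ^ 3) P)
    (s : Finset ι) (hv : ∑ i ∈ s, ∫ ω, ξ i ω ^ 2 ∂P ≤ 1)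
    (hv' : 1 / 2 ≤ ∑ i ∈ s, ∫ ω, ξ i ω ^ 2 ∂P) {γ : ℝ} (hγ : 0 < γ)
    (h3γ : ∑ i ∈ s, ∫ ω, |ξ i ω| ^ 3 ∂P ≤ γ) {a b : ℝ} (hab : a ≤ b) :
    P.real {ω | ∑ i ∈ s, ξ i ω ∈ Set.Icc a b} ≤ 2 * (b - a) + 24 * γ := by
  classical
  set δ := 4 * γ with hδ
  have hδ0 : 0 < δ := by positivity
  set c := (b - a) / 2 + δ with hc
  -- Stein's identity is tested against a function of slope one on a neighbourhood of `[a, b]`,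
  -- constant outside of it.
  set f : ℝ → ℝ := fun w => max (a - δ) (min w (b + δ)) - (a + b) / 2 with hf
  have hfm : Measurable f := by fun_prop
  have hfmono : Monotone f := fun x y h => by
    simp only [hf]; gcongr
  have hfc : ∀ x, |f x| ≤ c := fun x => by
    simp only [hf, hc, abs_le]
    constructor
    · have := le_max_left (a - δ) (min x (b + δ)); linarith
    · have : max (a - δ) (min x (b + δ)) ≤ b + δ := max_le (by linarith) (min_le_right _ _)
      linarith
  have hfid : ∀ x, a - δ ≤ x → x ≤ b + δ → f x = x - (a + b) / 2 := fun x h1 h2 => by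
    simp only [hf, min_eq_left h2, max_eq_right h1]
  set η : ℝ → ℝ := fun x => if |x| ≤ δ then x ^ 2 else 0 with hη
  have hηm : Measurable η := by
    refine Measurable.ite (measurableSet_le (by fun_prop) (by fun_prop)) (by fun_prop) (by fun_prop)
  have hη0 : ∀ x, 0 ≤ η x := fun x => by
    simp only [hη]; split_ifs <;> positivity
  have hηle : ∀ x, η x ≤ x ^ 2 := fun x => by
    simp only [hη]; split_ifs
    · exact le_rfl
    · positivity
  have h1 := fun i => integrable_of_integrable_abs_cube (hm i) (h3 i)
  have h2 := fun i => integrable_sq_of_integrable_abs_cube (hm i) (h3 i)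
  have hηi : ∀ i, Integrable (fun ω => η (ξ i ω)) P := fun i =>
    (h2 i).mono' (hηm.comp (hm i)).aestronglyMeasurable (ae_of_all _ fun ω => by
      rw [Real.norm_of_nonneg (hη0 _)]; exact hηle _)
  have hS : ∀ s : Finset ι, Measurable fun ω => ∑ j ∈ s, ξ j ω :=
    fun s => Finset.measurable_fun_sum _ fun j _ => hm j
  set A : Set Ω := {ω | ∑ i ∈ s, ξ i ω ∈ Set.Icc a b} with hA
  have hAm : MeasurableSet A := (hS s) measurableSet_Icc
  set T : Ω → ℝ := fun ω => ∑ i ∈ s, η (ξ i ω) with hT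
  have hTi : Integrable T P := integrable_finsetSum _ fun i _ => hηi i
  -- Upper bound on `E[W f(W)]`.
  have hup : ∫ ω, (∑ i ∈ s, ξ i ω) * f (∑ i ∈ s, ξ i ω) ∂P ≤ c := by
    have hi : Integrable (fun ω => |∑ i ∈ s, ξ i ω|) P :=
      (integrable_finsetSum _ fun i _ => h1 i).abs
    have hc0 : 0 ≤ c := by rw [hc]; linarith
    calc _ ≤ ∫ ω, c * |∑ i ∈ s, ξ i ω| ∂P := by
          refine integral_mono ((integrable_finsetSum _ fun i _ => h1 i).mul_bdd
            (hfm.comp (hS s)).aestronglyMeasurable (ae_of_all _ fun ω => hfc _))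
            (hi.const_mul _) fun ω => ?_
          simp only
          calc _ ≤ |(∑ i ∈ s, ξ i ω) * f (∑ i ∈ s, ξ i ω)| := le_abs_self _
            _ = |f (∑ i ∈ s, ξ i ω)| * |∑ i ∈ s, ξ i ω| := by rw [abs_mul, mul_comm]
            _ ≤ _ := by gcongr; exact hfc _
      _ ≤ c := by
          rw [integral_const_mul]
          exact mul_le_of_le_one_right hc0 (integral_abs_sum_le_one hm hind h0 h3 s hv)
  -- Lower bound on `E[W f(W)]`.
  have hlow : ∫ ω in A, T ω ∂P ≤ ∫ ω, (∑ i ∈ s, ξ i ω) * f (∑ i ∈ s, ξ i ω) ∂P := by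
    rw [integral_sum_mul_comp hm hind h0 h3 s hfm hfc, hT,
      integral_finsetSum _ fun i _ => (hηi i).integrableOn]
    refine Finset.sum_le_sum fun i hi => ?_
    rw [← integral_indicator hAm]
    refine integral_mono ((hηi i).indicator hAm) ?_ fun ω => ?_
    · refine (h1 i).mul_bdd (c := c + c)
        ((hfm.comp (hS _)).sub (hfm.comp (hS _))).aestronglyMeasurable (ae_of_all _ fun ω => ?_)
      exact (norm_sub_le _ _).trans (add_le_add (hfc _) (hfc _))
    · have hsum : ∑ j ∈ s, ξ j ω = ξ i ω + ∑ j ∈ s.erase i, ξ j ω :=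
        (Finset.add_sum_erase s (fun j => ξ j ω) hi).symm
      have hpos : 0 ≤ ξ i ω * (f (∑ j ∈ s, ξ j ω) - f (∑ j ∈ s.erase i, ξ j ω)) := by
        rcases le_total 0 (ξ i ω) with h | h
        · exact mul_nonneg h (sub_nonneg.2 (hfmono (by rw [hsum]; linarith)))
        · exact mul_nonneg_of_nonpos_of_nonpos h (sub_nonpos.2 (hfmono (by rw [hsum]; linarith)))
      by_cases hω : ω ∈ A
      · rw [Set.indicator_of_mem hω]
        simp only [hη]
        split_ifs with hle
        · have hω' : a ≤ ∑ j ∈ s, ξ j ω ∧ ∑ j ∈ s, ξ j ω ≤ b := hω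
          have hle' := abs_le.1 hle
          rw [hfid _ (by linarith) (by linarith), hfid _ (by linarith) (by linarith), hsum]
          apply le_of_eq; ring
        · exact hpos
      · rw [Set.indicator_of_notMem hω]
        exact hpos
  -- `T` concentrates around a mean that is bounded below.
  set m := ∫ ω, T ω ∂P with hmdef
  have hmean : 1 / 4 ≤ m := by
    have : ∀ i, ∫ ω, ξ i ω ^ 2 ∂P - (∫ ω, |ξ i ω| ^ 3 ∂P) / δ ≤ ∫ ω, η (ξ i ω) ∂P := fun i => by
      rw [← integral_div, ← integral_sub (h2 i) ((h3 i).div_const _)]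
      refine integral_mono ((h2 i).sub ((h3 i).div_const _)) (hηi i) fun ω => ?_
      simp only [hη]
      split_ifs with h
      · have : 0 ≤ |ξ i ω| ^ 3 / δ := by positivity
        linarith
      · push Not at h
        have : ξ i ω ^ 2 ≤ |ξ i ω| ^ 3 / δ := by
          rw [le_div_iff₀ hδ0, ← sq_abs, pow_succ |ξ i ω| 2]
          gcongr
        linarith
    rw [hmdef, hT, integral_finsetSum _ fun i _ => hηi i]
    calc 1 / 4 ≤ ∑ i ∈ s, (∫ ω, ξ i ω ^ 2 ∂P - (∫ ω, |ξ i ω| ^ 3 ∂P) / δ) := by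
          rw [Finset.sum_sub_distrib, ← Finset.sum_div]
          have : (∑ i ∈ s, ∫ ω, |ξ i ω| ^ 3 ∂P) / δ ≤ 1 / 4 := by
            rw [div_le_iff₀ hδ0]; linarith
          linarith
      _ ≤ _ := Finset.sum_le_sum fun i _ => this i
  have hηL : ∀ i, MemLp (fun ω => η (ξ i ω)) 2 P := fun i => by
    refine MemLp.of_bound (hηm.comp (hm i)).aestronglyMeasurable (δ ^ 2)
      (ae_of_all _ fun ω => ?_)
    rw [Real.norm_of_nonneg (hη0 _)]
    simp only [hη]
    split_ifs with h
    · rw [← sq_abs]; gcongr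
    · positivity
  have hTL : MemLp T 2 P := memLp_finsetSum s fun i _ => hηL i
  have hvar : ∫ ω, (T ω - m) ^ 2 ∂P ≤ 4 * γ ^ 2 := by
    have e1 := variance_eq_integral (μ := P) hTi.aemeasurable
    have e2 := IndepFun.variance_sum (s := s) (X := fun i ω => η (ξ i ω)) (μ := P)
      (fun i _ => hηL i) (fun i _ j _ hij => (hind.indepFun hij).comp hηm hηm)
    have e3 : (∑ i ∈ s, fun ω => η (ξ i ω)) = T := by ext ω; simp [hT]
    rw [e3] at e2
    rw [← hmdef] at e1
    rw [← e1, e2]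
    calc _ ≤ ∑ i ∈ s, δ * ∫ ω, |ξ i ω| ^ 3 ∂P := by
          refine Finset.sum_le_sum fun i _ => ?_
          refine (variance_le_expectation_sq (hηL i).1).trans ?_
          rw [← integral_const_mul]
          refine integral_mono (hηL i).integrable_sq ((h3 i).const_mul _) fun ω => ?_
          simp only [Pi.pow_apply, hη]
          split_ifs with h
          · calc (ξ i ω ^ 2) ^ 2 = (|ξ i ω| ^ 2) ^ 2 := by rw [sq_abs]
              _ = |ξ i ω| * |ξ i ω| ^ 3 := by ring
              _ ≤ _ := by gcongr
          · simp; positivity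
      _ ≤ 4 * γ ^ 2 := by
          rw [← Finset.mul_sum, hδ]; nlinarith
  have hdev : ∫ ω, |T ω - m| ∂P ≤ 2 * γ := by
    have hTm : MemLp (fun ω => T ω - m) 2 P := hTL.sub (memLp_const m)
    have : ∫ ω, |T ω - m| ∂P ≤ ∫ ω, (γ + (T ω - m) ^ 2 / (4 * γ)) ∂P := by
      refine integral_mono (hTi.sub (integrable_const _)).abs
        ((integrable_const _).add (hTm.integrable_sq.div_const _)) fun ω => ?_
      simp only
      rw [← sub_nonneg]
      have : γ + (T ω - m) ^ 2 / (4 * γ) - |T ω - m| = (|T ω - m| - 2 * γ) ^ 2 / (4 * γ) := by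
        rw [← sq_abs (T ω - m)]; field_simp; ring
      rw [this]; positivity
    rw [integral_add (integrable_const _) (hTm.integrable_sq.div_const _), integral_div] at this
    have h4 : (∫ ω, (T ω - m) ^ 2 ∂P) / (4 * γ) ≤ γ := by
      rw [div_le_iff₀ (by positivity)]; nlinarith
    simp at this
    linarith
  have hAT : m * P.real A - 2 * γ ≤ ∫ ω in A, T ω ∂P := by
    have e1 : ∫ ω in A, T ω ∂P = ∫ ω in A, (T ω - m) ∂P + m * P.real A := by
      rw [integral_sub hTi.integrableOn (integrable_const _).integrableOn]
      simp [mul_comm]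
    have e2 : -∫ ω, |T ω - m| ∂P ≤ ∫ ω in A, (T ω - m) ∂P := by
      have h := (norm_integral_le_integral_norm (μ := P.restrict A) fun ω => T ω - m).trans
        (setIntegral_le_integral (hTi.sub (integrable_const _)).norm
          (ae_of_all _ fun ω => norm_nonneg _))
      exact (abs_le.1 h).1
    linarith
  have hP : 0 ≤ P.real A := measureReal_nonneg
  nlinarith

end Independent

/-! ### The Gaussian distribution function and Stein's equation -/

/-- The cumulative distribution function of the standard Gaussian. -/
noncomputable def gaussianCDF (z : ℝ) : ℝ := (gaussianReal 0 1).real (Set.Iic z)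

/-- The density of the standard Gaussian. -/
noncomputable def stdPDF (x : ℝ) : ℝ := gaussianPDFReal 0 1 x

lemma stdPDF_eq (x : ℝ) : stdPDF x = (√(2 * Real.pi))⁻¹ * Real.exp (-x ^ 2 / 2) := by
  simp [stdPDF, gaussianPDFReal]

lemma stdPDF_pos (x : ℝ) : 0 < stdPDF x := gaussianPDFReal_pos _ _ _ one_ne_zero

lemma stdPDF_neg (x : ℝ) : stdPDF (-x) = stdPDF x := by simp [stdPDF_eq]

lemma integrable_stdPDF : Integrable stdPDF := integrable_gaussianPDFReal 0 1

lemma continuous_stdPDF : Continuous stdPDF := by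
  have : stdPDF = fun x => (√(2 * Real.pi))⁻¹ * Real.exp (-x ^ 2 / 2) := funext stdPDF_eq
  rw [this]; fun_prop

lemma hasDerivAt_stdPDF (x : ℝ) : HasDerivAt stdPDF (-x * stdPDF x) x := by
  have : stdPDF = fun x => (√(2 * Real.pi))⁻¹ * Real.exp (-x ^ 2 / 2) := funext stdPDF_eq
  rw [this]
  have h : HasDerivAt (fun x : ℝ => -x ^ 2 / 2) (-x) x := by
    have := ((hasDerivAt_pow 2 x).neg).div_const 2
    exact this.congr_deriv (by push_cast; ring)
  exact (h.exp.const_mul (√(2 * Real.pi))⁻¹).congr_deriv (by ring)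

lemma gaussianCDF_eq_integral (z : ℝ) : gaussianCDF z = ∫ x in Set.Iic z, stdPDF x := by
  rw [gaussianCDF, measureReal_def, gaussianReal_apply_eq_integral _ one_ne_zero,
    ENNReal.toReal_ofReal (integral_nonneg fun x => gaussianPDFReal_nonneg _ _ _)]
  rfl

lemma gaussianCDF_nonneg (z : ℝ) : 0 ≤ gaussianCDF z := measureReal_nonneg

lemma gaussianCDF_le_one (z : ℝ) : gaussianCDF z ≤ 1 := measureReal_le_one

lemma gaussianCDF_mono : Monotone gaussianCDF := fun _ _ h =>
  measureReal_mono (Set.Iic_subset_Iic.2 h)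

lemma hasDerivAt_gaussianCDF (z : ℝ) : HasDerivAt gaussianCDF (stdPDF z) z := by
  have h : gaussianCDF = fun z => gaussianCDF 0 + ∫ x in (0 : ℝ)..z, stdPDF x := by
    ext z
    rw [← intervalIntegral.integral_Iic_sub_Iic integrable_stdPDF.integrableOn
      integrable_stdPDF.integrableOn, ← gaussianCDF_eq_integral, ← gaussianCDF_eq_integral]
    ring
  rw [h]
  exact (intervalIntegral.integral_hasDerivAt_right integrable_stdPDF.intervalIntegrable
    continuous_stdPDF.aestronglyMeasurable.stronglyMeasurableAtFilter
    continuous_stdPDF.continuousAt).const_add _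

lemma one_sub_gaussianCDF (z : ℝ) : 1 - gaussianCDF z = (gaussianReal 0 1).real (Set.Ioi z) := by
  have := measureReal_add_measureReal_compl (μ := gaussianReal 0 1) (measurableSet_Iic (a := z))
  rw [Set.compl_Iic, probReal_univ] at this
  rw [gaussianCDF]; linarith

lemma gaussianCDF_neg (z : ℝ) : gaussianCDF (-z) = 1 - gaussianCDF z := by
  rw [one_sub_gaussianCDF, gaussianCDF]
  have h := gaussianReal_map_neg (μ := 0) (v := 1)
  rw [neg_zero] at h
  conv_lhs => rw [← h]
  rw [map_measureReal_apply (by fun_prop) measurableSet_Iic]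
  have := nullSingletonClass_gaussianReal (μ := 0) (v := 1) one_ne_zero
  have : (fun x : ℝ => -x) ⁻¹' Set.Iic (-z) = Set.Ici z := by ext; simp
  rw [this]
  exact measureReal_congr Ioi_ae_eq_Ici.symm

/-- The Mills ratio bound, by integrating `-x φ(x) = φ'(x)` over the tail. -/
lemma neg_mul_gaussianCDF_le {w : ℝ} : -w * gaussianCDF w ≤ stdPDF w := by
  have hlim : Tendsto stdPDF atBot (𝓝 0) := by
    have : stdPDF = fun x => (√(2 * Real.pi))⁻¹ * Real.exp (-x ^ 2 / 2) := funext stdPDF_eq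
    rw [this, ← mul_zero (√(2 * Real.pi))⁻¹]
    refine Tendsto.const_mul _ (Real.tendsto_exp_atBot.comp ?_)
    have h : Tendsto (fun x : ℝ => x ^ 2) atBot atTop := by
      have := (tendsto_pow_atTop (α := ℝ) two_ne_zero).comp tendsto_neg_atBot_atTop
      simpa [Function.comp_def] using this
    have h2 := (tendsto_neg_atTop_atBot.comp h).atBot_div_const (r := (2 : ℝ)) two_pos
    simpa [Function.comp_def] using h2
  have hint : Integrable (fun x : ℝ => -x * stdPDF x) := by
    have := (integrable_mul_exp_neg_mul_sq (b := 1 / 2) (by norm_num)).const_mul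
      (-(√(2 * Real.pi))⁻¹)
    refine this.congr (ae_of_all _ fun x => ?_)
    simp only [stdPDF_eq]
    rw [show -x ^ 2 / 2 = -(1 / 2) * x ^ 2 by ring]; ring
  have h := integral_Iic_of_hasDerivAt_of_tendsto (a := w) (f := stdPDF) (m := 0)
    continuous_stdPDF.continuousWithinAt (fun x _ => hasDerivAt_stdPDF x) hint.integrableOn hlim
  rw [sub_zero] at h
  rw [← h, gaussianCDF_eq_integral, ← integral_const_mul]
  refine setIntegral_mono_on (integrable_stdPDF.const_mul _).integrableOn hint.integrableOn
    measurableSet_Iic fun x hx => ?_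
  have := stdPDF_pos x
  have hx' : x ≤ w := hx
  gcongr

/-- The quotient of the distribution function and the density of the standard Gaussian. -/
noncomputable def millsRatio (w : ℝ) : ℝ := gaussianCDF w / stdPDF w

lemma millsRatio_nonneg (w : ℝ) : 0 ≤ millsRatio w :=
  div_nonneg (gaussianCDF_nonneg w) (stdPDF_pos w).le

lemma hasDerivAt_millsRatio (w : ℝ) : HasDerivAt millsRatio (1 + w * millsRatio w) w := by
  have h := (hasDerivAt_gaussianCDF w).div (hasDerivAt_stdPDF w) (stdPDF_pos w).ne'
  refine h.congr_deriv ?_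
  have := (stdPDF_pos w).ne'
  rw [millsRatio]; field_simp; ring

lemma neg_mul_millsRatio_le_one (w : ℝ) : -w * millsRatio w ≤ 1 := by
  rw [millsRatio, ← mul_div_assoc, div_le_one (stdPDF_pos w)]
  exact neg_mul_gaussianCDF_le

lemma millsRatio_mul_neg (w : ℝ) :
    millsRatio w * gaussianCDF (-w) = millsRatio (-w) * gaussianCDF w := by
  rw [millsRatio, millsRatio, stdPDF_neg]; ring

lemma monotone_millsRatio : Monotone millsRatio := by
  refine monotone_of_deriv_nonneg (fun w => (hasDerivAt_millsRatio w).differentiableAt) fun w => ?_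
  rw [(hasDerivAt_millsRatio w).deriv]
  have := neg_mul_millsRatio_le_one w
  linarith

lemma millsRatio_le_three {w : ℝ} (hw : w ≤ 0) : millsRatio w ≤ 3 := by
  refine (monotone_millsRatio hw).trans ?_
  rw [millsRatio, div_le_iff₀ (stdPDF_pos 0)]
  refine (gaussianCDF_le_one 0).trans ?_
  have h : √(2 * Real.pi) ≤ 3 := by
    rw [Real.sqrt_le_left (by norm_num)]; linarith [Real.pi_lt_four, Real.pi_lt_d2]
  simp only [stdPDF_eq]
  simp only [ne_eq, OfNat.ofNat_ne_zero, not_false_eq_true, zero_pow, neg_zero, zero_div,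
    Real.exp_zero, mul_one]
  rw [← div_eq_mul_inv, le_div_iff₀ (by positivity)]
  linarith

/-- Bounds on the left branch of the Stein solution; the right branch is its reflection. -/
lemma millsRatio_mul_gaussianCDF_neg_bounds {w z : ℝ} (h : w ≤ z) :
    0 ≤ millsRatio w * gaussianCDF (-z) ∧ millsRatio w * gaussianCDF (-z) ≤ 3 ∧
      |w * (millsRatio w * gaussianCDF (-z))| ≤ 1 := by
  have h0 := gaussianCDF_nonneg (-z)
  have h1 := gaussianCDF_le_one (-z)
  have hr := millsRatio_nonneg w
  refine ⟨mul_nonneg hr h0, ?_⟩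
  rcases le_total w 0 with hw | hw
  · refine ⟨(mul_le_of_le_one_right hr h1).trans (millsRatio_le_three hw), ?_⟩
    have h2 := neg_mul_millsRatio_le_one w
    have h3 : 0 ≤ -w * millsRatio w := mul_nonneg (by linarith) hr
    rw [abs_le]; constructor <;> nlinarith
  · have h2 : millsRatio w * gaussianCDF (-z) ≤ millsRatio (-w) := by
      calc _ ≤ millsRatio w * gaussianCDF (-w) := by
            gcongr; exact gaussianCDF_mono (by linarith)
        _ = millsRatio (-w) * gaussianCDF w := millsRatio_mul_neg w
        _ ≤ _ := mul_le_of_le_one_right (millsRatio_nonneg _) (gaussianCDF_le_one _)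
    refine ⟨h2.trans (millsRatio_le_three (by linarith)), ?_⟩
    have h3 := neg_mul_millsRatio_le_one (-w)
    rw [neg_neg] at h3
    rw [abs_of_nonneg (by positivity)]
    exact (mul_le_mul_of_nonneg_left h2 hw).trans h3

/-- The bounded solution `f` of Stein's equation `f'(w) - w f(w) = 1{w ≤ z} - Φ(z)`. -/
noncomputable def steinSol (z w : ℝ) : ℝ :=
  if w ≤ z then millsRatio w * gaussianCDF (-z) else millsRatio (-w) * gaussianCDF z

/-- The derivative of `steinSol z`, extended to the point `z` by Stein's equation. -/
noncomputable def steinDeriv (z w : ℝ) : ℝ :=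
  w * steinSol z w + (if w ≤ z then 1 else 0) - gaussianCDF z

lemma steinSol_of_ge {z w : ℝ} (h : z ≤ w) : steinSol z w = millsRatio (-w) * gaussianCDF z := by
  rcases h.eq_or_lt with rfl | h
  · rw [steinSol, if_pos le_rfl, millsRatio_mul_neg]
  · rw [steinSol, if_neg (not_le.2 h)]

lemma abs_steinSol_le (z w : ℝ) : |steinSol z w| ≤ 3 := by
  rcases le_total w z with h | h
  · rw [steinSol, if_pos h]
    obtain ⟨h1, h2, -⟩ := millsRatio_mul_gaussianCDF_neg_bounds h
    rwa [abs_of_nonneg h1]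
  · obtain ⟨h1, h2, -⟩ := millsRatio_mul_gaussianCDF_neg_bounds (neg_le_neg h)
    rw [neg_neg] at h1 h2
    rwa [steinSol_of_ge h, abs_of_nonneg h1]

lemma abs_steinDeriv_le (z w : ℝ) : |steinDeriv z w| ≤ 2 := by
  have h0 := gaussianCDF_nonneg z
  have h1 := gaussianCDF_le_one z
  rw [steinDeriv]
  split_ifs with h
  · obtain ⟨-, -, h3⟩ := millsRatio_mul_gaussianCDF_neg_bounds h
    rw [steinSol, if_pos h]
    rw [abs_le] at h3 ⊢
    constructor <;> linarith
  · obtain ⟨-, -, h3⟩ := millsRatio_mul_gaussianCDF_neg_bounds (neg_le_neg (not_le.1 h).le)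
    rw [neg_neg] at h3
    rw [steinSol_of_ge (not_le.1 h).le]
    rw [abs_le] at h3 ⊢
    constructor <;> linarith

lemma hasDerivAt_steinSol {z w : ℝ} (h : w ≠ z) : HasDerivAt (steinSol z) (steinDeriv z w) w := by
  rcases lt_or_gt_of_ne h with h | h
  · have h1 := (hasDerivAt_millsRatio w).mul_const (gaussianCDF (-z))
    refine (h1.congr_of_eventuallyEq ?_).congr_deriv ?_
    · filter_upwards [Iio_mem_nhds h] with x hx
      rw [steinSol, if_pos (le_of_lt hx)]
    · rw [steinDeriv, steinSol, if_pos h.le, if_pos h.le, gaussianCDF_neg]; ring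
  · have h1 := ((hasDerivAt_millsRatio (-w)).comp w (hasDerivAt_neg w)).mul_const (gaussianCDF z)
    refine (h1.congr_of_eventuallyEq ?_).congr_deriv ?_
    · filter_upwards [Ioi_mem_nhds h] with x hx
      rw [steinSol_of_ge (le_of_lt hx)]; rfl
    · rw [steinDeriv, steinSol_of_ge (le_of_lt h), if_neg (not_le.2 h)]; ring

lemma continuous_steinSol (z : ℝ) : Continuous (steinSol z) := by
  have hc : Continuous millsRatio :=
    continuous_iff_continuousAt.2 fun w => (hasDerivAt_millsRatio w).continuousAt
  refine Continuous.if_le (by fun_prop) (by fun_prop) continuous_id continuous_const fun x hx => ?_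
  have hx' : x = z := hx
  rw [hx', millsRatio_mul_neg]

lemma measurable_steinDeriv (z : ℝ) : Measurable (steinDeriv z) := by
  have := (continuous_steinSol z).measurable
  exact ((measurable_id.mul this).add (Measurable.ite measurableSet_Iic measurable_const
    measurable_const)).sub_const _

lemma abs_steinSol_sub_le (z x y : ℝ) : |steinSol z y - steinSol z x| ≤ 2 * |y - x| := by
  -- The solution is differentiable on both sides of `z`, and continuous there.
  have key : ∀ x y : ℝ, x ≤ y → (y ≤ z ∨ z ≤ x) →
      |steinSol z y - steinSol z x| ≤ 2 * (y - x) := fun x y hxy hz => by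
    rcases hxy.eq_or_lt with rfl | hlt
    · simp
    obtain ⟨c, hc, hd⟩ := exists_hasDerivAt_eq_slope (steinSol z) (steinDeriv z) hlt
      (continuous_steinSol z).continuousOn fun c hc => hasDerivAt_steinSol (by
        rcases hz with h | h
        · exact (hc.2.trans_le h).ne
        · exact (h.trans_lt hc.1).ne')
    have hpos : 0 < y - x := sub_pos.2 hlt
    have h2 := abs_steinDeriv_le z c
    rwa [hd, abs_div, abs_of_pos hpos, div_le_iff₀ hpos] at h2
  have key2 : ∀ x y : ℝ, x ≤ y → |steinSol z y - steinSol z x| ≤ 2 * (y - x) := fun x y hxy => by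
    rcases le_total y z with h | h
    · exact key x y hxy (Or.inl h)
    rcases le_total z x with h' | h'
    · exact key x y hxy (Or.inr h')
    have h1 := key x z h' (Or.inl le_rfl)
    have h2 := key z y h (Or.inr le_rfl)
    have h3 := abs_sub_le (steinSol z y) (steinSol z z) (steinSol z x)
    linarith
  rcases le_total x y with h | h
  · rw [abs_of_nonneg (sub_nonneg.2 h)]; exact key2 x y h
  · rw [abs_sub_comm, abs_sub_comm y, abs_of_nonneg (sub_nonneg.2 h)]; exact key2 y x h

/-- The indicator accounts for the jump of `steinDeriv z` at `z`. -/
lemma abs_steinDeriv_add_sub_le (z w a : ℝ) :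
    |steinDeriv z (w + a) - steinDeriv z w| ≤
      (2 * |w| + 3) * |a| + if |w - z| ≤ |a| then 1 else 0 := by
  have e : steinDeriv z (w + a) - steinDeriv z w =
      w * (steinSol z (w + a) - steinSol z w) + a * steinSol z (w + a) +
        ((if w + a ≤ z then 1 else 0) - if w ≤ z then 1 else 0) := by
    simp only [steinDeriv]; ring
  have h1 : |w * (steinSol z (w + a) - steinSol z w)| ≤ 2 * |w| * |a| := by
    rw [abs_mul]
    have := abs_steinSol_sub_le z w (w + a)
    rw [add_sub_cancel_left] at this
    nlinarith [abs_nonneg w]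
  have h2 : |a * steinSol z (w + a)| ≤ 3 * |a| := by
    rw [abs_mul, mul_comm]; gcongr; exact abs_steinSol_le _ _
  have h3 : |(if w + a ≤ z then (1 : ℝ) else 0) - if w ≤ z then 1 else 0| ≤
      if |w - z| ≤ |a| then 1 else 0 := by
    by_cases hc : |w - z| ≤ |a|
    · rw [if_pos hc]; split_ifs <;> simp
    · rw [if_neg hc]
      have : (w + a ≤ z ↔ w ≤ z) := by
        push Not at hc
        rcases abs_cases (w - z) with ⟨h, _⟩ | ⟨h, _⟩ <;>
          rcases abs_cases a with ⟨h', _⟩ | ⟨h', _⟩ <;> constructor <;> intro <;> linarith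
      simp [this]
  rw [e]
  refine (abs_add_three _ _ _).trans ?_
  linarith

/-- A second-order Taylor bound for the Stein solution; it degrades to a first-order bound for the
increments that may cross the kink at `z`. -/
lemma abs_steinSol_add_sub_le (z w a : ℝ) :
    |steinSol z (w + a) - steinSol z w - a * steinDeriv z w| ≤
      |a| * ((2 * |w| + 3) * |a| + 4 * if |w - z| ≤ |a| then 1 else 0) := by
  by_cases hc : |w - z| ≤ |a|
  · rw [if_pos hc]
    have h1 := abs_steinSol_sub_le z w (w + a)
    rw [add_sub_cancel_left] at h1
    have h2 : |a * steinDeriv z w| ≤ 2 * |a| := by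
      rw [abs_mul, mul_comm]; gcongr; exact abs_steinDeriv_le _ _
    refine (abs_sub _ _).trans ?_
    have : 0 ≤ |a| * ((2 * |w| + 3) * |a|) := by positivity
    linarith
  · rw [if_neg hc]
    push Not at hc
    have hd : ∀ t ∈ Metric.closedBall (0 : ℝ) |a|, HasDerivWithinAt
        (fun t => steinSol z (w + t) - t * steinDeriv z w)
        (steinDeriv z (w + t) - steinDeriv z w) (Metric.closedBall (0 : ℝ) |a|) t := fun t ht => by
      have ht' : |t| ≤ |a| := by simpa using ht
      have hne : w + t ≠ z := fun h => by
        have : w - z = -t := by linarith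
        rw [this, abs_neg] at hc; linarith
      have h1 := (hasDerivAt_steinSol hne).comp_const_add w t
      have h2 := (hasDerivAt_id t).mul_const (steinDeriv z w)
      exact ((h1.sub h2).congr_deriv (by simp)).hasDerivWithinAt
    have hb : ∀ t ∈ Metric.closedBall (0 : ℝ) |a|,
        ‖steinDeriv z (w + t) - steinDeriv z w‖ ≤ (2 * |w| + 3) * |a| := fun t ht => by
      have ht' : |t| ≤ |a| := by simpa using ht
      have := abs_steinDeriv_add_sub_le z w t
      rw [if_neg (by push Not; linarith), add_zero] at this
      exact this.trans (by gcongr)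
    have h := (convex_closedBall (0 : ℝ) |a|).norm_image_sub_le_of_norm_hasDerivWithin_le hd hb
      (x := 0) (y := a) (by simp) (by simp)
    simp only [add_zero, zero_mul, sub_zero, Real.norm_eq_abs] at h
    rw [sub_right_comm]
    linarith

/-! ### The Berry–Esseen theorem -/

section BerryEsseen

variable {Ω : Type*} [MeasurableSpace Ω] {P : Measure Ω} [IsProbabilityMeasure P]

/-- For independent `X` and `U`, a concentration bound for `U` is integrated over the random radius
`|X|`. -/
lemma integral_mul_indicator_le {X U : Ω → ℝ} (hX : Measurable X) (hU : Measurable U)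
    (hXU : IndepFun X U P) {z γ : ℝ}
    (hconc : ∀ r, 0 ≤ r → P.real {ω | |U ω - z| ≤ r} ≤ 4 * r + 24 * γ) {h : ℝ → ℝ}
    (hh : Measurable h) (h0 : ∀ x, 0 ≤ h x) (hi : Integrable (fun ω => h (X ω)) P)
    (hi' : Integrable (fun ω => h (X ω) * |X ω|) P) :
    ∫ ω, h (X ω) * (if |U ω - z| ≤ |X ω| then 1 else 0) ∂P ≤
      4 * ∫ ω, h (X ω) * |X ω| ∂P + 24 * γ * ∫ ω, h (X ω) ∂P := by
  have hprod := (indepFun_iff_map_prod_eq_prod_map_map hX.aemeasurable hU.aemeasurable).1 hXU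
  set F : ℝ × ℝ → ℝ := fun p => h p.1 * (if |p.2 - z| ≤ |p.1| then 1 else 0) with hF
  have hFm : Measurable F := (hh.comp measurable_fst).mul (Measurable.ite
    (measurableSet_le (by fun_prop) (by fun_prop)) measurable_const measurable_const)
  have := Measure.isProbabilityMeasure_map (μ := P) hX.aemeasurable
  have := Measure.isProbabilityMeasure_map (μ := P) hU.aemeasurable
  have hiX : Integrable h (P.map X) :=
    (integrable_map_measure hh.aestronglyMeasurable hX.aemeasurable).2 hi
  have hiX' : Integrable (fun x => h x * |x|) (P.map X) :=
    (integrable_map_measure (hh.mul (by fun_prop)).aestronglyMeasurable hX.aemeasurable).2 hi'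
  have hFi : Integrable F ((P.map X).prod (P.map U)) := by
    refine (hiX.comp_fst (P.map U)).mono' hFm.aestronglyMeasurable (ae_of_all _ fun p => ?_)
    simp only [hF]
    rw [Real.norm_of_nonneg (mul_nonneg (h0 _) (by split_ifs <;> norm_num))]
    split_ifs
    · simp
    · simpa using h0 _
  have e : ∫ ω, h (X ω) * (if |U ω - z| ≤ |X ω| then 1 else 0) ∂P =
      ∫ x, ∫ u, F (x, u) ∂(P.map U) ∂(P.map X) := by
    rw [← integral_prod F hFi, ← hprod, integral_map (hX.prodMk hU).aemeasurable
      hFm.aestronglyMeasurable]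
  have e2 : ∫ x, (h x * (4 * |x| + 24 * γ)) ∂(P.map X) =
      4 * ∫ ω, h (X ω) * |X ω| ∂P + 24 * γ * ∫ ω, h (X ω) ∂P := by
    rw [← integral_map (f := fun x => h x * |x|) hX.aemeasurable
      (hh.mul (by fun_prop)).aestronglyMeasurable,
      ← integral_map hX.aemeasurable hh.aestronglyMeasurable, ← integral_const_mul,
      ← integral_const_mul, ← integral_add (hiX'.const_mul _) (hiX.const_mul _)]
    congr 1; ext x; ring
  rw [e, ← e2]
  refine integral_mono hFi.integral_prod_left ?_ fun x => ?_
  · refine ((hiX'.const_mul 4).add (hiX.const_mul (24 * γ))).congr (ae_of_all _ fun x => ?_)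
    simp only [Pi.add_apply]; ring
  · simp only [hF]
    rw [integral_const_mul]
    refine mul_le_mul_of_nonneg_left ?_ (h0 x)
    have hs : MeasurableSet {u : ℝ | |u - z| ≤ |x|} := measurableSet_le (by fun_prop) (by fun_prop)
    have e3 : ∫ u, (if |u - z| ≤ |x| then (1 : ℝ) else 0) ∂(P.map U) =
        P.real {ω | |U ω - z| ≤ |x|} := by
      have : (fun u => if |u - z| ≤ |x| then (1 : ℝ) else 0) =
          Set.indicator {u : ℝ | |u - z| ≤ |x|} 1 := by
        ext u; simp [Set.indicator_apply]
      rw [this, integral_indicator_one hs, map_measureReal_apply hU hs]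
      rfl
    rw [e3]
    exact hconc _ (abs_nonneg _)

variable {ι : Type*} [DecidableEq ι] {ξ : ι → Ω → ℝ}

/-- The contribution of one summand to `E[W f(W)] - E[f'(W)]` for the Stein solution `f`. The bound
`1 / 2` on its variance leaves enough variance in the other summands for the concentration
inequality. -/
lemma abs_integral_steinSol_increment_le (hm : ∀ i, Measurable (ξ i)) (hind : iIndepFun ξ P)
    (h0 : ∀ i, ∫ ω, ξ i ω ∂P = 0) (h3 : ∀ i, Integrable (fun ω => |ξ i ω| ^ 3) P)
    (s : Finset ι) (hv : ∑ i ∈ s, ∫ ω, ξ i ω ^ 2 ∂P = 1)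
    {γ : ℝ} (hγ : 0 < γ) (h3γ : ∑ i ∈ s, ∫ ω, |ξ i ω| ^ 3 ∂P ≤ γ) {i : ι} (his : i ∈ s)
    (hi2 : ∫ ω, ξ i ω ^ 2 ∂P ≤ 1 / 2) (z : ℝ) :
    |∫ ω, ξ i ω * (steinSol z (∑ j ∈ s, ξ j ω) - steinSol z (∑ j ∈ s.erase i, ξ j ω)) ∂P -
        (∫ ω, ξ i ω ^ 2 ∂P) * ∫ ω, steinDeriv z (∑ j ∈ s, ξ j ω) ∂P| ≤
      30 * ∫ ω, |ξ i ω| ^ 3 ∂P + 120 * γ * ∫ ω, ξ i ω ^ 2 ∂P := by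
  set X := ξ i with hXdef
  set U : Ω → ℝ := fun ω => ∑ j ∈ s.erase i, ξ j ω with hUdef
  set m := ∫ ω, X ω ^ 2 ∂P with hmdef
  have hXm : Measurable X := hm i
  have hUm : Measurable U := Finset.measurable_fun_sum _ fun j _ => hm j
  have hS : ∀ ω, ∑ j ∈ s, ξ j ω = U ω + X ω := fun ω =>
    (Finset.sum_erase_add s (fun j => ξ j ω) his).symm
  simp only [hS]
  have hXU : IndepFun X U P := indepFun_sum_erase hm hind s i
  have hX3 : Integrable (fun ω => |X ω| ^ 3) P := h3 i
  have hX2 : Integrable (fun ω => X ω ^ 2) P := integrable_sq_of_integrable_abs_cube hXm hX3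
  have hX1 : Integrable X P := integrable_of_integrable_abs_cube hXm hX3
  have hU1 : Integrable U P := integrable_finsetSum _ fun j _ =>
    integrable_of_integrable_abs_cube (hm j) (h3 j)
  have hm0 : 0 ≤ m := integral_nonneg fun ω => sq_nonneg _
  have hvs : ∑ j ∈ s.erase i, ∫ ω, ξ j ω ^ 2 ∂P = 1 - m := by
    rw [← hv, ← Finset.add_sum_erase s _ his]; simp [hmdef, hXdef]
  have h3s : ∑ j ∈ s.erase i, ∫ ω, |ξ j ω| ^ 3 ∂P ≤ γ :=
    (Finset.sum_le_sum_of_subset_of_nonneg (Finset.erase_subset _ _)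
      fun j _ _ => integral_nonneg fun ω => by positivity).trans h3γ
  have hEU : ∫ ω, |U ω| ∂P ≤ 1 := integral_abs_sum_le_one hm hind h0 h3 _ (by rw [hvs]; linarith)
  have hconc : ∀ r, 0 ≤ r → P.real {ω | |U ω - z| ≤ r} ≤ 4 * r + 24 * γ := fun r hr => by
    have := measureReal_sum_mem_Icc_le hm hind h0 h3 (s.erase i) (by rw [hvs]; linarith)
      (by rw [hvs]; linarith) hγ h3s (a := z - r) (b := z + r) (by linarith)
    have e : {ω | |U ω - z| ≤ r} = {ω | U ω ∈ Set.Icc (z - r) (z + r)} := by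
      ext ω
      simp only [Set.mem_ofPred_eq, Set.mem_Icc, abs_le]
      constructor <;> rintro ⟨h, h'⟩ <;> constructor <;> linarith
    rw [e]; linarith
  set β := ∫ ω, |X ω| ^ 3 ∂P with hβ
  have hmβ : m * ∫ ω, |X ω| ∂P ≤ β := integral_sq_mul_integral_abs_le hXm hX3
  set I : Ω → ℝ := fun ω => if |U ω - z| ≤ |X ω| then 1 else 0 with hI
  have hIm : Measurable I := Measurable.ite (measurableSet_le (by fun_prop) (by fun_prop))
    measurable_const measurable_const
  have hI1 : ∀ ω, ‖I ω‖ ≤ 1 := fun ω => by simp only [hI]; split_ifs <;> simp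
  have hXX : ∀ ω, X ω ^ 2 * |X ω| = |X ω| ^ 3 := fun ω => by rw [← sq_abs]; ring
  have hI2 : ∫ ω, X ω ^ 2 * I ω ∂P ≤ 4 * β + 24 * γ * m := by
    have := integral_mul_indicator_le (h := fun x => x ^ 2) hXm hUm hXU hconc (by fun_prop)
      (fun x => sq_nonneg x) hX2 (hX3.congr (ae_of_all _ fun ω => (hXX ω).symm))
    simpa only [hXX] using this
  have hI0 : ∫ ω, I ω ∂P ≤ 4 * ∫ ω, |X ω| ∂P + 24 * γ := by
    have := integral_mul_indicator_le (h := fun _ => 1) hXm hUm hXU hconc (by fun_prop)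
      (fun x => zero_le_one) (integrable_const _) (by simpa using hX1.abs)
    simpa [hI] using this
  have hsf := continuous_steinSol z
  have hsd := measurable_steinDeriv z
  -- Independence of `U` and `X`.
  have hind2 : ∫ ω, X ω ^ 2 * steinDeriv z (U ω) ∂P = m * ∫ ω, steinDeriv z (U ω) ∂P :=
    (hXU.comp (measurable_id.pow_const 2) hsd).integral_fun_mul_eq_mul_integral
      (hXm.pow_const 2).aestronglyMeasurable (hsd.comp hUm).aestronglyMeasurable
  have hiU : ∀ {k : Ω → ℝ}, Measurable k → Integrable (fun ω => steinDeriv z (k ω)) P :=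
    fun hk => Integrable.of_bound (hsd.comp hk).aestronglyMeasurable 2
      (ae_of_all _ fun ω => abs_steinDeriv_le z _)
  have habs : IndepFun (fun ω => |X ω|) (fun ω => |U ω|) P :=
    hXU.comp (φ := fun x => |x|) (ψ := fun x => |x|) (by fun_prop) (by fun_prop)
  have habs3 : IndepFun (fun ω => |X ω| ^ 3) (fun ω => |U ω|) P :=
    hXU.comp (φ := fun x => |x| ^ 3) (ψ := fun x => |x|) (by fun_prop) (by fun_prop)
  have hE1 : ∫ ω, |X ω| * |U ω| ∂P ≤ ∫ ω, |X ω| ∂P := by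
    rw [habs.integral_fun_mul_eq_mul_integral hX1.abs.1 hU1.abs.1]
    exact mul_le_of_le_one_right (integral_nonneg fun ω => abs_nonneg _) hEU
  have hE3 : ∫ ω, |X ω| ^ 3 * |U ω| ∂P ≤ β := by
    rw [habs3.integral_fun_mul_eq_mul_integral hX3.1 hU1.abs.1]
    exact mul_le_of_le_one_right (integral_nonneg fun ω => by positivity) hEU
  have hiE1 : Integrable (fun ω => |X ω| * |U ω|) P := habs.integrable_mul hX1.abs hU1.abs
  have hiE3 : Integrable (fun ω => |X ω| ^ 3 * |U ω|) P := habs3.integrable_mul hX3 hU1.abs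
  have hiI2 : Integrable (fun ω => X ω ^ 2 * I ω) P :=
    hX2.mul_bdd hIm.aestronglyMeasurable (ae_of_all _ hI1)
  have hiI : Integrable I P := Integrable.of_bound hIm.aestronglyMeasurable 1 (ae_of_all _ hI1)
  -- Second-order expansion of `f` at `U`.
  have hA : |∫ ω, X ω * (steinSol z (U ω + X ω) - steinSol z (U ω)) ∂P -
      ∫ ω, X ω ^ 2 * steinDeriv z (U ω) ∂P| ≤ 5 * β + 4 * (4 * β + 24 * γ * m) := by
    have hi1 : Integrable (fun ω => X ω * (steinSol z (U ω + X ω) - steinSol z (U ω))) P := by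
      refine hX1.mul_bdd (c := 3 + 3) (by fun_prop) (ae_of_all _ fun ω => ?_)
      exact (norm_sub_le _ _).trans (add_le_add (abs_steinSol_le _ _) (abs_steinSol_le _ _))
    have hi2 : Integrable (fun ω => X ω ^ 2 * steinDeriv z (U ω)) P :=
      hX2.mul_bdd (hsd.comp hUm).aestronglyMeasurable (ae_of_all _ fun ω => abs_steinDeriv_le z _)
    rw [← integral_sub hi1 hi2]
    refine (abs_integral_le_integral_abs).trans ?_
    have : ∫ ω, |X ω * (steinSol z (U ω + X ω) - steinSol z (U ω)) -
        X ω ^ 2 * steinDeriv z (U ω)| ∂P ≤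
        ∫ ω, (2 * (|X ω| ^ 3 * |U ω|) + 3 * |X ω| ^ 3 + 4 * (X ω ^ 2 * I ω)) ∂P := by
      refine integral_mono (hi1.sub hi2).abs
        (((hiE3.const_mul 2).add (hX3.const_mul 3)).add (hiI2.const_mul 4)) fun ω => ?_
      have e : X ω * (steinSol z (U ω + X ω) - steinSol z (U ω)) - X ω ^ 2 * steinDeriv z (U ω) =
          X ω * (steinSol z (U ω + X ω) - steinSol z (U ω) - X ω * steinDeriv z (U ω)) := by ring
      simp only [e, abs_mul]
      have := mul_le_mul_of_nonneg_left (abs_steinSol_add_sub_le z (U ω) (X ω)) (abs_nonneg (X ω))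
      refine this.trans (le_of_eq ?_)
      simp only [hI]
      rw [← sq_abs (X ω)]; ring
    refine this.trans ?_
    have hi3 : Integrable (fun ω => 2 * (|X ω| ^ 3 * |U ω|) + 3 * |X ω| ^ 3) P :=
      (hiE3.const_mul 2).add (hX3.const_mul 3)
    rw [integral_add hi3 (hiI2.const_mul 4),
      integral_add (hiE3.const_mul 2) (hX3.const_mul 3), integral_const_mul, integral_const_mul,
      integral_const_mul]
    linarith
  have hB : |∫ ω, steinDeriv z (U ω + X ω) ∂P - ∫ ω, steinDeriv z (U ω) ∂P| ≤
      9 * ∫ ω, |X ω| ∂P + 24 * γ := by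
    have hUX : Measurable fun ω => U ω + X ω := hUm.add hXm
    rw [← integral_sub (hiU hUX) (hiU hUm)]
    refine (abs_integral_le_integral_abs).trans ?_
    have : ∫ ω, |steinDeriv z (U ω + X ω) - steinDeriv z (U ω)| ∂P ≤
        ∫ ω, (2 * (|X ω| * |U ω|) + 3 * |X ω| + I ω) ∂P := by
      refine integral_mono ((hiU (hUm.add hXm)).sub (hiU hUm)).abs
        (((hiE1.const_mul 2).add (hX1.abs.const_mul 3)).add hiI) fun ω => ?_
      refine (abs_steinDeriv_add_sub_le z (U ω) (X ω)).trans (le_of_eq ?_)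
      simp only [hI]; ring
    refine this.trans ?_
    have hi3 : Integrable (fun ω => 2 * (|X ω| * |U ω|) + 3 * |X ω|) P :=
      (hiE1.const_mul 2).add (hX1.abs.const_mul 3)
    rw [integral_add hi3 hiI,
      integral_add (hiE1.const_mul 2) (hX1.abs.const_mul 3), integral_const_mul, integral_const_mul]
    linarith
  have hC : |m * ∫ ω, steinDeriv z (U ω) ∂P - m * ∫ ω, steinDeriv z (U ω + X ω) ∂P| ≤
      9 * β + 24 * γ * m := by
    rw [← mul_sub, abs_mul, abs_of_nonneg hm0, abs_sub_comm]
    have := mul_le_mul_of_nonneg_left hB hm0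
    linarith
  have := abs_sub_le (∫ ω, X ω * (steinSol z (U ω + X ω) - steinSol z (U ω)) ∂P)
    (m * ∫ ω, steinDeriv z (U ω) ∂P) (m * ∫ ω, steinDeriv z (U ω + X ω) ∂P)
  rw [hind2] at hA
  linarith

/-- **Berry–Esseen theorem** for sums of independent variables, without an optimal constant; the
variance restriction on the single summands is harmless for i.i.d. sums of two or more terms. -/
theorem berryEsseen (hm : ∀ i, Measurable (ξ i)) (hind : iIndepFun ξ P)
    (h0 : ∀ i, ∫ ω, ξ i ω ∂P = 0) (h3 : ∀ i, Integrable (fun ω => |ξ i ω| ^ 3) P)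
    (s : Finset ι) (hv : ∑ i ∈ s, ∫ ω, ξ i ω ^ 2 ∂P = 1)
    (hv2 : ∀ i ∈ s, ∫ ω, ξ i ω ^ 2 ∂P ≤ 1 / 2)
    {γ : ℝ} (hγ : 0 < γ) (h3γ : ∑ i ∈ s, ∫ ω, |ξ i ω| ^ 3 ∂P ≤ γ) (z : ℝ) :
    |P.real {ω | ∑ i ∈ s, ξ i ω ≤ z} - gaussianCDF z| ≤ 150 * γ := by
  have hSm : Measurable fun ω => ∑ i ∈ s, ξ i ω := Finset.measurable_fun_sum _ fun j _ => hm j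
  have hsf := continuous_steinSol z
  have e1 := integral_sum_mul_comp hm hind h0 h3 s hsf.measurable (abs_steinSol_le z)
  have hiS : Integrable (fun ω => (∑ i ∈ s, ξ i ω) * steinSol z (∑ i ∈ s, ξ i ω)) P :=
    (integrable_finsetSum _ fun j _ => integrable_of_integrable_abs_cube (hm j) (h3 j)).mul_bdd
      (hsf.measurable.comp hSm).aestronglyMeasurable (ae_of_all _ fun ω => abs_steinSol_le z _)
  have hA : MeasurableSet {ω | ∑ i ∈ s, ξ i ω ≤ z} := measurableSet_le hSm measurable_const
  have e2 : ∫ ω, steinDeriv z (∑ i ∈ s, ξ i ω) ∂P =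
      ∫ ω, (∑ i ∈ s, ξ i ω) * steinSol z (∑ i ∈ s, ξ i ω) ∂P +
        (P.real {ω | ∑ i ∈ s, ξ i ω ≤ z} - gaussianCDF z) := by
    have e3 : ∀ ω, steinDeriv z (∑ i ∈ s, ξ i ω) =
        (∑ i ∈ s, ξ i ω) * steinSol z (∑ i ∈ s, ξ i ω) +
          (Set.indicator {ω | ∑ i ∈ s, ξ i ω ≤ z} 1 ω - gaussianCDF z) := fun ω => by
      simp only [steinDeriv, Set.indicator_apply, Set.mem_ofPred_eq, Pi.one_apply]; ring
    have hi1 : Integrable (Set.indicator {ω | ∑ i ∈ s, ξ i ω ≤ z} (1 : Ω → ℝ)) P :=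
      (integrable_const (1 : ℝ)).indicator hA
    simp only [e3]
    have hi2 : Integrable (fun ω => Set.indicator {ω | ∑ i ∈ s, ξ i ω ≤ z} (1 : Ω → ℝ) ω -
        gaussianCDF z) P := hi1.sub (integrable_const _)
    rw [integral_add hiS hi2, integral_sub hi1 (integrable_const _),
      integral_indicator_one hA]
    simp
  have e4 : P.real {ω | ∑ i ∈ s, ξ i ω ≤ z} - gaussianCDF z =
      -∑ i ∈ s, (∫ ω, ξ i ω * (steinSol z (∑ j ∈ s, ξ j ω) -
        steinSol z (∑ j ∈ s.erase i, ξ j ω)) ∂P -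
        (∫ ω, ξ i ω ^ 2 ∂P) * ∫ ω, steinDeriv z (∑ j ∈ s, ξ j ω) ∂P) := by
    rw [Finset.sum_sub_distrib, ← Finset.sum_mul, hv, ← e1]
    linarith
  rw [e4, abs_neg]
  refine (Finset.abs_sum_le_sum_abs _ _).trans ((Finset.sum_le_sum fun i hi =>
    abs_integral_steinSol_increment_le hm hind h0 h3 s hv hγ h3γ hi (hv2 i hi) z).trans ?_)
  rw [Finset.sum_add_distrib, ← Finset.mul_sum, ← Finset.mul_sum, hv]
  linarith

end BerryEsseen

/-- The Berry–Esseen theorem for a sum of i.i.d. variables, realized as a function of the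
coordinates of a product measure. -/
theorem exists_berryEsseen_pi (μ : Measure ℝ) [IsProbabilityMeasure μ] {h : ℝ → ℝ}
    (hh : Measurable h) (h0 : ∫ x, h x ∂μ = 0) {v : ℝ} (hv : 0 < v) (h2 : ∫ x, h x ^ 2 ∂μ = v)
    (h3 : Integrable (fun x => |h x| ^ 3) μ) :
    ∃ C : ℝ, ∀ n : ℕ, 2 ≤ n → ∀ z : ℝ,
      |(Measure.pi fun _ : Fin n => μ).real {x | ∑ i, h (x i) ≤ √(n * v) * z} - gaussianCDF z| ≤
        C / √n := by
  set β := ∫ x, |h x| ^ 3 ∂μ + 1 with hβ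
  have hβ0 : 0 < β := by
    have : 0 ≤ ∫ x, |h x| ^ 3 ∂μ := integral_nonneg fun x => by positivity
    linarith
  refine ⟨150 * (β / √v ^ 3), fun n hn z => ?_⟩
  have hn0 : (0 : ℝ) < n := by positivity
  have hn2 : (2 : ℝ) ≤ n := by exact_mod_cast hn
  set a := √(n * v) with ha
  have ha0 : 0 < a := Real.sqrt_pos.2 (by positivity)
  have ha2 : a ^ 2 = n * v := Real.sq_sqrt (by positivity)
  set P := Measure.pi fun _ : Fin n => μ
  set ξ : Fin n → (Fin n → ℝ) → ℝ := fun i x => h (x i) / a with hξ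
  have hcomp : ∀ (i : Fin n) {f : ℝ → ℝ}, Measurable f → ∫ x, f (x i) ∂P = ∫ t, f t ∂μ :=
    fun i f hf => by
      have hp := measurePreserving_eval (fun _ : Fin n => μ) i
      rw [← hp.map_eq, integral_map hp.aemeasurable hf.aestronglyMeasurable]
  have hm : ∀ i, Measurable (ξ i) := fun i => (hh.comp (measurable_pi_apply i)).div_const a
  have hind : iIndepFun ξ P :=
    iIndepFun_pi (X := fun _ t => h t / a) fun i => (hh.div_const a).aemeasurable
  have e0 : ∀ i, ∫ x, ξ i x ∂P = 0 := fun i => by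
    rw [hcomp i (hh.div_const a), integral_div, h0, zero_div]
  have e3i : ∀ i, Integrable (fun x => |ξ i x| ^ 3) P := fun i => by
    have hp := measurePreserving_eval (fun _ : Fin n => μ) i
    have : Integrable (fun t => |h t / a| ^ 3) μ := by
      simp only [abs_div, div_pow]; exact h3.div_const _
    exact hp.integrable_comp_of_integrable this
  have e2 : ∀ i, ∫ x, ξ i x ^ 2 ∂P = 1 / n := fun i => by
    rw [hcomp i (f := fun t => (h t / a) ^ 2) (by fun_prop)]
    simp only [div_pow]
    rw [integral_div, h2, ha2]
    field_simp
  have e3 : ∀ i, ∫ x, |ξ i x| ^ 3 ∂P ≤ β / a ^ 3 := fun i => by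
    rw [hcomp i (f := fun t => |h t / a| ^ 3) (by fun_prop)]
    simp only [abs_div, div_pow]
    rw [integral_div, abs_of_pos ha0]
    gcongr
    linarith
  have hsn : 0 < √(n : ℝ) := Real.sqrt_pos.2 hn0
  have hsv : 0 < √v := Real.sqrt_pos.2 hv
  have hγ : (n : ℝ) * (β / a ^ 3) = β / √v ^ 3 / √n := by
    have h1 : a = √n * √v := Real.sqrt_mul hn0.le v
    have h2 : (n : ℝ) = √n ^ 2 := (Real.sq_sqrt hn0.le).symm
    rw [h1]
    conv_lhs => rw [h2, Real.sqrt_sq hsn.le]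
    field_simp
  have key := berryEsseen hm hind e0 e3i Finset.univ (by simp [e2, hn0.ne'])
    (fun i _ => by rw [e2]; exact one_div_le_one_div_of_le two_pos hn2)
    (γ := β / √v ^ 3 / √n) (by positivity)
    ((Finset.sum_le_sum fun i _ => e3 i).trans (by simp [← hγ])) z
  have hset : {x : Fin n → ℝ | ∑ i, ξ i x ≤ z} = {x | ∑ i, h (x i) ≤ a * z} := by
    ext x
    simp only [Set.mem_ofPred_eq, hξ, ← Finset.sum_div]
    rw [div_le_iff₀ ha0, mul_comm]
  rw [hset] at key
  refine key.trans (le_of_eq ?_)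
  ring

end SteinMethod

namespace GaussianCodebook

open SteinMethod

/-! ### The Gaussian tail function and its inverse -/

lemma gaussianQ_eq (z : ℝ) : gaussianQ z = 1 - gaussianCDF z := (one_sub_gaussianCDF z).symm

lemma hasDerivAt_gaussianQ (z : ℝ) : HasDerivAt gaussianQ (-stdPDF z) z := by
  rw [show gaussianQ = fun z => 1 - gaussianCDF z from funext gaussianQ_eq]
  exact (hasDerivAt_gaussianCDF z).const_sub 1

lemma strictAnti_gaussianQ : StrictAnti gaussianQ :=
  strictAnti_of_hasDerivAt_neg (fun z => hasDerivAt_gaussianQ z) fun z =>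
    neg_neg_of_pos (stdPDF_pos z)

lemma gaussianQ_le_exp {t : ℝ} (ht : 1 ≤ t) : gaussianQ t ≤ Real.exp (-t ^ 2 / 2) := by
  rw [gaussianQ_eq, ← gaussianCDF_neg]
  have h := neg_mul_gaussianCDF_le (w := -t)
  rw [neg_neg, stdPDF_neg] at h
  calc gaussianCDF (-t) ≤ t * gaussianCDF (-t) := le_mul_of_one_le_left (gaussianCDF_nonneg _) ht
    _ ≤ stdPDF t := h
    _ ≤ 1 * Real.exp (-t ^ 2 / 2) := by
      rw [stdPDF_eq]
      gcongr
      refine inv_le_one_of_one_le₀ ?_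
      rw [Real.one_le_sqrt]
      linarith [Real.pi_gt_three]
    _ = _ := one_mul _

lemma exists_gaussianQ_eq {ε : ℝ} (h0 : 0 < ε) (h1 : ε < 1) : ∃ z, gaussianQ z = ε := by
  have hc : gaussianCDF = cdf (gaussianReal 0 1) := by
    ext z; rw [cdf_eq_real]; rfl
  have hq : gaussianQ = fun z => 1 - cdf (gaussianReal 0 1) z := by
    ext z; rw [gaussianQ_eq, hc]
  have hbot : Tendsto gaussianQ atBot (𝓝 1) := by
    rw [hq]; simpa using (tendsto_cdf_atBot (gaussianReal 0 1)).const_sub 1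
  have htop : Tendsto gaussianQ atTop (𝓝 0) := by
    rw [hq]; simpa using (tendsto_cdf_atTop (gaussianReal 0 1)).const_sub 1
  obtain ⟨a, ha⟩ := (hbot.eventually (lt_mem_nhds h1)).exists
  obtain ⟨b, hb⟩ := (htop.eventually (gt_mem_nhds h0)).exists
  have hcont : Continuous gaussianQ :=
    continuous_iff_continuousAt.2 fun z => (hasDerivAt_gaussianQ z).continuousAt
  exact mem_range_of_exists_le_of_exists_ge hcont ⟨b, hb.le⟩ ⟨a, ha.le⟩

lemma gaussianQInv_gaussianQ (z : ℝ) : gaussianQInv (gaussianQ z) = z := by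
  have : {x | gaussianQ z ≤ gaussianQ x} = Set.Iic z := by
    ext x; exact strictAnti_gaussianQ.le_iff_ge
  rw [gaussianQInv, this]
  have hmono : Monotone fun x : ℝ => (x : EReal) := fun x y h => EReal.coe_le_coe_iff.2 h
  exact (hmono.map_isGreatest isGreatest_Iic).isLUB.sSup_eq

lemma gaussianQInv_zero : gaussianQInv 0 = ⊤ := by
  have : {x | 0 ≤ gaussianQ x} = Set.univ := by
    ext x; simp [gaussianQ]
  rw [gaussianQInv, this, Set.image_univ, sSup_eq_top]
  intro b hb
  obtain ⟨x, hx, -⟩ := EReal.lt_iff_exists_real_btwn.1 hb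
  exact ⟨x, ⟨x, rfl⟩, hx⟩

/-- Around a point `z` the function `gaussianQ` decreases at least linearly. -/
lemma exists_gaussianQ_slope (z : ℝ) : ∃ p, 0 < p ∧ ∀ t, 0 ≤ t → t ≤ 1 →
    gaussianQ (z + t) ≤ gaussianQ z - p * t ∧ gaussianQ z + p * t ≤ gaussianQ (z - t) := by
  obtain ⟨y, -, hy⟩ := (isCompact_Icc (a := z - 1) (b := z + 1)).exists_isMinOn
    ⟨z, by constructor <;> linarith⟩ continuous_stdPDF.continuousOn
  have key : ∀ a b, z - 1 ≤ a → b ≤ z + 1 → a ≤ b →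
      gaussianQ b ≤ gaussianQ a - stdPDF y * (b - a) := by
    intro a b ha hb hab
    have := (convex_Icc (z - 1) (z + 1)).image_sub_le_mul_sub_of_deriv_le (f := gaussianQ)
      (C := -stdPDF y)
      (continuous_iff_continuousAt.2 fun z => (hasDerivAt_gaussianQ z).continuousAt).continuousOn
      (fun x _ => (hasDerivAt_gaussianQ x).differentiableAt.differentiableWithinAt)
      (fun x hx => by
        rw [(hasDerivAt_gaussianQ x).deriv]
        exact neg_le_neg (hy (interior_subset hx))) a ⟨ha, by linarith⟩ b ⟨by linarith, hb⟩ hab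
    linarith
  refine ⟨stdPDF y, stdPDF_pos y, fun t ht0 ht1 => ⟨?_, ?_⟩⟩
  · have := key z (z + t) (by linarith) (by linarith) (by linarith)
    rwa [add_sub_cancel_left] at this
  · have := key (z - t) z (by linarith) (by linarith) (by linarith)
    rw [sub_sub_cancel] at this
    linarith

/-! ### Fluctuations of the source power -/

/-- The random part `∑ (xᵢ² - s) / (2 s)` of the information density of a source sequence. -/
noncomputable def logDev (s : ℝ) {n : ℕ} (x : Fin n → ℝ) : ℝ := ∑ i, (x i ^ 2 - s) / (2 * s)

@[fun_prop]
lemma measurable_logDev (s : ℝ) (n : ℕ) : Measurable (logDev s : (Fin n → ℝ) → ℝ) := by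
  unfold logDev; fun_prop

instance (μ : Measure ℝ) [IsProbabilityMeasure μ] (n : ℕ) :
    IsProbabilityMeasure (sourceLaw μ n) := by
  unfold sourceLaw; infer_instance

lemma eventually_const_div_sqrt_lt (a : ℝ) {b : ℝ} (hb : 0 < b) :
    ∀ᶠ n : ℕ in atTop, a / √n < b := by
  have : Tendsto (fun n : ℕ => a / √n) atTop (𝓝 0) :=
    tendsto_const_nhds.div_atTop (Real.tendsto_sqrt_atTop.comp tendsto_natCast_atTop_atTop)
  exact this.eventually (gt_mem_nhds hb)

section Source

variable {μ : Measure ℝ} [IsProbabilityMeasure μ] {s ζ : ℝ}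

lemma integrable_pow_two_of_pow_four (h4i : Integrable (fun x : ℝ => x ^ 4) μ) :
    Integrable (fun x : ℝ => x ^ 2) μ := by
  refine ((integrable_const (1 : ℝ)).add h4i).mono' (by fun_prop) (ae_of_all _ fun x => ?_)
  simp only [Pi.add_apply, norm_pow, Real.norm_eq_abs, sq_abs]
  nlinarith [sq_nonneg (x ^ 2 - 1)]

lemma integral_logDev_letter (h2 : ∫ x, x ^ 2 ∂μ = s)
    (h4i : Integrable (fun x : ℝ => x ^ 4) μ) : ∫ x, (x ^ 2 - s) / (2 * s) ∂μ = 0 := by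
  rw [integral_div, integral_sub (integrable_pow_two_of_pow_four h4i) (integrable_const _), h2]
  simp

lemma integral_logDev_letter_sq (h2 : ∫ x, x ^ 2 ∂μ = s)
    (h4i : Integrable (fun x : ℝ => x ^ 4) μ) (h4 : ∫ x, x ^ 4 ∂μ = ζ) :
    ∫ x, ((x ^ 2 - s) / (2 * s)) ^ 2 ∂μ = dispersion s ζ := by
  have h2i := integrable_pow_two_of_pow_four h4i
  have e : ∀ x : ℝ, ((x ^ 2 - s) / (2 * s)) ^ 2 = (x ^ 4 - 2 * s * x ^ 2 + s ^ 2) / (4 * s ^ 2) :=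
    fun x => by rw [div_pow]; ring
  simp only [e]
  have hi : Integrable (fun x : ℝ => x ^ 4 - 2 * s * x ^ 2) μ := h4i.sub (h2i.const_mul _)
  rw [integral_div, integral_add hi (integrable_const _), integral_sub h4i (h2i.const_mul _),
    integral_const_mul, h2, h4, dispersion]
  simp
  ring

lemma integrable_abs_logDev_letter_cube (h6 : Integrable (fun x : ℝ => x ^ 6) μ) :
    Integrable (fun x : ℝ => |(x ^ 2 - s) / (2 * s)| ^ 3) μ := by
  have : Integrable (fun x : ℝ => 4 * (x ^ 6 + |s| ^ 3) / |2 * s| ^ 3) μ :=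
    ((h6.add (integrable_const _)).const_mul 4).div_const _
  refine this.mono' (by fun_prop) (ae_of_all _ fun x => ?_)
  rw [Real.norm_of_nonneg (by positivity), abs_div, div_pow]
  gcongr
  have h1 : |x ^ 2 - s| ≤ x ^ 2 + |s| := by
    have := abs_sub (x ^ 2) s; rwa [abs_of_nonneg (sq_nonneg x)] at this
  calc |x ^ 2 - s| ^ 3 ≤ (x ^ 2 + |s|) ^ 3 := by gcongr
    _ ≤ 4 * ((x ^ 2) ^ 3 + |s| ^ 3) := by
      nlinarith [mul_nonneg (add_nonneg (sq_nonneg x) (abs_nonneg s)) (sq_nonneg (x ^ 2 - |s|))]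
    _ = _ := by ring

/-- Tail bounds for `logDev` with a deviation of constant order in the threshold: the shift by `K`
pays for the Berry–Esseen error and for large deviations of order `√(n log n)`. -/
lemma exists_logDev_tail_bounds (h2 : ∫ x, x ^ 2 ∂μ = s)
    (h4i : Integrable (fun x : ℝ => x ^ 4) μ) (h4 : ∫ x, x ^ 4 ∂μ = ζ)
    (h6 : Integrable (fun x : ℝ => x ^ 6) μ) {ε z : ℝ} (h0 : 0 < ε) (h1 : ε < 1)
    (hz : gaussianQ z = ε) :
    ∃ K : ℝ, ∀ᶠ n : ℕ in atTop,
      (sourceLaw μ n).real {x | √(n * dispersion s ζ) * z + K < logDev s x} +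
          (sourceLaw μ n).real {x | √(n * (dispersion s ζ + 1) * Real.log n) < |logDev s x|} ≤
        ε - 1 / √n ∧
      ε + 1 / √n < (sourceLaw μ n).real {x | √(n * dispersion s ζ) * z - K < logDev s x} -
          (sourceLaw μ n).real {x | √(n * (dispersion s ζ + 1) * Real.log n) < |logDev s x|} := by
  set V := dispersion s ζ with hV
  have hVint := integral_logDev_letter_sq h2 h4i h4
  have hint0 := integral_logDev_letter h2 h4i
  have hint3 := integrable_abs_logDev_letter_cube (s := s) h6
  have hV0 : 0 ≤ V := by rw [hV, ← hVint]; exact integral_nonneg fun x => sq_nonneg _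
  rcases hV0.eq_or_lt with hV0 | hV0
  · -- Without dispersion `logDev` vanishes almost surely.
    have hae : ∀ᵐ x ∂μ, (x ^ 2 - s) / (2 * s) = 0 := by
      have hi := integrable_sq_of_integrable_abs_cube (by fun_prop) hint3
      have := (integral_eq_zero_iff_of_nonneg (fun x => sq_nonneg _) hi).1
        (hVint.trans hV0.symm)
      filter_upwards [this] with x hx
      exact pow_eq_zero_iff two_ne_zero |>.1 hx
    have hae' : ∀ n : ℕ, ∀ᵐ x ∂sourceLaw μ n, logDev s x = 0 := fun n => by
      have : ∀ i : Fin n, ∀ᵐ x ∂sourceLaw μ n, (x i ^ 2 - s) / (2 * s) = 0 := fun i =>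
        (measurePreserving_eval (fun _ : Fin n => μ) i).quasiMeasurePreserving.ae hae
      filter_upwards [ae_all_iff.2 this] with x hx
      simp [logDev, hx]
    refine ⟨1, ?_⟩
    filter_upwards [eventually_const_div_sqrt_lt 1 h0,
      eventually_const_div_sqrt_lt 1 (sub_pos.2 h1)] with n hn1 hn2
    have e1 : (sourceLaw μ n).real {x | √(n * V) * z + 1 < logDev s x} = 0 := by
      rw [measureReal_def, measure_eq_zero_iff_ae_notMem.2, ENNReal.toReal_zero]
      filter_upwards [hae' n] with x hx
      simp [hx, ← hV0]
    have e2 : (sourceLaw μ n).real {x | √(n * (V + 1) * Real.log n) < |logDev s x|} = 0 := by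
      rw [measureReal_def, measure_eq_zero_iff_ae_notMem.2, ENNReal.toReal_zero]
      filter_upwards [hae' n] with x hx
      simp [hx, Real.sqrt_nonneg]
    have e3 : (sourceLaw μ n).real {x | √(n * V) * z - 1 < logDev s x} = 1 := by
      rw [measureReal_def, (mem_ae_iff_prob_eq_one
        (measurableSet_lt measurable_const (by fun_prop))).1, ENNReal.toReal_one]
      filter_upwards [hae' n] with x hx
      simp [hx, ← hV0]
    rw [e1, e2, e3]
    constructor <;> linarith
  · obtain ⟨C, hC⟩ := exists_berryEsseen_pi μ (h := fun x => (x ^ 2 - s) / (2 * s))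
      (by fun_prop) hint0 hV0 hVint hint3
    have hC0 : 0 ≤ C := by
      have := (abs_nonneg _).trans (hC 2 le_rfl 0)
      exact (div_nonneg_iff.1 this).elim (fun h => h.1)
        fun h => absurd h.2 (not_le.2 (by positivity))
    obtain ⟨p, hp0, hp⟩ := exists_gaussianQ_slope z
    set κ := (3 * C + 4) / p with hκ
    have hκ0 : 0 < κ := by positivity
    refine ⟨√V * κ, ?_⟩
    filter_upwards [eventually_const_div_sqrt_lt κ zero_lt_one, eventually_ge_atTop 3] with n hn hn3
    have hn3' : (3 : ℝ) ≤ n := by exact_mod_cast hn3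
    have hsn : 0 < √(n : ℝ) := Real.sqrt_pos.2 (by linarith)
    have hsq : √(n * V) = √n * √V := Real.sqrt_mul (by linarith) V
    have hlt : ∀ y, |(sourceLaw μ n).real {x | √(n * V) * y < logDev s x} - gaussianQ y| ≤
        C / √n := by
      intro y
      have h := hC n (by omega) y
      have hm : MeasurableSet {x : Fin n → ℝ | ∑ i, (x i ^ 2 - s) / (2 * s) ≤ √(n * V) * y} :=
        measurableSet_le (by fun_prop) measurable_const
      have hc := measureReal_add_measureReal_compl (μ := sourceLaw μ n) hm
      rw [probReal_univ] at hc
      have hset : {x : Fin n → ℝ | ∑ i, (x i ^ 2 - s) / (2 * s) ≤ √(n * V) * y}ᶜ =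
          {x | √(n * V) * y < logDev s x} := by
        ext x; simp [logDev]
      rw [hset] at hc
      rw [gaussianQ_eq, abs_sub_comm]
      convert h using 2
      change _ = (sourceLaw μ n).real _ - _
      linarith
    set t := √(Real.log n) with ht
    have hlog : 1 ≤ Real.log n := by
      rw [Real.le_log_iff_exp_le (by linarith)]
      linarith [Real.exp_one_lt_d9]
    have ht1 : 1 ≤ t := Real.one_le_sqrt.2 hlog
    have hQt : gaussianQ t ≤ 1 / √n := by
      refine (gaussianQ_le_exp ht1).trans (le_of_eq ?_)
      rw [ht, Real.sq_sqrt (by linarith), Real.sqrt_eq_rpow,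
        Real.rpow_def_of_pos (by linarith), one_div, ← Real.exp_neg]
      congr 1; ring
    have htail : (sourceLaw μ n).real {x | √(n * (V + 1) * Real.log n) < |logDev s x|} ≤
        (2 * C + 2) / √n := by
      have hle : √(n * V) * t ≤ √(n * (V + 1) * Real.log n) := by
        rw [ht, ← Real.sqrt_mul (by positivity)]
        apply Real.sqrt_le_sqrt
        gcongr
        linarith
      have hsub : {x : Fin n → ℝ | √(n * (V + 1) * Real.log n) < |logDev s x|} ⊆
          {x | √(n * V) * t < logDev s x} ∪ {x | √(n * V) * (-t) < logDev s x}ᶜ := by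
        intro x hx
        have hx' : √(n * (V + 1) * Real.log n) < |logDev s x| := hx
        rcases lt_abs.1 hx' with h | h
        · left; exact hle.trans_lt h
        · right
          simp only [Set.mem_compl_iff, Set.mem_ofPred_eq, not_lt]
          linarith
      have h1 := (abs_le.1 (hlt t)).2
      have h2 := (abs_le.1 (hlt (-t))).1
      have h3 : gaussianQ (-t) = 1 - gaussianQ t := by
        rw [gaussianQ_eq, gaussianQ_eq, gaussianCDF_neg]
      have hm : MeasurableSet {x : Fin n → ℝ | √(n * V) * (-t) < logDev s x} :=
        measurableSet_lt measurable_const (by fun_prop)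
      have h4 := measureReal_add_measureReal_compl (μ := sourceLaw μ n) hm
      rw [probReal_univ] at h4
      calc _ ≤ _ := measureReal_mono hsub
        _ ≤ _ := measureReal_union_le _ _
        _ ≤ C / √n + 1 / √n + (C / √n + 1 / √n) := by linarith
        _ = _ := by ring
    obtain ⟨hp1, hp2⟩ := hp (κ / √n) (by positivity) hn.le
    have hpκ : p * (κ / √n) = 3 * (C / √n) + 4 * (1 / √n) := by
      rw [hκ]; field_simp
    have e1 : √(n * V) * z + √V * κ = √(n * V) * (z + κ / √n) := by
      rw [hsq]; field_simp
    have e2 : √(n * V) * z - √V * κ = √(n * V) * (z - κ / √n) := by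
      rw [hsq]; field_simp
    rw [e1, e2]
    have b1 := (abs_le.1 (hlt (z + κ / √n))).2
    have b2 := (abs_le.1 (hlt (z - κ / √n))).1
    have e3 : (2 * C + 2) / √n = 2 * (C / √n) + 2 * (1 / √n) := by ring
    rw [e3] at htail
    have hpos : 0 < 1 / √(n : ℝ) := by positivity
    rw [hpκ, hz] at hp1 hp2
    constructor <;> linarith

end Source

/-! ### Excess-distortion probability and covering probability -/

/-- The probability, under the codeword law `ν`, that a single random codeword covers `x` within
distortion `D`. -/
noncomputable def coverProb {n : ℕ} (ν : Measure (Fin n → ℝ)) (D : ℝ) (x : Fin n → ℝ) : ℝ :=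
  ν.real {y | distortion x y ≤ D}

lemma measurable_distortion {α : Type*} [MeasurableSpace α] {n : ℕ} {f g : α → Fin n → ℝ}
    (hf : Measurable f) (hg : Measurable g) : Measurable fun a => distortion (f a) (g a) := by
  unfold distortion; fun_prop

lemma measurable_coverProb {n : ℕ} (ν : Measure (Fin n → ℝ)) [SFinite ν] (D : ℝ) :
    Measurable (coverProb ν D) :=
  (measurable_measure_prodMk_left (measurableSet_le
    (measurable_distortion measurable_fst measurable_snd)
    (measurable_const (a := D)))).ennreal_toReal

lemma distortion_encoder_le {n M : ℕ} [NeZero M] (c : Fin M → Fin n → ℝ) (x : Fin n → ℝ)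
    (i : Fin M) : distortion x (decoder c (encoder c x)) ≤ distortion x (c i) :=
  Classical.choose_spec (Finite.exists_min (fun i : Fin M => distortion x (c i))) i

lemma lt_distortion_encoder_iff {n M : ℕ} [NeZero M] (c : Fin M → Fin n → ℝ) (x : Fin n → ℝ)
    (D : ℝ) : D < distortion x (decoder c (encoder c x)) ↔ ∀ i, D < distortion x (c i) :=
  ⟨fun h i => h.trans_le (distortion_encoder_le c x i), fun h => h _⟩

/-- Given the source sequence `x`, all codewords fail independently with probability
`1 - coverProb x`. -/
lemma excessDistortionProb_eq (μ : Measure ℝ) [IsProbabilityMeasure μ]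
    (ν : (n : ℕ) → Measure (Fin n → ℝ)) (D : ℝ) (n M : ℕ) [NeZero M]
    [IsProbabilityMeasure (ν n)] :
    excessDistortionProb μ ν D n M = ∫ x, (1 - coverProb (ν n) D x) ^ M ∂sourceLaw μ n := by
  have hset : {p : (Fin n → ℝ) × (Fin M → Fin n → ℝ) |
      D < distortion p.1 (decoder p.2 (encoder p.2 p.1))} =
      {p | ∀ i, D < distortion p.1 (p.2 i)} := by
    ext p; exact lt_distortion_encoder_iff p.2 p.1 D
  have hm : MeasurableSet {p : (Fin n → ℝ) × (Fin M → Fin n → ℝ) |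
      ∀ i, D < distortion p.1 (p.2 i)} := by
    simp only [Set.ofPred_forall]
    refine MeasurableSet.iInter fun i => measurableSet_lt measurable_const ?_
    exact measurable_distortion measurable_fst ((measurable_pi_apply i).comp measurable_snd)
  have hc : ∀ x, 0 ≤ 1 - coverProb (ν n) D x := fun x =>
    sub_nonneg.2 measureReal_le_one
  have hmc := measurable_coverProb (ν n) D
  rw [excessDistortionProb, hset, measureReal_def, Measure.prod_apply hm,
    integral_eq_lintegral_of_nonneg_ae (ae_of_all _ fun x => pow_nonneg (hc x) M)
      (by fun_prop)]
  congr 1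
  refine lintegral_congr fun x => ?_
  have hpre : Prod.mk x ⁻¹' {p : (Fin n → ℝ) × (Fin M → Fin n → ℝ) |
      ∀ i, D < distortion p.1 (p.2 i)} =
      Set.univ.pi fun _ => {y | distortion x y ≤ D}ᶜ := by
    ext c; simp
  have hmx : MeasurableSet {y | distortion x y ≤ D} :=
    measurableSet_le (measurable_distortion measurable_const measurable_id) measurable_const
  rw [hpre, Measure.pi_pi, Finset.prod_const, Finset.card_univ, Fintype.card_fin,
    ENNReal.ofReal_pow (hc x), coverProb, ← probReal_compl_eq_one_sub hmx, ofReal_measureReal]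

section Bounds

variable {μ : Measure ℝ} [IsProbabilityMeasure μ] {ν : (n : ℕ) → Measure (Fin n → ℝ)} {s D : ℝ}
  {n M : ℕ} [IsProbabilityMeasure (ν n)]

lemma integrable_one_sub_coverProb_pow :
    Integrable (fun x => (1 - coverProb (ν n) D x) ^ M) (sourceLaw μ n) := by
  have hmc := measurable_coverProb (ν n) D
  refine Integrable.of_bound (by fun_prop) 1 (ae_of_all _ fun x => ?_)
  have h0 : 0 ≤ coverProb (ν n) D x := measureReal_nonneg
  have h1 : coverProb (ν n) D x ≤ 1 := measureReal_le_one
  rw [norm_pow, Real.norm_of_nonneg (by linarith)]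
  exact pow_le_one₀ (by linarith) (by linarith)

variable [NeZero M]

/-- Achievability: a union of the atypical source sequences and the failure of the codebook on the
typical ones. -/
lemma excessDistortionProb_le {γ τ q : ℝ}
    (hq : ∀ x : Fin n → ℝ, logDev s x ≤ γ → |logDev s x| ≤ τ → q ≤ coverProb (ν n) D x) :
    excessDistortionProb μ ν D n M ≤ (sourceLaw μ n).real {x | γ < logDev s x} +
      (sourceLaw μ n).real {x | τ < |logDev s x|} + Real.exp (-(M * q)) := by
  rw [excessDistortionProb_eq]
  set A := {x : Fin n → ℝ | γ < logDev s x} with hA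
  set B := {x : Fin n → ℝ | τ < |logDev s x|} with hB
  have hAm : MeasurableSet A := measurableSet_lt measurable_const (by fun_prop)
  have hBm : MeasurableSet B := measurableSet_lt measurable_const (by fun_prop)
  have hiA : Integrable (A.indicator (1 : (Fin n → ℝ) → ℝ)) (sourceLaw μ n) :=
    (integrable_const (1 : ℝ)).indicator hAm
  have hiB : Integrable (B.indicator (1 : (Fin n → ℝ) → ℝ)) (sourceLaw μ n) :=
    (integrable_const (1 : ℝ)).indicator hBm
  have key : ∫ x, (1 - coverProb (ν n) D x) ^ M ∂sourceLaw μ n ≤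
      ∫ x, ((A.indicator 1 + B.indicator 1 : (Fin n → ℝ) → ℝ) x + Real.exp (-(M * q)))
        ∂sourceLaw μ n := by
    refine integral_mono integrable_one_sub_coverProb_pow
      ((hiA.add hiB).add (integrable_const _)) fun x => ?_
    have h0 : 0 ≤ coverProb (ν n) D x := measureReal_nonneg
    have h1 : coverProb (ν n) D x ≤ 1 := measureReal_le_one
    have hle : (1 - coverProb (ν n) D x) ^ M ≤ 1 := pow_le_one₀ (by linarith) (by linarith)
    have hexp := Real.exp_pos (-(M * q))
    have hA0 : 0 ≤ A.indicator (1 : (Fin n → ℝ) → ℝ) x := Set.indicator_nonneg (by simp) x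
    have hB0 : 0 ≤ B.indicator (1 : (Fin n → ℝ) → ℝ) x := Set.indicator_nonneg (by simp) x
    simp only [Pi.add_apply]
    by_cases hxA : x ∈ A
    · rw [Set.indicator_of_mem hxA, Pi.one_apply]; linarith
    by_cases hxB : x ∈ B
    · rw [Set.indicator_of_mem hxB, Pi.one_apply]; linarith
    have hx := hq x (not_lt.1 hxA) (not_lt.1 hxB)
    calc (1 - coverProb (ν n) D x) ^ M ≤ Real.exp (-q) ^ M := by
          refine pow_le_pow_left₀ (by linarith) ?_ M
          have := Real.add_one_le_exp (-q)
          linarith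
      _ = Real.exp (-(M * q)) := by rw [← Real.exp_nat_mul]; congr 1; ring
      _ ≤ _ := by linarith
  refine key.trans (le_of_eq ?_)
  rw [integral_add (hiA.add hiB) (integrable_const _), integral_add' hiA hiB,
    integral_indicator_one hAm, integral_indicator_one hBm]
  simp

/-- Converse: on the source sequences that are hard to cover the codebook fails, by the union bound
over the codewords. -/
lemma le_excessDistortionProb {γ τ q : ℝ} (hq0 : 0 ≤ q)
    (hq : ∀ x : Fin n → ℝ, γ < logDev s x → |logDev s x| ≤ τ → coverProb (ν n) D x ≤ q) :
    (sourceLaw μ n).real {x | γ < logDev s x} - (sourceLaw μ n).real {x | τ < |logDev s x|} -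
      M * q ≤ excessDistortionProb μ ν D n M := by
  rw [excessDistortionProb_eq]
  set A := {x : Fin n → ℝ | γ < logDev s x} with hA
  set B := {x : Fin n → ℝ | τ < |logDev s x|} with hB
  have hAm : MeasurableSet A := measurableSet_lt measurable_const (by fun_prop)
  have hBm : MeasurableSet B := measurableSet_lt measurable_const (by fun_prop)
  have hiA : Integrable (A.indicator (1 : (Fin n → ℝ) → ℝ)) (sourceLaw μ n) :=
    (integrable_const (1 : ℝ)).indicator hAm
  have hiB : Integrable (B.indicator (1 : (Fin n → ℝ) → ℝ)) (sourceLaw μ n) :=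
    (integrable_const (1 : ℝ)).indicator hBm
  have key : ∫ x, ((A.indicator 1 - B.indicator 1 : (Fin n → ℝ) → ℝ) x - M * q) ∂sourceLaw μ n ≤
      ∫ x, (1 - coverProb (ν n) D x) ^ M ∂sourceLaw μ n := by
    refine integral_mono ((hiA.sub hiB).sub (integrable_const _))
      integrable_one_sub_coverProb_pow fun x => ?_
    have h0 : 0 ≤ coverProb (ν n) D x := measureReal_nonneg
    have h1 : coverProb (ν n) D x ≤ 1 := measureReal_le_one
    have hpow : 0 ≤ (1 - coverProb (ν n) D x) ^ M := pow_nonneg (by linarith) M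
    have hMq : 0 ≤ M * q := by positivity
    have hA1 : A.indicator (1 : (Fin n → ℝ) → ℝ) x ≤ 1 := Set.indicator_le_self' (by simp) x
    have hB0 : 0 ≤ B.indicator (1 : (Fin n → ℝ) → ℝ) x := Set.indicator_nonneg (by simp) x
    simp only [Pi.sub_apply]
    by_cases hxA : x ∈ A
    · by_cases hxB : x ∈ B
      · rw [Set.indicator_of_mem hxB, Pi.one_apply]; linarith
      have hx := hq x hxA (not_lt.1 hxB)
      have hb := one_add_mul_le_pow (a := -coverProb (ν n) D x) (by linarith) M
      have hM : (M : ℝ) * coverProb (ν n) D x ≤ M * q := by gcongr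
      rw [← sub_eq_add_neg] at hb
      linarith
    · rw [Set.indicator_of_notMem hxA]; linarith
  refine le_trans (le_of_eq ?_) key
  rw [integral_sub (hiA.sub hiB) (integrable_const _), integral_sub' hiA hiB,
    integral_indicator_one hAm, integral_indicator_one hBm]
  simp

end Bounds

/-! ### From a covering estimate to the second-order expansion -/

lemma minCodewords_le (μ : Measure ℝ) (ν : (n : ℕ) → Measure (Fin n → ℝ)) {D ε : ℝ} {n M : ℕ}
    [hM : NeZero M] (h : excessDistortionProb μ ν D n M ≤ ε) : minCodewords μ ν D ε n ≤ M :=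
  sInf_le ⟨M, hM, rfl, h⟩

lemma exists_of_minCodewords_ne_top {μ : Measure ℝ} {ν : (n : ℕ) → Measure (Fin n → ℝ)} {D ε : ℝ}
    {n : ℕ} (h : minCodewords μ ν D ε n ≠ ⊤) : ∃ (M : ℕ) (_ : NeZero M),
      minCodewords μ ν D ε n = M ∧ excessDistortionProb μ ν D n M ≤ ε := by
  have hmem := csInf_mem (s := {m : ℕ∞ | ∃ (M : ℕ) (_ : NeZero M), m = M ∧
    excessDistortionProb μ ν D n M ≤ ε}) (Set.nonempty_iff_ne_empty.2 fun he =>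
      h (by rw [minCodewords, he, sInf_empty]))
  exact hmem

lemma minCodewords_anti (μ : Measure ℝ) (ν : (n : ℕ) → Measure (Fin n → ℝ)) (D : ℝ) (n : ℕ)
    {ε ε' : ℝ} (h : ε ≤ ε') : minCodewords μ ν D ε' n ≤ minCodewords μ ν D ε n :=
  sInf_le_sInf fun _ ⟨M, hM, he, hp⟩ => ⟨M, hM, he, hp.trans h⟩

/-- The covering probability of a source sequence `x` equals `exp(-(n/2) log(s/D) - logDev s x)`,
up to factors that are polynomial in `n` as long as `logDev s x` is of order `√(n log n)`. -/
def HasCoverEstimate (ν : (n : ℕ) → Measure (Fin n → ℝ)) (s D : ℝ) : Prop :=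
  ∃ C δ : ℝ, 0 ≤ C ∧ 0 < δ ∧ ∀ᶠ n : ℕ in atTop, IsProbabilityMeasure (ν n) ∧
    ∀ x : Fin n → ℝ, |logDev s x| ≤ δ * n →
      Real.exp (-(n * firstOrderRate s D + logDev s x) -
          C * (logDev s x ^ 2 / n + Real.log n)) ≤ coverProb (ν n) D x ∧
        coverProb (ν n) D x ≤ Real.exp (-(n * firstOrderRate s D + logDev s x) +
          C * (logDev s x ^ 2 / n + Real.log n))

/-- The sequence whose upper limit is the second-order rate. -/
noncomputable def normalizedRate (μ : Measure ℝ) (ν : (n : ℕ) → Measure (Fin n → ℝ)) (s D ε : ℝ)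
    (n : ℕ) : EReal :=
  ((1 / √n : ℝ) : EReal) * (ENNReal.log ((minCodewords μ ν D ε n : ℕ∞) : ENNReal) -
    ((n * firstOrderRate s D : ℝ) : EReal))

lemma normalizedRate_anti (μ : Measure ℝ) (ν : (n : ℕ) → Measure (Fin n → ℝ)) (s D : ℝ)
    {ε ε' : ℝ} (h : ε ≤ ε') (n : ℕ) :
    normalizedRate μ ν s D ε' n ≤ normalizedRate μ ν s D ε n := by
  refine mul_le_mul_of_nonneg_left (EReal.sub_le_sub (ENNReal.log_monotone
    (ENat.toENNReal_le.2 (minCodewords_anti μ ν D n h))) le_rfl) ?_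
  exact EReal.coe_nonneg.2 (by positivity)

section Expansion

variable {μ : Measure ℝ} [IsProbabilityMeasure μ] {ν : (n : ℕ) → Measure (Fin n → ℝ)}
  {s ζ D ε z : ℝ}

lemma dispersion_nonneg (h2 : ∫ x, x ^ 2 ∂μ = s) (h4i : Integrable (fun x : ℝ => x ^ 4) μ)
    (h4 : ∫ x, x ^ 4 ∂μ = ζ) : 0 ≤ dispersion s ζ := by
  rw [← integral_logDev_letter_sq h2 h4i h4]
  exact integral_nonneg fun x => sq_nonneg _

/-- The second-order expansion. The threshold `√(n (V + 1) log n)` for typical source sequences is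
large enough for atypical ones to have probability `O(1/√n)`, and small enough for the error of the
covering estimate to be `O(log n)`. -/
lemma exists_minCodewords_bounds (hD0 : 0 < D) (hD : D < s) (h2 : ∫ x, x ^ 2 ∂μ = s)
    (h4i : Integrable (fun x : ℝ => x ^ 4) μ) (h4 : ∫ x, x ^ 4 ∂μ = ζ)
    (h6 : Integrable (fun x : ℝ => x ^ 6) μ) (h0 : 0 < ε) (h1 : ε < 1)
    (hz : gaussianQ z = ε) (hν : HasCoverEstimate ν s D) :
    ∃ K : ℝ, ∀ᶠ n : ℕ in atTop, minCodewords μ ν D ε n ≠ ⊤ ∧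
      |Real.log ((minCodewords μ ν D ε n).toNat : ℝ) -
        (n * firstOrderRate s D + √(n * dispersion s ζ) * z)| ≤ K * Real.log n := by
  obtain ⟨C, δ, hC0, hδ, hcov⟩ := hν
  obtain ⟨K, hK⟩ := exists_logDev_tail_bounds h2 h4i h4 h6 h0 h1 hz
  have hV := dispersion_nonneg h2 h4i h4
  set V := dispersion s ζ
  set R := firstOrderRate s D with hR
  have hR0 : 0 < R := by
    have : 0 < Real.log (s / D) := Real.log_pos (by rwa [one_lt_div hD0])
    rw [hR, firstOrderRate]; positivity
  set k := C * (V + 2) with hk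
  have hk0 : 0 ≤ k := by positivity
  have hlog : ∀ᶠ n : ℕ in atTop, (V + 1) * Real.log n ≤ δ ^ 2 * n := by
    have h := ((Real.isLittleO_log_id_atTop.const_mul_left (V + 1)).comp_tendsto
      tendsto_natCast_atTop_atTop).bound (sq_pos_of_pos hδ)
    filter_upwards [h] with n hn
    simp only [Function.comp_apply, id, Real.norm_eq_abs, Nat.abs_cast] at hn
    exact (le_abs_self _).trans hn
  have hE : ∀ᶠ n : ℕ in atTop, 0 ≤ n * R + √(n * V) * z + K := by
    have hs : Tendsto (fun n : ℕ => √(n : ℝ)) atTop atTop :=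
      Real.tendsto_sqrt_atTop.comp tendsto_natCast_atTop_atTop
    have h := hs.atTop_mul_atTop₀
      (tendsto_atTop_add_const_right _ (√V * z) (hs.const_mul_atTop hR0))
    have h' := tendsto_atTop_add_const_right _ K h
    filter_upwards [h'.eventually_ge_atTop 0] with n hn
    have e : √(n * V) = √n * √V := Real.sqrt_mul (by positivity) V
    have e2 : (n : ℝ) = √n * √n := (Real.mul_self_sqrt (by positivity)).symm
    rw [e]
    calc 0 ≤ √n * (R * √n + √V * z) + K := hn
      _ = (√n * √n) * R + √n * √V * z + K := by ring
      _ = _ := by rw [← e2]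
  refine ⟨|K| + 1 + k + 1, ?_⟩
  filter_upwards [hcov, hK, hlog, hE, eventually_ge_atTop 3] with n hn hKn hlogn hEn hn3
  obtain ⟨hprob, hn⟩ := hn
  obtain ⟨hKn1, hKn2⟩ := hKn
  have hn3' : (3 : ℝ) ≤ n := by exact_mod_cast hn3
  have hn0 : (0 : ℝ) < n := by linarith
  have hlog1 : 1 ≤ Real.log n := by
    rw [Real.le_log_iff_exp_le (by linarith)]
    linarith [Real.exp_one_lt_d9]
  set τ := √(n * (V + 1) * Real.log n) with hτ
  have hτ2 : τ ^ 2 = n * (V + 1) * Real.log n := Real.sq_sqrt (by positivity)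
  have hτ0 : 0 ≤ τ := Real.sqrt_nonneg _
  have hτδ : τ ≤ δ * n := by
    refine Real.sqrt_le_iff.2 ⟨by positivity, ?_⟩
    calc n * (V + 1) * Real.log n = n * ((V + 1) * Real.log n) := by ring
      _ ≤ n * (δ ^ 2 * n) := by gcongr
      _ = _ := by ring
  -- On typical sequences the error term of the covering estimate is logarithmic.
  have herr : ∀ x : Fin n → ℝ, |logDev s x| ≤ τ →
      C * (logDev s x ^ 2 / n + Real.log n) ≤ k * Real.log n := fun x hx => by
    have h : logDev s x ^ 2 ≤ n * (V + 1) * Real.log n := by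
      rw [← hτ2, ← sq_abs]; gcongr
    have h' : logDev s x ^ 2 / n ≤ (V + 1) * Real.log n := by
      rw [div_le_iff₀ hn0]; linarith
    rw [hk, mul_assoc]
    gcongr
    linarith
  have hsqrt : 1 / (n : ℝ) ≤ 1 / √n := by
    gcongr
    rw [Real.sqrt_le_left hn0.le]
    nlinarith
  have hexplog : Real.exp (Real.log n) = n := Real.exp_log hn0
  -- Achievability.
  have hup : minCodewords μ ν D ε n ≠ ⊤ ∧ Real.log ((minCodewords μ ν D ε n).toNat : ℝ) ≤
      n * R + √(n * V) * z + K + (k + 1) * Real.log n + 1 := by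
    set E := n * R + √(n * V) * z + K + (k + 1) * Real.log n with hEdef
    have hE0 : 0 ≤ E := by
      have : 0 ≤ (k + 1) * Real.log n := by positivity
      linarith
    set M := ⌈Real.exp E⌉₊ with hM
    have hM0 : NeZero M := ⟨(Nat.ceil_pos.2 (Real.exp_pos E)).ne'⟩
    set q := Real.exp (-(n * R + (√(n * V) * z + K)) - k * Real.log n) with hq
    have hMq : (n : ℝ) ≤ M * q := by
      calc (n : ℝ) = Real.exp E * q := by
            rw [hq, ← Real.exp_add, hEdef]
            conv_lhs => rw [← hexplog]
            congr 1; ring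
        _ ≤ M * q := by gcongr; exact Nat.le_ceil _
    have hexc := excessDistortionProb_le (μ := μ) (ν := ν) (s := s) (D := D) (n := n) (M := M)
      (γ := √(n * V) * z + K) (τ := τ) (q := q) fun x hx hxτ => by
        refine le_trans ?_ (hn x (hxτ.trans hτδ)).1
        rw [hq, Real.exp_le_exp]
        have := herr x hxτ
        linarith
    have hexpn : Real.exp (-(M * q)) ≤ 1 / √n := by
      refine le_trans ?_ hsqrt
      rw [Real.exp_neg, ← one_div]
      gcongr
      linarith [Real.add_one_le_exp (M * q)]
    have hle : minCodewords μ ν D ε n ≤ M := minCodewords_le μ ν (hexc.trans (by linarith))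
    have hne : minCodewords μ ν D ε n ≠ ⊤ := ne_top_of_le_ne_top (ENat.natCast_ne_top M) hle
    refine ⟨hne, ?_⟩
    obtain ⟨m, hm0, hm, -⟩ := exists_of_minCodewords_ne_top hne
    rw [hm] at hle ⊢
    rw [ENat.toNat_natCast]
    have hmM : m ≤ M := by exact_mod_cast hle
    have hmpos : (0 : ℝ) < m := Nat.cast_pos.2 (Nat.pos_of_ne_zero hm0.out)
    have h1E : 1 ≤ Real.exp E := Real.one_le_exp hE0
    calc Real.log m ≤ Real.log (Real.exp (E + 1)) := by
          apply Real.log_le_log hmpos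
          calc (m : ℝ) ≤ M := by exact_mod_cast hmM
            _ ≤ Real.exp E + 1 := (Nat.ceil_lt_add_one (Real.exp_pos E).le).le
            _ ≤ Real.exp E * Real.exp 1 := by nlinarith [Real.add_one_le_exp 1]
            _ = _ := (Real.exp_add _ _).symm
      _ = E + 1 := Real.log_exp _
  refine ⟨hup.1, ?_⟩
  -- Converse.
  have hlow : n * R + √(n * V) * z - K - (k + 1) * Real.log n ≤
      Real.log ((minCodewords μ ν D ε n).toNat : ℝ) := by
    obtain ⟨m, hm0, hm, hexc⟩ := exists_of_minCodewords_ne_top hup.1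
    rw [hm, ENat.toNat_natCast]
    have hmpos : (0 : ℝ) < m := Nat.cast_pos.2 (Nat.pos_of_ne_zero hm0.out)
    by_contra! hlt
    rw [Real.log_lt_iff_lt_exp hmpos] at hlt
    set q := Real.exp (-(n * R + (√(n * V) * z - K)) + k * Real.log n) with hq
    have hmq : m * q ≤ 1 / n := by
      calc m * q ≤ Real.exp (n * R + √(n * V) * z - K - (k + 1) * Real.log n) * q := by gcongr
        _ = (Real.exp (Real.log n))⁻¹ := by
          rw [hq, ← Real.exp_add, ← Real.exp_neg]; congr 1; ring
        _ = 1 / n := by rw [hexplog, one_div]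
    have hlower := le_excessDistortionProb (μ := μ) (ν := ν) (s := s) (D := D) (n := n) (M := m)
      (γ := √(n * V) * z - K) (τ := τ) (q := q) (Real.exp_pos _).le fun x hx hxτ => by
        refine (hn x (hxτ.trans hτδ)).2.trans ?_
        rw [hq, Real.exp_le_exp]
        have := herr x hxτ
        linarith
    linarith
  have h2 := hup.2
  have hK1 := neg_abs_le K
  have hK2 := le_abs_self K
  have hK3 : |K| ≤ |K| * Real.log n := le_mul_of_one_le_right (abs_nonneg K) hlog1
  have hexpand : (|K| + 1 + k + 1) * Real.log n =
      |K| * Real.log n + Real.log n + (k + 1) * Real.log n := by ring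
  rw [abs_le, hexpand]
  constructor <;> linarith

lemma hasSecondOrderExpansion_of_coverEstimate (hD0 : 0 < D) (hD : D < s)
    (h2 : ∫ x, x ^ 2 ∂μ = s) (h4i : Integrable (fun x : ℝ => x ^ 4) μ) (h4 : ∫ x, x ^ 4 ∂μ = ζ)
    (h6 : Integrable (fun x : ℝ => x ^ 6) μ) (h0 : 0 < ε) (h1 : ε < 1)
    (hν : HasCoverEstimate ν s D) : HasSecondOrderExpansion μ ν s ζ D ε := by
  obtain ⟨z, hz⟩ := exists_gaussianQ_eq h0 h1
  obtain ⟨K, hK⟩ := exists_minCodewords_bounds hD0 hD h2 h4i h4 h6 h0 h1 hz hν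
  refine ⟨hK.mono fun n hn => hn.1, IsBigO.of_bound K (hK.mono fun n hn => ?_)⟩
  have hlog : 0 ≤ Real.log n := Real.log_natCast_nonneg n
  rw [← hz, gaussianQInv_gaussianQ, EReal.toReal_coe, Real.norm_eq_abs,
    Real.norm_of_nonneg hlog, hz]
  have := hn.2
  rwa [firstOrderRate, show (n : ℝ) * (1 / 2 * Real.log (s / D)) = n / 2 * Real.log (s / D) by ring]
    at this

lemma tendsto_normalizedRate (hD0 : 0 < D) (hD : D < s)
    (h2 : ∫ x, x ^ 2 ∂μ = s) (h4i : Integrable (fun x : ℝ => x ^ 4) μ) (h4 : ∫ x, x ^ 4 ∂μ = ζ)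
    (h6 : Integrable (fun x : ℝ => x ^ 6) μ) (h0 : 0 < ε) (h1 : ε < 1) (hz : gaussianQ z = ε)
    (hν : HasCoverEstimate ν s D) :
    Tendsto (normalizedRate μ ν s D ε) atTop (𝓝 ((√(dispersion s ζ) * z : ℝ) : EReal)) := by
  obtain ⟨K, hK⟩ := exists_minCodewords_bounds hD0 hD h2 h4i h4 h6 h0 h1 hz hν
  have hreal : Tendsto (fun n : ℕ => 1 / √n * (Real.log ((minCodewords μ ν D ε n).toNat : ℝ) -
      n * firstOrderRate s D)) atTop (𝓝 (√(dispersion s ζ) * z)) := by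
    have hlim : Tendsto (fun n : ℕ => K * (Real.log n / √n)) atTop (𝓝 0) := by
      rw [← mul_zero K]
      refine Tendsto.const_mul K ?_
      have := ((isLittleO_log_rpow_atTop (r := 1 / 2) (by norm_num)).tendsto_div_nhds_zero).comp
        tendsto_natCast_atTop_atTop
      simpa only [Function.comp_def, ← Real.sqrt_eq_rpow] using this
    rw [tendsto_iff_norm_sub_tendsto_zero]
    refine squeeze_zero' (Eventually.of_forall fun n => norm_nonneg _) ?_ hlim
    filter_upwards [hK, eventually_ge_atTop 1] with n hn hn1
    have hn0 : (0 : ℝ) < n := by exact_mod_cast hn1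
    have hs : 0 < √(n : ℝ) := Real.sqrt_pos.2 hn0
    have e : √(n * dispersion s ζ) = √n * √(dispersion s ζ) := Real.sqrt_mul hn0.le _
    have e2 : 1 / √n * (Real.log ((minCodewords μ ν D ε n).toNat : ℝ) - n * firstOrderRate s D) -
        √(dispersion s ζ) * z = (Real.log ((minCodewords μ ν D ε n).toNat : ℝ) -
          (n * firstOrderRate s D + √(n * dispersion s ζ) * z)) / √n := by
      rw [e]; field_simp; ring
    rw [e2, Real.norm_eq_abs, abs_div, abs_of_pos hs, ← mul_div_assoc]
    gcongr
    exact hn.2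
  refine (EReal.tendsto_coe.2 hreal).congr' ?_
  filter_upwards [hK] with n hn
  obtain ⟨m, hm0, hm, -⟩ := exists_of_minCodewords_ne_top hn.1
  rw [normalizedRate, hm, ENat.toNat_natCast, ENat.toENNReal_coe,
    ENNReal.log_pos_real (by exact_mod_cast hm0.out) (ENNReal.natCast_ne_top m),
    ENNReal.toReal_natCast]
  push_cast
  rfl

lemma secondOrderRate_of_coverEstimate (hD0 : 0 < D) (hD : D < s)
    (h2 : ∫ x, x ^ 2 ∂μ = s) (h4i : Integrable (fun x : ℝ => x ^ 4) μ) (h4 : ∫ x, x ^ 4 ∂μ = ζ)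
    (h6 : Integrable (fun x : ℝ => x ^ 6) μ) (h0 : 0 ≤ ε) (h1 : ε < 1)
    (hV : ε = 0 → 0 < dispersion s ζ) (hν : HasCoverEstimate ν s D) :
    secondOrderRate μ ν s D ε = ((√(dispersion s ζ) : ℝ) : EReal) * gaussianQInv ε := by
  change limsup (normalizedRate μ ν s D ε) atTop = _
  rcases h0.eq_or_lt with rfl | h0
  · rw [gaussianQInv_zero, EReal.coe_mul_top_of_pos (Real.sqrt_pos.2 (hV rfl)), eq_top_iff]
    refine le_of_forall_lt fun b hb => ?_
    obtain ⟨y, hy, -⟩ := EReal.lt_iff_exists_real_btwn.1 hb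
    refine hy.trans_le ?_
    -- The error probability zero is compared with the positive probability `Q(y / √V)`.
    have hs : 0 < √(dispersion s ζ) := Real.sqrt_pos.2 (hV rfl)
    set z := y / √(dispersion s ζ) with hz
    have hQ0 : 0 < gaussianQ z := (measureReal_nonneg (s := Set.Ioi (z + 1))).trans_lt
      (strictAnti_gaussianQ (lt_add_one z))
    have hQ1 : gaussianQ z < 1 := (strictAnti_gaussianQ (sub_one_lt z)).trans_le
      measureReal_le_one
    have hlim := tendsto_normalizedRate hD0 hD h2 h4i h4 h6 hQ0 hQ1 rfl hν
    have hy : √(dispersion s ζ) * z = y := by rw [hz]; field_simp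
    rw [hy] at hlim
    rw [← hlim.limsup_eq]
    exact limsup_le_limsup (Eventually.of_forall fun n => normalizedRate_anti μ ν s D hQ0.le n)
  · obtain ⟨z, hz⟩ := exists_gaussianQ_eq h0 h1
    rw [(tendsto_normalizedRate hD0 hD h2 h4i h4 h6 h0 h1 hz hν).limsup_eq, ← hz,
      gaussianQInv_gaussianQ, EReal.coe_mul]

end Expansion

/-! ### Standard Gaussian vectors and the two codeword laws -/

/-- The law of a vector of `n` independent standard Gaussians. -/
noncomputable def stdGaussianVec (n : ℕ) : Measure (Fin n → ℝ) :=
  Measure.pi fun _ => gaussianReal 0 1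

instance (n : ℕ) : IsProbabilityMeasure (stdGaussianVec n) := by
  unfold stdGaussianVec; infer_instance

/-- The density of a standard Gaussian vector in `ℝⁿ`, as a function of the Euclidean norm. -/
noncomputable def radialDensity (n : ℕ) (r : ℝ) : ENNReal :=
  ENNReal.ofReal ((√(2 * Real.pi))⁻¹ ^ n * Real.exp (-r ^ 2 / 2))

lemma measurable_radialDensity (n : ℕ) : Measurable (radialDensity n) := by
  unfold radialDensity; fun_prop

lemma ofReal_prod_stdPDF {n : ℕ} (y : Fin n → ℝ) :
    ENNReal.ofReal (∏ i, stdPDF (y i)) = radialDensity n √(∑ i, y i ^ 2) := by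
  simp only [stdPDF_eq, radialDensity]
  rw [Finset.prod_mul_distrib, Finset.prod_const, Finset.card_univ, Fintype.card_fin,
    ← Real.exp_sum, Real.sq_sqrt (Finset.sum_nonneg fun i _ => sq_nonneg _), ← Finset.sum_div,
    Finset.sum_neg_distrib]

lemma stdGaussianVec_eq_withDensity (n : ℕ) :
    stdGaussianVec n = (volume : Measure (Fin n → ℝ)).withDensity
      fun y => radialDensity n √(∑ i, y i ^ 2) := by
  simp only [← ofReal_prod_stdPDF]
  refine Measure.pi_eq fun t ht => ?_
  rw [withDensity_apply _ (MeasurableSet.univ_pi ht), volume_pi, Measure.restrict_pi_pi,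
    ← ofReal_integral_eq_lintegral_ofReal
      (Integrable.fintype_prod fun i => integrable_stdPDF.integrableOn)
      (ae_of_all _ fun y => Finset.prod_nonneg fun i _ => (stdPDF_pos _).le),
    integral_fintype_prod_eq_prod (fun _ x => stdPDF x), ENNReal.ofReal_prod_of_nonneg
      fun i _ => integral_nonneg fun x => (stdPDF_pos x).le]
  refine Finset.prod_congr rfl fun i _ => ?_
  rw [gaussianReal_apply_eq_integral _ one_ne_zero]
  rfl

lemma norm_toLp_eq_sqrt {n : ℕ} (y : Fin n → ℝ) :
    ‖(WithLp.toLp 2 y : EuclideanSpace ℝ (Fin n))‖ = √(∑ i, y i ^ 2) := by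
  rw [EuclideanSpace.norm_eq]; simp

lemma map_toLp_stdGaussianVec (n : ℕ) :
    (stdGaussianVec n).map (WithLp.toLp 2) = stdGaussian (EuclideanSpace ℝ (Fin n)) :=
  map_pi_eq_stdGaussian

lemma lintegral_stdGaussian {n : ℕ} {F : EuclideanSpace ℝ (Fin n) → ENNReal} (hF : Measurable F) :
    ∫⁻ v, F v ∂stdGaussian (EuclideanSpace ℝ (Fin n)) = ∫⁻ v, radialDensity n ‖v‖ * F v := by
  have hr := measurable_radialDensity n
  rw [← map_toLp_stdGaussianVec, lintegral_map hF (by fun_prop), stdGaussianVec_eq_withDensity,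
    lintegral_withDensity_eq_lintegral_mul _ (by fun_prop) (by fun_prop),
    ← (PiLp.volume_preserving_toLp (Fin n)).lintegral_comp (by fun_prop)]
  simp only [Pi.mul_apply, norm_toLp_eq_sqrt]

/-- The direction of a standard Gaussian vector is uniformly distributed on the sphere: in polar
coordinates its density depends on the radius only. -/
lemma stdGaussian_direction (n : ℕ) [NeZero n]
    {A : Set (Metric.sphere (0 : EuclideanSpace ℝ (Fin n)) 1)} (hA : MeasurableSet A)
    {B : Set (EuclideanSpace ℝ (Fin n))} (hB : MeasurableSet B)
    (hAB : ∀ u : Metric.sphere (0 : EuclideanSpace ℝ (Fin n)) 1, ∀ r : ℝ, 0 < r →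
      (u ∈ A ↔ r • u.1 ∈ B)) :
    stdGaussian (EuclideanSpace ℝ (Fin n)) B =
      (volume : Measure (EuclideanSpace ℝ (Fin n))).toSphere A *
        ∫⁻ r, radialDensity n r.1 ∂Measure.volumeIoiPow (n - 1) := by
  have hr := measurable_radialDensity n
  rw [← lintegral_indicator_one hB, lintegral_stdGaussian (measurable_one.indicator hB)]
  have h0 : ∀ᵐ v : EuclideanSpace ℝ (Fin n), v ∈ ({0}ᶜ : Set (EuclideanSpace ℝ (Fin n))) := by
    rw [ae_iff]; simp
  rw [← setLIntegral_univ, ← setLIntegral_congr (s := ({0}ᶜ : Set (EuclideanSpace ℝ (Fin n))))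
      (by filter_upwards [h0] with v hv; exact eq_iff_iff.2 ⟨fun _ => trivial, fun _ => hv⟩),
    ← lintegral_subtype_comap (measurableSet_singleton (0 : EuclideanSpace ℝ (Fin n))).compl]
  have hmp := Measure.measurePreserving_homeomorphUnitSphereProd
    (volume : Measure (EuclideanSpace ℝ (Fin n)))
  rw [show n - 1 = Module.finrank ℝ (EuclideanSpace ℝ (Fin n)) - 1 by simp,
    ← lintegral_indicator_one hA, ← lintegral_prod_mul (measurable_one.indicator hA).aemeasurable
      (g := fun r : Set.Ioi (0 : ℝ) => radialDensity n r.1)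
      (hr.comp measurable_subtype_coe).aemeasurable, ← hmp.lintegral_comp
      (f := fun z : Metric.sphere (0 : EuclideanSpace ℝ (Fin n)) 1 × Set.Ioi (0 : ℝ) =>
        A.indicator 1 z.1 * radialDensity n z.2.1)
      (((measurable_one.indicator hA).comp measurable_fst).mul
        ((hr.comp measurable_subtype_coe).comp measurable_snd))]
  refine lintegral_congr fun v => ?_
  have hnorm : ((homeomorphUnitSphereProd (EuclideanSpace ℝ (Fin n))) v).2.1 = ‖v.1‖ := by
    simp
  have hv : 0 < ‖v.1‖ := norm_pos_iff.2 v.2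
  have hmem := hAB ((homeomorphUnitSphereProd (EuclideanSpace ℝ (Fin n))) v).1 ‖v.1‖ hv
  rw [homeomorphUnitSphereProd_apply_fst_coe, smul_inv_smul₀ hv.ne'] at hmem
  rw [hnorm, mul_comm]
  congr 1
  by_cases h : v.1 ∈ B
  · rw [Set.indicator_of_mem h, Set.indicator_of_mem (hmem.2 h)]; rfl
  · rw [Set.indicator_of_notMem h, Set.indicator_of_notMem (fun h' => h (hmem.1 h'))]

/-- A uniform point on the sphere is a normalized standard Gaussian vector. -/
lemma sphericalLaw_eq_map (P : ℝ) (n : ℕ) [NeZero n] :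
    sphericalLaw P n = (stdGaussianVec n).map fun y i => √(n * P) * (y i / √(∑ j, y j ^ 2)) := by
  set S : Measure (Metric.sphere (0 : EuclideanSpace ℝ (Fin n)) 1) :=
    (volume : Measure (EuclideanSpace ℝ (Fin n))).toSphere with hS
  set c := ∫⁻ r, radialDensity n r.1 ∂Measure.volumeIoiPow (n - 1) with hc
  have hone : S Set.univ * c = 1 := by
    rw [← stdGaussian_direction n MeasurableSet.univ MeasurableSet.univ (by simp), measure_univ]
  have hcinv : (S Set.univ)⁻¹ = c := (ENNReal.eq_inv_of_mul_eq_one_left (by rwa [mul_comm])).symm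
  have hf1 : Measurable fun (u : Metric.sphere (0 : EuclideanSpace ℝ (Fin n)) 1) (i : Fin n) =>
      √(n * P) * u.1 i := by
    fun_prop
  have hf2 : Measurable fun (v : EuclideanSpace ℝ (Fin n)) (i : Fin n) =>
      √(n * P) * (v i / ‖v‖) := by
    fun_prop
  ext B hB
  have hcomp : (fun (y : Fin n → ℝ) (i : Fin n) => √(n * P) * (y i / √(∑ j, y j ^ 2))) =
      (fun (v : EuclideanSpace ℝ (Fin n)) (i : Fin n) => √(n * P) * (v i / ‖v‖)) ∘
        WithLp.toLp 2 := by
    ext y i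
    simp only [Function.comp_apply, norm_toLp_eq_sqrt]
  rw [hcomp, ← Measure.map_map hf2 (by fun_prop), map_toLp_stdGaussianVec,
    Measure.map_apply hf2 hB]
  have key := stdGaussian_direction n (hf1 hB) (hf2 hB) fun u r hr => by
    have hu : ‖u.1‖ = 1 := by simp
    simp only [Set.mem_preimage]
    have : (fun i => √(n * P) * ((r • u.1) i / ‖r • u.1‖)) = fun i => √(n * P) * u.1 i := by
      ext i
      rw [norm_smul, hu, mul_one, Real.norm_of_nonneg hr.le, PiLp.smul_apply, smul_eq_mul,
        mul_div_cancel_left₀ _ hr.ne']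
    rw [this]
  rw [key, mul_comm, ← hc, ← hcinv, sphericalLaw, Measure.map_apply hf1 hB]
  rfl

lemma iidGaussianLaw_eq_map {P : ℝ} (hP : 0 ≤ P) (n : ℕ) :
    iidGaussianLaw P n = (stdGaussianVec n).map fun y i => √P * y i := by
  have h := gaussianReal_map_const_mul (μ := 0) (v := 1) √P
  have hv : NNReal.mk (√P ^ 2) (sq_nonneg _) * 1 = P.toNNReal := by
    ext; simp [Real.sq_sqrt hP, hP]
  rw [mul_zero, hv] at h
  have : ∀ _ : Fin n, SigmaFinite ((gaussianReal 0 1).map fun x => √P * x) := fun _ => by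
    rw [h]; infer_instance
  rw [stdGaussianVec, Measure.pi_map_pi (f := fun _ x => √P * x) fun _ => by fun_prop]
  simp only [h]
  rfl

/-- Rotation invariance: only the inner product with `x` and the norm matter, and the direction of
`x` can be taken to be the first coordinate axis. -/
lemma map_inner_normSq_stdGaussianVec {m : ℕ} (x : Fin (m + 1) → ℝ) :
    (stdGaussianVec (m + 1)).map (fun y => (∑ i, x i * y i, ∑ i, y i ^ 2)) =
      (stdGaussianVec (m + 1)).map (fun y => (√(∑ i, x i ^ 2) * y 0, ∑ i, y i ^ 2)) := by
  set x' : EuclideanSpace ℝ (Fin (m + 1)) := WithLp.toLp 2 x with hx'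
  rcases eq_or_ne x' 0 with h0 | h0
  · have : x = 0 := by
      simpa [hx'] using congrArg WithLp.ofLp h0
    simp [this]
  have hn : 0 < ‖x'‖ := norm_pos_iff.2 h0
  obtain ⟨b, hb⟩ := Orthonormal.exists_orthonormalBasis_extension_of_card_eq (𝕜 := ℝ)
    (E := EuclideanSpace ℝ (Fin (m + 1))) (ι := Fin (m + 1)) (by simp)
    (v := fun _ => ‖x'‖⁻¹ • x') (s := {0}) (by
      rw [orthonormal_iff_ite]
      intro i j
      rw [if_pos (Subsingleton.elim i j)]
      simp only [Set.domRestrict_apply]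
      rw [inner_smul_left, inner_smul_right, real_inner_self_eq_norm_sq]
      simp only [map_inv₀, conj_trivial]
      field_simp)
  have hb0 := hb 0 rfl
  have hF : Measurable fun v : EuclideanSpace ℝ (Fin (m + 1)) => (inner ℝ x' v, ‖v‖ ^ 2) := by
    fun_prop
  have e1 := congrArg (fun ν => Measure.map
      (fun v : EuclideanSpace ℝ (Fin (m + 1)) => (inner ℝ x' v, ‖v‖ ^ 2)) ν)
    ((map_toLp_stdGaussianVec (m + 1)).trans (stdGaussian_eq_map_pi_orthonormalBasis b))
  rw [Measure.map_map hF (by fun_prop), Measure.map_map hF (by fun_prop)] at e1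
  convert e1 using 2
  · ext y
    · simp [hx', PiLp.inner_apply, mul_comm]
    · simp [EuclideanSpace.norm_sq_eq]
  · ext y
    · have : x' = ‖x'‖ • b 0 := by rw [hb0, smul_inv_smul₀ hn.ne']
      simp only [Function.comp_apply]
      rw [inner_sum, this, ← norm_toLp_eq_sqrt, ← hx']
      simp [inner_smul_left, inner_smul_right, b.inner_eq_ite, mul_comm]
    · simp only [Function.comp_apply]
      rw [← b.sum_sq_norm_inner_right]
      simp [inner_sum, inner_smul_right, b.inner_eq_ite]
  · rfl

/-! ### Lower bounds for Gaussian probabilities -/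

/-- Stirling's upper bound for the Gamma function, up to a polynomial factor. -/
lemma Gamma_add_one_le {t : ℝ} (ht : 0 < t) :
    Real.Gamma (t + 1) ≤ (t + 1) * Real.exp (t * (Real.log (t + 1) - 1)) := by
  rw [Real.Gamma_eq_integral (by linarith), add_sub_cancel_right]
  have hr : 0 < (t + 1)⁻¹ := by positivity
  have hint : IntegrableOn (fun x : ℝ => Real.exp (-(t + 1)⁻¹ * x)) (Set.Ioi 0) := by
    simpa using exp_neg_integrableOn_Ioi 0 hr
  have hval : ∫ x in Set.Ioi (0 : ℝ), Real.exp (-(t + 1)⁻¹ * x) = t + 1 := by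
    have := integral_exp_mul_Ioi (a := -(t + 1)⁻¹) (by linarith) 0
    rw [this]
    simp
  calc ∫ x in Set.Ioi (0 : ℝ), Real.exp (-x) * x ^ t
      ≤ ∫ x in Set.Ioi (0 : ℝ),
          Real.exp (t * (Real.log (t + 1) - 1)) * Real.exp (-(t + 1)⁻¹ * x) := by
        refine setIntegral_mono_on ?_ (hint.const_mul _) measurableSet_Ioi fun x hx => ?_
        · have := Real.GammaIntegral_convergent (s := t + 1) (by linarith)
          rwa [add_sub_cancel_right] at this
        · have hx : 0 < x := hx
          rw [Real.rpow_def_of_pos hx, ← Real.exp_add, ← Real.exp_add, Real.exp_le_exp]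
          -- `log u ≤ u - 1` at the quotient of `x` and the maximizer `t + 1`.
          have h := Real.log_le_sub_one_of_pos (x := x / (t + 1)) (by positivity)
          rw [Real.log_div hx.ne' (by linarith)] at h
          have h' := mul_le_mul_of_nonneg_left h ht.le
          have e : -x + t * (x / (t + 1)) = -(t + 1)⁻¹ * x := by field_simp; ring
          linarith
    _ = _ := by rw [integral_const_mul, hval, mul_comm]

lemma volume_setOf_sum_sq_le {m : ℕ} (hm : 1 ≤ m) (r : ℝ) (hr : 0 ≤ r) :
    (volume : Measure (Fin m → ℝ)).real {y | ∑ i, y i ^ 2 ≤ r ^ 2} =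
      r ^ m * (√Real.pi ^ m / Real.Gamma (m / 2 + 1)) := by
  have : Nonempty (Fin m) := ⟨⟨0, hm⟩⟩
  have h := EuclideanSpace.volume_closedBall (Fin m) 0 r
  rw [← (PiLp.volume_preserving_toLp (Fin m)).measure_preimage
    measurableSet_closedBall.nullMeasurableSet] at h
  have hset : WithLp.toLp 2 ⁻¹' Metric.closedBall (0 : EuclideanSpace ℝ (Fin m)) r =
      {y | ∑ i, y i ^ 2 ≤ r ^ 2} := by
    ext y
    rw [Set.mem_preimage, mem_closedBall_zero_iff, norm_toLp_eq_sqrt, Real.sqrt_le_left hr]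
    rfl
  rw [hset] at h
  rw [measureReal_def, h]
  have hG : 0 < Real.Gamma (m / 2 + 1) := Real.Gamma_pos_of_pos (by positivity)
  simp only [Fintype.card_fin, ENNReal.toReal_mul, ENNReal.toReal_pow]
  rw [ENNReal.toReal_ofReal hr, ENNReal.toReal_ofReal (by positivity)]

/-- Small ball probability of a standard Gaussian vector: the exponent `(n/2)(1 + log b - b)` is the
rate function of the chi-squared law. -/
lemma le_stdGaussianVec_ball {m : ℕ} (hm : 1 ≤ m) {b : ℝ} (hb0 : 0 < b) (hb1 : b ≤ 1) :
    Real.exp (((m + 1 : ℕ) : ℝ) / 2 * (1 + Real.log b - b) - 1 - Real.log (m + 1 : ℕ)) ≤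
      (stdGaussianVec m).real {y | ∑ i, y i ^ 2 ≤ (m + 1 : ℕ) * b} := by
  set n : ℝ := ((m + 1 : ℕ) : ℝ) with hn
  have hmn : (m : ℝ) = n - 1 := by rw [hn]; push_cast; ring
  have hn2 : 2 ≤ n := by rw [hn]; exact_mod_cast Nat.succ_le_succ hm
  set r := √(n * b) with hr
  have hr0 : 0 ≤ r := Real.sqrt_nonneg _
  have hr2 : r ^ 2 = n * b := Real.sq_sqrt (by positivity)
  have hG : 0 < Real.Gamma (m / 2 + 1) := Real.Gamma_pos_of_pos (by positivity)
  set B : Set (Fin m → ℝ) := {y | ∑ i, y i ^ 2 ≤ n * b} with hB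
  have hBm : MeasurableSet B := measurableSet_le (by fun_prop) measurable_const
  set κ := (√(2 * Real.pi))⁻¹ ^ m * Real.exp (-(n * b) / 2) with hκ
  have hvol : κ * (volume : Measure (Fin m → ℝ)).real B ≤ (stdGaussianVec m).real B := by
    rw [measureReal_def, measureReal_def, ← ENNReal.toReal_ofReal (show 0 ≤ κ by positivity),
      ← ENNReal.toReal_mul]
    refine ENNReal.toReal_mono (measure_ne_top _ _) ?_
    rw [stdGaussianVec_eq_withDensity, withDensity_apply _ hBm, ← setLIntegral_const]
    refine setLIntegral_mono (by have := measurable_radialDensity m; fun_prop) fun y hy => ?_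
    rw [radialDensity]
    refine ENNReal.ofReal_le_ofReal ?_
    rw [Real.sq_sqrt (Finset.sum_nonneg fun i _ => sq_nonneg _), hκ]
    have hy' : ∑ i, y i ^ 2 ≤ n * b := hy
    gcongr
  refine le_trans ?_ hvol
  have hvolB := volume_setOf_sum_sq_le hm r hr0
  rw [hr2] at hvolB
  rw [hB, hvolB]
  have hpow : κ * (r ^ m * (√Real.pi ^ m / Real.Gamma (m / 2 + 1))) =
      Real.exp (-(n * b) / 2 + m / 2 * Real.log (n * b / 2)) / Real.Gamma (m / 2 + 1) := by
    have h1 : (√(2 * Real.pi))⁻¹ * (r * √Real.pi) = √(n * b / 2) := by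
      rw [hr, Real.sqrt_mul (by norm_num), Real.sqrt_div (by positivity)]
      have : √Real.pi ≠ 0 := (Real.sqrt_pos.2 Real.pi_pos).ne'
      field_simp
    have h2 : √(n * b / 2) ^ m = Real.exp (m / 2 * Real.log (n * b / 2)) := by
      rw [Real.sqrt_eq_rpow, ← Real.rpow_natCast, ← Real.rpow_mul (by positivity),
        Real.rpow_def_of_pos (by positivity)]
      congr 1; ring
    rw [Real.exp_add, ← h2, ← h1, hκ, mul_pow, mul_pow]
    ring
  rw [hpow, le_div_iff₀ hG]
  have hGle := Gamma_add_one_le (t := (m : ℝ) / 2) (by positivity)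
  have hm2 : (m : ℝ) / 2 + 1 = (n + 1) / 2 := by rw [hmn]; ring
  have hle : (m : ℝ) / 2 + 1 ≤ Real.exp (Real.log n) := by
    rw [Real.exp_log (by linarith)]; linarith
  calc _ ≤ Real.exp (n / 2 * (1 + Real.log b - b) - 1 - Real.log n) *
        (Real.exp (Real.log n) * Real.exp (m / 2 * (Real.log ((n + 1) / 2) - 1))) := by
        gcongr
        refine hGle.trans ?_
        rw [hm2] at hle ⊢
        gcongr
    _ = Real.exp (n / 2 * (1 + Real.log b - b) - 1 + m / 2 * (Real.log ((n + 1) / 2) - 1)) := by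
        rw [← Real.exp_add, ← Real.exp_add]; congr 1; ring
    _ ≤ _ := by
        rw [Real.exp_le_exp, Real.log_div (by linarith) two_ne_zero,
          Real.log_div (by positivity) two_ne_zero, Real.log_mul (by linarith) hb0.ne']
        have hlb : Real.log b ≤ 0 := Real.log_nonpos hb0.le hb1
        have hlog : Real.log (n + 1) - Real.log n ≤ 1 / n := by
          rw [← Real.log_div (by linarith) (by linarith)]
          refine (Real.log_le_sub_one_of_pos (by positivity)).trans (le_of_eq ?_)
          field_simp; ring
        have hmul : (m : ℝ) / 2 * (Real.log (n + 1) - Real.log n) ≤ 1 / 2 := by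
          calc (m : ℝ) / 2 * (Real.log (n + 1) - Real.log n) ≤ (n - 1) / 2 * (1 / n) := by
                rw [hmn]; gcongr; linarith
            _ ≤ 1 / 2 := by
                rw [div_mul_div_comm, div_le_div_iff₀ (by positivity) two_pos]; linarith
        rw [hmn] at hmul ⊢
        nlinarith

lemma le_gaussianReal_Icc {u h : ℝ} (hu : 0 ≤ u) (hh : 0 ≤ h) :
    h * stdPDF (u + h) ≤ (gaussianReal 0 1).real (Set.Icc u (u + h)) := by
  rw [measureReal_def, gaussianReal_apply_eq_integral _ one_ne_zero, ENNReal.toReal_ofReal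
    (integral_nonneg fun x => gaussianPDFReal_nonneg _ _ _)]
  have hc : ∫ x in Set.Icc u (u + h), stdPDF (u + h) = h * stdPDF (u + h) := by
    simp [hh]
  rw [← hc]
  refine setIntegral_mono_on (by simp) integrable_stdPDF.integrableOn measurableSet_Icc
    fun x hx => ?_
  change stdPDF (u + h) ≤ stdPDF x
  simp only [stdPDF_eq]
  have : x ^ 2 ≤ (u + h) ^ 2 := by
    have := hx.1
    have := hx.2
    gcongr
    linarith
  gcongr

/-- The set of vectors whose first coordinate is close to `√n a` and whose remaining coordinates
have squared norm at most `n b`. -/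
def window (m : ℕ) (a b : ℝ) : Set (Fin (m + 1) → ℝ) :=
  {y | y 0 ∈ Set.Icc (√(m + 1 : ℕ) * a) (√(m + 1 : ℕ) * a + 1 / √(m + 1 : ℕ)) ∧
    ∑ i : Fin m, y i.succ ^ 2 ≤ (m + 1 : ℕ) * b}

lemma le_stdGaussianVec_window {m : ℕ} (hm : 1 ≤ m) {a b : ℝ} (ha : 0 ≤ a) (hb0 : 0 < b)
    (hb1 : b ≤ 1) :
    Real.exp (((m + 1 : ℕ) : ℝ) / 2 * (1 - a ^ 2 - b + Real.log b) - (a + 4) -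
        2 * Real.log (m + 1 : ℕ)) ≤ (stdGaussianVec (m + 1)).real (window m a b) := by
  have hball := le_stdGaussianVec_ball hm hb0 hb1
  set n : ℝ := ((m + 1 : ℕ) : ℝ) with hn
  have hn2 : 2 ≤ n := by rw [hn]; exact_mod_cast Nat.succ_le_succ hm
  have hsn : 0 < √n := Real.sqrt_pos.2 (by linarith)
  have hprod : (stdGaussianVec (m + 1)).real (window m a b) =
      (gaussianReal 0 1).real (Set.Icc (√n * a) (√n * a + 1 / √n)) *
        (stdGaussianVec m).real {y | ∑ i, y i ^ 2 ≤ n * b} := by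
    have hmp := measurePreserving_piFinSuccAbove (fun _ : Fin (m + 1) => gaussianReal 0 1) 0
    have hms : MeasurableSet (Set.Icc (√n * a) (√n * a + 1 / √n) ×ˢ
        {y : Fin m → ℝ | ∑ i, y i ^ 2 ≤ n * b}) :=
      measurableSet_Icc.prod (measurableSet_le (by fun_prop) measurable_const)
    rw [← measureReal_prod_prod, stdGaussianVec, stdGaussianVec]
    rw [measureReal_def, measureReal_def, ← hmp.measure_preimage hms.nullMeasurableSet]
    congr 2
  have hI := le_gaussianReal_Icc (u := √n * a) (h := 1 / √n) (by positivity) (by positivity)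
  have hexp : Real.exp (-(n / 2 * a ^ 2) - (a + 3) - Real.log n) ≤
      1 / √n * stdPDF (√n * a + 1 / √n) := by
    have h1 : Real.exp (-Real.log n) ≤ 1 / √n := by
      rw [Real.exp_neg, Real.exp_log (by linarith), ← one_div]
      gcongr
      rw [Real.sqrt_le_left (by linarith)]
      nlinarith
    have h2 : Real.exp (-2) ≤ (√(2 * Real.pi))⁻¹ := by
      rw [Real.exp_neg]
      gcongr
      have h3 : √(2 * Real.pi) ≤ 3 := by
        rw [Real.sqrt_le_left (by norm_num)]; linarith [Real.pi_lt_d2]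
      linarith [Real.add_one_le_exp 2]
    have h4 : -(n / 2 * a ^ 2) - (a + 1) ≤ -(√n * a + 1 / √n) ^ 2 / 2 := by
      have e : (√n * a + 1 / √n) ^ 2 = √n ^ 2 * a ^ 2 + 2 * a + 1 / √n ^ 2 := by
        field_simp
        ring
      rw [e, Real.sq_sqrt (by linarith)]
      have : 1 / n ≤ 1 := by rw [div_le_one (by linarith)]; linarith
      linarith
    rw [stdPDF_eq]
    calc Real.exp (-(n / 2 * a ^ 2) - (a + 3) - Real.log n) =
          Real.exp (-Real.log n) * (Real.exp (-2) * Real.exp (-(n / 2 * a ^ 2) - (a + 1))) := by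
          rw [← Real.exp_add, ← Real.exp_add]; congr 1; ring
      _ ≤ _ := by gcongr
  rw [hprod]
  calc _ = Real.exp (-(n / 2 * a ^ 2) - (a + 3) - Real.log n) *
        Real.exp (n / 2 * (1 + Real.log b - b) - 1 - Real.log n) := by
        rw [← Real.exp_add]; congr 1; ring
    _ ≤ _ := by
        gcongr
        exact hexp.trans hI

/-! ### Chernoff bounds -/

lemma integral_exp_neg_mul_sq_gaussianReal {θ : ℝ} (hθ : 0 < 1 + 2 * θ) :
    ∫ x, Real.exp (-θ * x ^ 2) ∂gaussianReal 0 1 = √(1 / (1 + 2 * θ)) := by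
  rw [integral_gaussianReal_eq_integral_smul one_ne_zero]
  have e : ∀ x : ℝ, gaussianPDFReal 0 1 x • Real.exp (-θ * x ^ 2) =
      (√(2 * Real.pi))⁻¹ * Real.exp (-(θ + 1 / 2) * x ^ 2) := fun x => by
    change stdPDF x * _ = _
    rw [stdPDF_eq, mul_assoc, ← Real.exp_add]
    congr 2; ring
  simp only [e]
  rw [integral_const_mul, integral_gaussian, ← Real.sqrt_inv, ← Real.sqrt_mul (by positivity)]
  congr 1
  have := Real.pi_pos
  rw [show θ + 1 / 2 = (1 + 2 * θ) / 2 by ring]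
  field_simp

lemma integrable_exp_neg_mul_sq_gaussianReal {θ : ℝ} (hθ : 0 < 1 + 2 * θ) :
    Integrable (fun x => Real.exp (-θ * x ^ 2)) (gaussianReal 0 1) := by
  by_contra h
  have h1 := integral_exp_neg_mul_sq_gaussianReal hθ
  rw [integral_undef h] at h1
  exact (Real.sqrt_pos.2 (show 0 < 1 / (1 + 2 * θ) by positivity)).ne h1

/-- Chernoff bound for the probability of a cone around the first axis (a spherical cap) under a
standard Gaussian vector. -/
lemma stdGaussianVec_cone_le {m : ℕ} (hm : 1 ≤ m) {c : ℝ} (hc0 : 0 < c) (hc1 : c < 1) :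
    (stdGaussianVec (m + 1)).real {y | c * √(∑ i, y i ^ 2) ≤ y 0} ≤
      Real.exp (((m + 1 : ℕ) : ℝ) / 2 * Real.log (1 - c ^ 2) + 1 / 2 * Real.log (m + 1 : ℕ) +
        1 / 2 - 1 / 2 * Real.log (1 - c ^ 2)) := by
  set n : ℝ := ((m + 1 : ℕ) : ℝ) with hn
  have hmn : (m : ℝ) = n - 1 := by rw [hn]; push_cast; ring
  have hn2 : 2 ≤ n := by rw [hn]; exact_mod_cast Nat.succ_le_succ hm
  have hn0 : 0 < n := by linarith
  have hcc : 0 < 1 - c ^ 2 := by nlinarith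
  -- At `1 / (2 (1 - c²))` the exponential moment of the first coordinate is infinite; the factor
  -- `1 - 1 / n` makes it `√n`, and costs only a bounded factor in the other coordinates.
  set lam := (1 - 1 / n) / (2 * (1 - c ^ 2)) with hlam
  have h1n : 0 < 1 - 1 / n := by
    have : 1 / n < 1 := by rw [div_lt_one hn0]; linarith
    linarith
  have hlam0 : 0 < lam := by positivity
  set θ : Fin (m + 1) → ℝ := Fin.cons (-(lam * (1 - c ^ 2))) fun _ => lam * c ^ 2 with hθ
  have hθ0 : 1 + 2 * θ 0 = 1 / n := by
    simp only [hθ, Fin.cons_zero, hlam]; field_simp; ring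
  have hθs : ∀ i : Fin m, 1 + 2 * θ i.succ = (1 - c ^ 2 / n) / (1 - c ^ 2) := fun i => by
    simp only [hθ, Fin.cons_succ, hlam]; field_simp; ring
  have hcn : 1 - 1 / n ≤ 1 - c ^ 2 / n := by
    gcongr; nlinarith
  have hθpos : ∀ i, 0 < 1 + 2 * θ i := fun i => by
    refine Fin.cases ?_ (fun i => ?_) i
    · rw [hθ0]; positivity
    · rw [hθs]; exact div_pos (by linarith) hcc
  have hint : Integrable (fun y : Fin (m + 1) → ℝ => ∏ i, Real.exp (-θ i * y i ^ 2))
      (stdGaussianVec (m + 1)) :=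
    Integrable.fintype_prod (f := fun i x => Real.exp (-θ i * x ^ 2))
      fun i => integrable_exp_neg_mul_sq_gaussianReal (hθpos i)
  have hmarkov := mul_meas_ge_le_integral_of_nonneg
    (ae_of_all _ fun y => Finset.prod_nonneg fun i _ => (Real.exp_pos _).le) hint 1
  rw [one_mul, stdGaussianVec,
    integral_fintype_prod_eq_prod (f := fun i x => Real.exp (-θ i * x ^ 2))] at hmarkov
  simp only [integral_exp_neg_mul_sq_gaussianReal (hθpos _)] at hmarkov
  rw [Fin.prod_univ_succ, hθ0] at hmarkov
  simp only [hθs] at hmarkov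
  rw [Finset.prod_const, Finset.card_univ, Fintype.card_fin] at hmarkov
  have hsub : {y : Fin (m + 1) → ℝ | c * √(∑ i, y i ^ 2) ≤ y 0} ⊆
      {y | 1 ≤ ∏ i, Real.exp (-θ i * y i ^ 2)} := fun y hy => by
    have hy' : c * √(∑ i, y i ^ 2) ≤ y 0 := hy
    have hsq : (c * √(∑ i, y i ^ 2)) ^ 2 ≤ y 0 ^ 2 := by gcongr
    rw [mul_pow, Real.sq_sqrt (Finset.sum_nonneg fun i _ => sq_nonneg _), Fin.sum_univ_succ] at hsq
    rw [Set.mem_ofPred_eq, ← Real.exp_sum, Real.one_le_exp_iff, Fin.sum_univ_succ]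
    simp only [hθ, Fin.cons_zero, Fin.cons_succ]
    rw [← Finset.mul_sum]
    nlinarith [mul_le_mul_of_nonneg_left hsq hlam0.le]
  refine (measureReal_mono hsub).trans (hmarkov.trans ?_)
  have e1 : √(1 / (1 / n)) = Real.exp (1 / 2 * Real.log n) := by
    rw [one_div_one_div, Real.sqrt_eq_rpow, Real.rpow_def_of_pos hn0, mul_comm]
  have hpos : 0 < 1 / ((1 - c ^ 2 / n) / (1 - c ^ 2)) := one_div_pos.2 (div_pos (by linarith) hcc)
  have e2 : √(1 / ((1 - c ^ 2 / n) / (1 - c ^ 2))) ^ m =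
      Real.exp (m / 2 * (Real.log (1 - c ^ 2) - Real.log (1 - c ^ 2 / n))) := by
    rw [Real.sqrt_eq_rpow, ← Real.rpow_natCast, ← Real.rpow_mul hpos.le, Real.rpow_def_of_pos hpos,
      one_div_div, Real.log_div hcc.ne' (by linarith)]
    congr 1; ring
  rw [e1, e2, ← Real.exp_add, Real.exp_le_exp]
  -- `-log(1 - c²/n) ≤ -log(1 - 1/n) ≤ 1/(n - 1)`.
  have hl1 : Real.log (1 - 1 / n) ≤ Real.log (1 - c ^ 2 / n) := Real.log_le_log h1n hcn
  have hl2 : 1 - (1 - 1 / n)⁻¹ ≤ Real.log (1 - 1 / n) := Real.one_sub_inv_le_log_of_pos h1n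
  have hl3 : m / 2 * (1 - (1 - 1 / n)⁻¹) = -(1 / 2) := by
    have : n - 1 ≠ 0 := by intro h; linarith
    rw [hmn]; field_simp; ring
  have hm0 : (0 : ℝ) ≤ m / 2 := by positivity
  have := mul_le_mul_of_nonneg_left (hl2.trans hl1) hm0
  rw [hl3] at this
  rw [mul_sub]
  have e3 : (m : ℝ) / 2 * Real.log (1 - c ^ 2) =
      n / 2 * Real.log (1 - c ^ 2) - 1 / 2 * Real.log (1 - c ^ 2) := by rw [hmn]; ring
  linarith

lemma integral_exp_neg_sub_sq_gaussianReal {P D : ℝ} (hP : 0 < P) (hD : 0 < D) (x : ℝ) :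
    ∫ y, Real.exp (-(x - y) ^ 2 / (2 * D)) ∂gaussianReal 0 P.toNNReal =
      √(D / (D + P)) * Real.exp (-x ^ 2 / (2 * (D + P))) := by
  have hP' : P.toNNReal ≠ 0 := by simpa using hP
  rw [integral_gaussianReal_eq_integral_smul hP']
  set B := (D + P) / (2 * D * P) with hB
  set u := x * P / (D + P) with hu
  have e : ∀ y : ℝ, gaussianPDFReal 0 P.toNNReal y • Real.exp (-(x - y) ^ 2 / (2 * D)) =
      (√(2 * Real.pi * P))⁻¹ * Real.exp (-x ^ 2 / (2 * (D + P))) *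
        Real.exp (-B * (y - u) ^ 2) := fun y => by
    rw [gaussianPDFReal, Real.coe_toNNReal _ hP.le, smul_eq_mul,
      mul_assoc _ (Real.exp _) (Real.exp _), mul_assoc _ (Real.exp _) (Real.exp _),
      ← Real.exp_add, ← Real.exp_add]
    congr 2
    rw [hB, hu]; field_simp; ring
  simp only [e]
  rw [integral_const_mul, integral_sub_right_eq_self (fun y => Real.exp (-B * y ^ 2)),
    integral_gaussian]
  have e2 : (√(2 * Real.pi * P))⁻¹ * √(Real.pi / B) = √(D / (D + P)) := by
    rw [← Real.sqrt_inv, ← Real.sqrt_mul (by positivity)]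
    congr 1
    have := Real.pi_pos
    rw [hB]; field_simp
  rw [← e2]; ring

lemma integrable_exp_neg_sub_sq_gaussianReal {P D : ℝ} (hD : 0 < D) (x : ℝ) :
    Integrable (fun y => Real.exp (-(x - y) ^ 2 / (2 * D))) (gaussianReal 0 P.toNNReal) := by
  refine Integrable.of_bound (by fun_prop) 1 (ae_of_all _ fun y => ?_)
  rw [Real.norm_of_nonneg (Real.exp_pos _).le, Real.exp_le_one_iff, neg_div]
  have : 0 ≤ (x - y) ^ 2 / (2 * D) := by positivity
  linarith

lemma distortion_le_iff {n : ℕ} (hn : n ≠ 0) (x y : Fin n → ℝ) (D : ℝ) :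
    distortion x y ≤ D ↔ ∑ i, (x i - y i) ^ 2 ≤ n * D := by
  have : (0 : ℝ) < n := by positivity
  rw [distortion, one_div, inv_mul_le_iff₀ this]

/-- The Chernoff bound with exponent `1 / (2 D)` per unit of squared distance; for the i.i.d.
Gaussian codebook it has no error term. -/
lemma coverProb_iidGaussianLaw_le {P D : ℝ} (hP : 0 < P) (hD : 0 < D) {n : ℕ} (hn : n ≠ 0)
    (x : Fin n → ℝ) : coverProb (iidGaussianLaw P n) D x ≤
      Real.exp (-(n * firstOrderRate (D + P) D + logDev (D + P) x)) := by
  have hint : Integrable (fun y : Fin n → ℝ => ∏ i, Real.exp (-(x i - y i) ^ 2 / (2 * D)))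
      (iidGaussianLaw P n) :=
    Integrable.fintype_prod (f := fun i t => Real.exp (-(x i - t) ^ 2 / (2 * D)))
      fun i => integrable_exp_neg_sub_sq_gaussianReal hD (x i)
  have hmarkov := mul_meas_ge_le_integral_of_nonneg
    (ae_of_all _ fun y => Finset.prod_nonneg fun i _ => (Real.exp_pos _).le) hint
    (Real.exp (-(n / 2)))
  have hfin : IsProbabilityMeasure (iidGaussianLaw P n) := by
    unfold iidGaussianLaw; infer_instance
  have hsub : {y | distortion x y ≤ D} ⊆
      {y | Real.exp (-(n / 2)) ≤ ∏ i, Real.exp (-(x i - y i) ^ 2 / (2 * D))} := fun y hy => by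
    have hy' := (distortion_le_iff hn x y D).1 hy
    rw [Set.mem_ofPred_eq, ← Real.exp_sum, Real.exp_le_exp, ← Finset.sum_div,
      Finset.sum_neg_distrib, neg_div, neg_le_neg_iff, div_le_iff₀ (by positivity)]
    linarith
  rw [coverProb, ← mul_le_mul_iff_right₀ (Real.exp_pos (-(n / 2)))]
  refine (mul_le_mul_of_nonneg_left (measureReal_mono hsub) (Real.exp_pos _).le).trans
    (hmarkov.trans (le_of_eq ?_))
  rw [iidGaussianLaw,
    integral_fintype_prod_eq_prod (f := fun i t => Real.exp (-(x i - t) ^ 2 / (2 * D)))]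
  simp only [integral_exp_neg_sub_sq_gaussianReal hP hD]
  have hs : 0 < D + P := by linarith
  rw [Finset.prod_mul_distrib, Finset.prod_const, Finset.card_univ, Fintype.card_fin,
    ← Real.exp_sum, Real.sqrt_eq_rpow, ← Real.rpow_natCast, ← Real.rpow_mul (by positivity),
    Real.rpow_def_of_pos (by positivity), ← Real.exp_add, ← Real.exp_add]
  congr 1
  have hsum : ∑ i, (x i ^ 2 - (D + P)) / (2 * (D + P)) =
      ∑ i, x i ^ 2 / (2 * (D + P)) - (n : ℝ) / 2 := by
    simp only [sub_div, Finset.sum_sub_distrib, Finset.sum_const, Finset.card_univ,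
      Fintype.card_fin, nsmul_eq_mul]
    congr 1; field_simp
  have hlog : Real.log (D / (D + P)) = -Real.log ((D + P) / D) := by
    rw [← Real.log_inv, inv_div]
  simp only [neg_div, Finset.sum_neg_distrib]
  rw [logDev, firstOrderRate, hsum, hlog]
  ring

/-! ### Second-order expansions in the source power -/

/-- First-order Taylor expansion with a quadratic remainder. -/
lemma exists_abs_sub_linear_le {f : ℝ → ℝ} {B : ℝ} (hf : ContDiffAt ℝ 2 f 0)
    (hB : HasDerivAt f B 0) :
    ∃ C, 0 ≤ C ∧ ∀ᶠ t in 𝓝 (0 : ℝ), |f t - (f 0 + B * t)| ≤ C * t ^ 2 := by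
  have hd : ContDiffAt ℝ 1 (deriv f) 0 :=
    (hf.fderiv_right (m := 1) (by norm_num)).clm_apply (contDiffAt_const (c := (1 : ℝ)))
  obtain ⟨K, U, hU, hK⟩ := hd.exists_lipschitzOnWith
  have hdiff : ∀ᶠ t in 𝓝 (0 : ℝ), DifferentiableAt ℝ f t := by
    filter_upwards [hf.eventually (by simp)] with t ht
    exact ht.differentiableAt (by simp)
  obtain ⟨δ, hδ, hball⟩ := Metric.eventually_nhds_iff_ball.1 (hdiff.and hU)
  refine ⟨K, K.2, ?_⟩
  filter_upwards [Metric.ball_mem_nhds (0 : ℝ) hδ] with t ht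
  have ht' : |t| < δ := by simpa using ht
  have hseg : ∀ u ∈ Metric.closedBall (0 : ℝ) |t|, u ∈ Metric.ball (0 : ℝ) δ := fun u hu => by
    have : |u| ≤ |t| := by simpa using hu
    simpa using this.trans_lt ht'
  have h := (convex_closedBall (0 : ℝ) |t|).norm_image_sub_le_of_norm_hasDerivWithin_le
    (f := fun u => f u - B * u) (f' := fun u => deriv f u - B) (C := K * |t|) (x := 0) (y := t)
    (fun u hu => ?_) (fun u hu => ?_) (by simp) (by simp)
  · simp only [mul_zero, sub_zero, Real.norm_eq_abs] at h
    rw [show f t - (f 0 + B * t) = f t - B * t - f 0 by ring, ← sq_abs t]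
    linarith
  · have h1 := (hball u (hseg u hu)).1.hasDerivAt
    have h2 := (hasDerivAt_id u).const_mul B
    exact ((h1.sub h2).congr_deriv (by simp)).hasDerivWithinAt
  · have h1 := hK.dist_le_mul u (hball u (hseg u hu)).2 0 (mem_of_mem_nhds hU)
    rw [hB.deriv, Real.dist_eq, Real.dist_eq, sub_zero] at h1
    have : |u| ≤ |t| := by simpa using hu
    exact h1.trans (by gcongr)

/-- The exponent of the window probability, to first order in the deviation `t` of the source power:
it only depends on the value and the slope of the radius parameter `b` at `0`. -/
lemma exists_window_exponent_bound {s D : ℝ} (hD0 : 0 < D) (hD : D < s) {b : ℝ → ℝ}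
    (hb : ContDiffAt ℝ 2 b 0) (hb0 : b 0 = D / s) (hb' : HasDerivAt b (-2 * D / (s - D)) 0) :
    ∃ C, 0 ≤ C ∧ ∀ᶠ t in 𝓝 (0 : ℝ), 0 < b t ∧ b t ≤ 1 ∧
      -(firstOrderRate s D + t) - C * t ^ 2 ≤
        1 / 2 * (1 - (s - D) / s - b t + Real.log (b t)) := by
  have hs : 0 < s := hD0.trans hD
  have hP : 0 < s - D := sub_pos.2 hD
  have hb00 : 0 < b 0 := by rw [hb0]; positivity
  have hb01 : b 0 < 1 := by rw [hb0, div_lt_one hs]; exact hD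
  have hf : ContDiffAt ℝ 2 (fun t => 1 / 2 * (1 - (s - D) / s - b t + Real.log (b t))) 0 :=
    contDiffAt_const.mul ((contDiffAt_const.sub hb).add (hb.log hb00.ne'))
  have hf' : HasDerivAt (fun t => 1 / 2 * (1 - (s - D) / s - b t + Real.log (b t))) (-1) 0 := by
    refine (((hb'.const_sub (1 - (s - D) / s)).add (hb'.log hb00.ne')).const_mul
      (1 / 2)).congr_deriv ?_
    rw [hb0]
    field_simp
    ring
  obtain ⟨C, hC0, hC⟩ := exists_abs_sub_linear_le hf hf'
  refine ⟨C, hC0, ?_⟩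
  filter_upwards [hC, hb.continuousAt.eventually (lt_mem_nhds hb00),
    hb.continuousAt.eventually (gt_mem_nhds hb01)] with t ht h0 h1
  refine ⟨h0, h1.le, ?_⟩
  have hR : 1 / 2 * (1 - (s - D) / s - b 0 + Real.log (b 0)) = -firstOrderRate s D := by
    rw [hb0, firstOrderRate, ← inv_div s D, Real.log_inv, inv_div]
    field_simp
    ring
  rw [hR] at ht
  have := (abs_le.1 ht).1
  linarith

lemma sum_sq_eq_logDev {s : ℝ} (hs : s ≠ 0) {n : ℕ} (hn : n ≠ 0) (x : Fin n → ℝ) :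
    ∑ i, x i ^ 2 = n * (s * (1 + 2 * (logDev s x / n))) := by
  have : (n : ℝ) ≠ 0 := by exact_mod_cast hn
  rw [logDev, ← Finset.sum_div, Finset.sum_sub_distrib]
  simp only [Finset.sum_const, Finset.card_univ, Fintype.card_fin, nsmul_eq_mul]
  field_simp
  ring

/-! ### Covering probabilities through two Gaussian statistics -/

lemma measureReal_inner_normSq_stdGaussianVec {m : ℕ} (x : Fin (m + 1) → ℝ) {A : Set (ℝ × ℝ)}
    (hA : MeasurableSet A) :
    (stdGaussianVec (m + 1)).real {y | (∑ i, x i * y i, ∑ i, y i ^ 2) ∈ A} =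
      (stdGaussianVec (m + 1)).real {y | (√(∑ i, x i ^ 2) * y 0, ∑ i, y i ^ 2) ∈ A} := by
  have h := congrArg (fun ν => Measure.real ν A) (map_inner_normSq_stdGaussianVec x)
  rwa [map_measureReal_apply (by fun_prop) hA, map_measureReal_apply (by fun_prop) hA] at h

lemma coverProb_iidGaussianLaw_eq {P : ℝ} (hP : 0 ≤ P) (D : ℝ) {m : ℕ} (x : Fin (m + 1) → ℝ) :
    coverProb (iidGaussianLaw P (m + 1)) D x = (stdGaussianVec (m + 1)).real
      {y | ∑ i, x i ^ 2 - 2 * √P * (√(∑ i, x i ^ 2) * y 0) + P * ∑ i, y i ^ 2 ≤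
        (m + 1 : ℕ) * D} := by
  have hA : MeasurableSet {p : ℝ × ℝ | ∑ i, x i ^ 2 - 2 * √P * p.1 + P * p.2 ≤ (m + 1 : ℕ) * D} :=
    measurableSet_le (by fun_prop) measurable_const
  have hmx : MeasurableSet {y : Fin (m + 1) → ℝ | distortion x y ≤ D} :=
    measurableSet_le (measurable_distortion measurable_const measurable_id) measurable_const
  rw [coverProb, iidGaussianLaw_eq_map hP, map_measureReal_apply (by fun_prop) hmx]
  refine Eq.trans ?_ (measureReal_inner_normSq_stdGaussianVec x hA)
  congr 1
  ext y
  simp only [Set.mem_preimage, Set.mem_ofPred_eq]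
  rw [distortion_le_iff (by simp)]
  have e : ∑ i, (x i - √P * y i) ^ 2 =
      ∑ i, x i ^ 2 - 2 * √P * ∑ i, x i * y i + P * ∑ i, y i ^ 2 := by
    rw [Finset.mul_sum, Finset.mul_sum, ← Finset.sum_sub_distrib, ← Finset.sum_add_distrib]
    refine Finset.sum_congr rfl fun i _ => ?_
    rw [sub_sq, mul_pow, Real.sq_sqrt hP]
    ring
  rw [e]

lemma coverProb_sphericalLaw_eq {P : ℝ} (hP : 0 ≤ P) (D : ℝ) {m : ℕ} (x : Fin (m + 1) → ℝ) :
    coverProb (sphericalLaw P (m + 1)) D x = (stdGaussianVec (m + 1)).real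
      {y | ∑ i, x i ^ 2 - 2 * √((m + 1 : ℕ) * P) * (√(∑ i, x i ^ 2) * y 0 / √(∑ i, y i ^ 2)) +
        (m + 1 : ℕ) * P * (∑ i, y i ^ 2 / √(∑ i, y i ^ 2) ^ 2) ≤ (m + 1 : ℕ) * D} := by
  have hnP : (0 : ℝ) ≤ (m + 1 : ℕ) * P := by positivity
  have hA : MeasurableSet {p : ℝ × ℝ | ∑ i, x i ^ 2 - 2 * √((m + 1 : ℕ) * P) * (p.1 / √p.2) +
      (m + 1 : ℕ) * P * (p.2 / √p.2 ^ 2) ≤ (m + 1 : ℕ) * D} :=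
    measurableSet_le (by fun_prop) measurable_const
  have h := measureReal_inner_normSq_stdGaussianVec x hA
  simp only [Set.mem_ofPred_eq] at h
  simp only [← Finset.sum_div]
  have hmx : MeasurableSet {y : Fin (m + 1) → ℝ | distortion x y ≤ D} :=
    measurableSet_le (measurable_distortion measurable_const measurable_id) measurable_const
  rw [← h, coverProb, sphericalLaw_eq_map, map_measureReal_apply (by fun_prop) hmx]
  congr 1
  ext y
  simp only [Set.mem_preimage, Set.mem_ofPred_eq]
  rw [distortion_le_iff (by simp)]
  set r := √(∑ j, y j ^ 2)
  have e : ∑ i, (x i - √((m + 1 : ℕ) * P) * (y i / r)) ^ 2 =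
      ∑ i, x i ^ 2 - 2 * √((m + 1 : ℕ) * P) * ((∑ i, x i * y i) / r) +
        (m + 1 : ℕ) * P * ((∑ i, y i ^ 2) / r ^ 2) := by
    rw [Finset.sum_div, Finset.sum_div, Finset.mul_sum, Finset.mul_sum, ← Finset.sum_sub_distrib,
      ← Finset.sum_add_distrib]
    refine Finset.sum_congr rfl fun i _ => ?_
    rw [sub_sq, mul_pow, Real.sq_sqrt hnP]
    ring
  rw [e]

/-- A covering estimate follows from inscribing a window in the covering event, as soon as the
radius parameter `b` of the window has the right value and slope when the source power is typical,
together with an upper bound of the same order. -/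
lemma hasCoverEstimate_of_window {ν : (n : ℕ) → Measure (Fin n → ℝ)} {s D : ℝ} (hD0 : 0 < D)
    (hD : D < s) (hprob : ∀ᶠ n in atTop, IsProbabilityMeasure (ν n)) {b : ℝ → ℝ}
    (hb : ContDiffAt ℝ 2 b 0) (hb0 : b 0 = D / s) (hb' : HasDerivAt b (-2 * D / (s - D)) 0)
    {N : ℕ} (hlow : ∀ᶠ t in 𝓝 (0 : ℝ), ∀ m : ℕ, N ≤ m → ∀ x : Fin (m + 1) → ℝ,
      ∑ i, x i ^ 2 = (m + 1 : ℕ) * (s * (1 + 2 * t)) →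
        (stdGaussianVec (m + 1)).real (window m √((s - D) / s) (b t)) ≤ coverProb (ν (m + 1)) D x)
    {K : ℝ} (hK : 0 ≤ K) (hup : ∀ᶠ t in 𝓝 (0 : ℝ), ∀ m : ℕ, 1 ≤ m → ∀ x : Fin (m + 1) → ℝ,
      ∑ i, x i ^ 2 = (m + 1 : ℕ) * (s * (1 + 2 * t)) →
        coverProb (ν (m + 1)) D x ≤ Real.exp (-((m + 1 : ℕ) * (firstOrderRate s D + t)) +
          K * ((m + 1 : ℕ) * t ^ 2 + 1 + Real.log (m + 1 : ℕ)))) :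
    HasCoverEstimate ν s D := by
  have hs : 0 < s := hD0.trans hD
  have hP : 0 < s - D := sub_pos.2 hD
  obtain ⟨C, hC0, hC⟩ := exists_window_exponent_bound hD0 hD hb hb0 hb'
  obtain ⟨δ, hδ, hball⟩ := Metric.eventually_nhds_iff_ball.1 ((hlow.and hup).and hC)
  set a := √((s - D) / s) with ha
  have ha0 : 0 ≤ a := Real.sqrt_nonneg _
  have ha2 : a ^ 2 = (s - D) / s := Real.sq_sqrt (by positivity)
  have hlog1 : ∀ᶠ n : ℕ in atTop, 1 ≤ Real.log n :=
    (Real.tendsto_log_atTop.comp tendsto_natCast_atTop_atTop).eventually_ge_atTop 1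
  refine ⟨C + 2 * K + a + 6, δ / 2, by positivity, by positivity, ?_⟩
  filter_upwards [hprob, hlog1, eventually_ge_atTop (N + 2)] with n hpn hlogn hn
  refine ⟨hpn, fun x hx => ?_⟩
  obtain ⟨m, rfl⟩ : ∃ m, n = m + 1 := ⟨n - 1, by omega⟩
  have hn0 : (0 : ℝ) < (m + 1 : ℕ) := by positivity
  have hsum := sum_sq_eq_logDev hs.ne' (Nat.succ_ne_zero m) x
  set L := logDev s x with hL
  set n : ℝ := ((m + 1 : ℕ) : ℝ) with hnn
  set t := L / n with ht
  have htL : L = n * t := by rw [ht]; field_simp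
  have ht' : |t| < δ := by
    rw [ht, abs_div, abs_of_pos hn0, div_lt_iff₀ hn0]
    nlinarith
  obtain ⟨⟨hlo, hu⟩, hb1, hb2, hexp⟩ := hball t (by simpa using ht')
  have hlo := hlo m (by omega) x hsum
  have hu := hu m (by omega) x hsum
  have hw := le_stdGaussianVec_window (m := m) (by omega) ha0 hb1 hb2
  rw [ha2] at hw
  have hq : L ^ 2 / n = n * t ^ 2 := by rw [htL]; field_simp
  rw [hq, htL]
  have hnt : 0 ≤ n * t ^ 2 := by positivity
  constructor
  · refine le_trans (Real.exp_le_exp.2 ?_) (hw.trans hlo)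
    have h1 := mul_le_mul_of_nonneg_left hexp hn0.le
    have h2 : a ≤ a * Real.log n := le_mul_of_one_le_right ha0 hlogn
    have h3 : 0 ≤ (2 * K + a + 6) * (n * t ^ 2) := by positivity
    have h4 : 0 ≤ (C + 2 * K) * Real.log n := by positivity
    nlinarith
  · refine hu.trans (Real.exp_le_exp.2 ?_)
    have h2 : K ≤ K * Real.log n := le_mul_of_one_le_right hK hlogn
    have h3 : 0 ≤ (C + K + a + 6) * (n * t ^ 2) := by positivity
    have h4 : 0 ≤ (C + a + 6) * Real.log n := by positivity
    nlinarith

/-! ### The i.i.d. Gaussian codebook -/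

/-- The first coordinate of a codeword in the window leaves a residual along `x` of squared length
at most `n (s √(1 + 2 t) - (s - D))² / s`; the radius of the window uses up the remaining
distortion. -/
lemma hasCoverEstimate_iidGaussianLaw {s D : ℝ} (hD0 : 0 < D) (hD : D < s) :
    HasCoverEstimate (iidGaussianLaw (s - D)) s D := by
  have hs : 0 < s := hD0.trans hD
  have hP : 0 < s - D := sub_pos.2 hD
  set P := s - D with hPdef
  have hone : HasDerivAt (fun t : ℝ => 1 + 2 * t) 2 0 := by
    simpa using ((hasDerivAt_id (0 : ℝ)).const_mul 2).const_add 1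
  have hw' : HasDerivAt (fun t : ℝ => s * √(1 + 2 * t)) s 0 :=
    ((hone.sqrt (by norm_num)).const_mul s).congr_deriv (by norm_num)
  have hwc : ContDiffAt ℝ 2 (fun t : ℝ => s * √(1 + 2 * t)) 0 :=
    contDiffAt_const.mul (ContDiffAt.sqrt (by fun_prop) (by norm_num))
  refine hasCoverEstimate_of_window hD0 hD (Eventually.of_forall fun n => by
      unfold iidGaussianLaw; infer_instance)
    (b := fun t => (D - (s * √(1 + 2 * t) - P) ^ 2 / s) / P)
    ((contDiffAt_const.sub (((hwc.sub contDiffAt_const).pow 2).div_const s)).div_const P) ?_ ?_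
    (N := ⌈2 * √(s * P) / D⌉₊) ?_ (K := 0) le_rfl ?_
  · simp only [mul_zero, add_zero, Real.sqrt_one, mul_one]
    rw [show s - P = D by rw [hPdef]; ring]
    field_simp
    rw [hPdef]
  · refine (((((hw'.sub_const P).pow 2).div_const s).const_sub D).div_const P).congr_deriv ?_
    simp only [mul_zero, add_zero, Real.sqrt_one, mul_one]
    rw [show s - P = D by rw [hPdef]; ring, ← hPdef]
    norm_num
    field_simp
  · have hgt : ∀ᶠ t in 𝓝 (0 : ℝ), P + D / 2 < s * √(1 + 2 * t) :=
      hw'.continuousAt.eventually (lt_mem_nhds (by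
        simp only [mul_zero, add_zero, Real.sqrt_one, mul_one]; linarith))
    have hpos : ∀ᶠ t in 𝓝 (0 : ℝ), 0 < 1 + 2 * t :=
      hone.continuousAt.eventually (lt_mem_nhds (by norm_num))
    filter_upwards [hgt, hpos] with t ht ht0 m hm x hx
    rw [coverProb_iidGaussianLaw_eq hP.le]
    refine measureReal_mono fun y hy => ?_
    obtain ⟨⟨hy0, hy1⟩, hyS⟩ := hy
    have hn0 : (0 : ℝ) < (m + 1 : ℕ) := by positivity
    have hmn : 2 * √(s * P) / D ≤ (m + 1 : ℕ) :=
      (Nat.le_ceil _).trans (by exact_mod_cast hm.trans (Nat.le_succ m))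
    simp only [Set.mem_ofPred_eq]
    rw [Fin.sum_univ_succ (fun i => y i ^ 2), hx]
    set n : ℝ := ((m + 1 : ℕ) : ℝ)
    set S := ∑ i : Fin m, y i.succ ^ 2
    set w := s * √(1 + 2 * t) with hw
    have hsn : 0 < √n := Real.sqrt_pos.2 hn0
    have hss : 0 < √s := Real.sqrt_pos.2 hs
    have hnn : √n ^ 2 = n := Real.sq_sqrt hn0.le
    have hs2 : √s ^ 2 = s := Real.sq_sqrt hs.le
    have hP2 : √P ^ 2 = P := Real.sq_sqrt hP.le
    have hX : √(n * (s * (1 + 2 * t))) = √n * (w / √s) := by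
      rw [Real.sqrt_mul hn0.le, Real.sqrt_mul hs.le, hw]
      congr 1
      field_simp
      rw [hs2]
    have hX2 : n * (s * (1 + 2 * t)) = (√n * (w / √s)) ^ 2 := by
      rw [← hX, Real.sq_sqrt (by positivity)]
    have ha : √(P / s) = √P / √s := Real.sqrt_div hP.le s
    rw [hX, hX2]
    rw [ha] at hy0 hy1
    -- The component of `x - √P y` along `x`.
    set Z := √n * (w / √s) - √P * y 0 with hZ
    -- The residual must not change sign, as only its upper bound is controlled by `y 0 ≥ √n a`;
    -- this is where the length `1 / √n` of the interval and the lower bound on `n` come in.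
    have hZ0 : 0 ≤ Z := by
      have h1 : √P * y 0 ≤ √P * (√n * (√P / √s) + 1 / √n) := by gcongr
      have h2 : √P * (√n * (√P / √s) + 1 / √n) = √n * ((P + √s * √P / n) / √s) := by
        field_simp
        linear_combination n * √n ^ 2 * hP2 - √P * √s * hnn
      have h3 : P + √s * √P / n ≤ w := by
        rw [Real.sqrt_mul hs.le, div_le_iff₀ hD0] at hmn
        have : √s * √P / n ≤ D / 2 := by rw [div_le_iff₀ hn0]; linarith
        linarith
      have h4 : √n * ((P + √s * √P / n) / √s) ≤ √n * (w / √s) := by gcongr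
      rw [hZ]
      linarith
    have hZ1 : Z ≤ √n * ((w - P) / √s) := by
      have h1 : √P * (√n * (√P / √s)) ≤ √P * y 0 := by gcongr
      have h2 : √P * (√n * (√P / √s)) = √n * (P / √s) := by
        rw [← hP2]; ring_nf; rw [Real.sqrt_sq (Real.sqrt_nonneg _)]
      rw [hZ, sub_div, mul_sub]
      linarith
    have hZ2 : Z ^ 2 ≤ n * ((w - P) ^ 2 / s) := by
      refine (pow_le_pow_left₀ hZ0 hZ1 2).trans_eq ?_
      rw [mul_pow, div_pow, hnn, hs2]
    have hS2 : P * S ≤ n * (D - (w - P) ^ 2 / s) := by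
      refine (mul_le_mul_of_nonneg_left hyS hP.le).trans_eq ?_
      field_simp
    have e : (√n * (w / √s)) ^ 2 - 2 * √P * (√n * (w / √s) * y 0) + P * (y 0 ^ 2 + S) =
        Z ^ 2 + P * S := by
      rw [hZ]
      linear_combination -(y 0 ^ 2) * hP2
    rw [e]
    linarith
  · refine Eventually.of_forall fun t m _ x hx => ?_
    have h := coverProb_iidGaussianLaw_le hP hD0 (Nat.succ_ne_zero m) x
    rw [show D + P = s by rw [hPdef]; ring] at h
    refine h.trans_eq ?_
    have hn0 : ((m + 1 : ℕ) : ℝ) ≠ 0 := by positivity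
    have h2 := sum_sq_eq_logDev hs.ne' (Nat.succ_ne_zero m) x
    rw [hx, mul_right_inj' hn0, mul_right_inj' hs.ne'] at h2
    have : logDev s x = (m + 1 : ℕ) * t := by
      have : t = logDev s x / (m + 1 : ℕ) := by linarith
      rw [this]; field_simp
    rw [this]
    congr 1
    ring

/-! ### The spherical codebook -/

/-- For a spherical codeword, covering `x` means that the angle between the codeword and `x` is
small; here `r ^ 2` is the power of the source sequence. -/
lemma spherical_cover_iff {n P D r q v : ℝ} (hn : 0 < n) (hP : 0 < P) (hr : 0 < r) (hq : 0 < q) :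
    n * r ^ 2 - 2 * √(n * P) * (√(n * r ^ 2) * v / √q) + n * P * (q / √q ^ 2) ≤ n * D ↔
      (r ^ 2 + P - D) / (2 * (√P * r)) * √q ≤ v := by
  have hsq : 0 < √q := Real.sqrt_pos.2 hq
  have hsP : 0 < √P := Real.sqrt_pos.2 hP
  have hnn : √n ^ 2 = n := Real.sq_sqrt hn.le
  rw [Real.sqrt_mul hn.le, Real.sqrt_mul hn.le, Real.sqrt_sq hr.le, Real.sq_sqrt hq.le,
    div_self hq.ne', mul_one]
  have e : 2 * (√n * √P) * (√n * r * v / √q) = n * (2 * (√P * r) * (v / √q)) := by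
    nth_rewrite 3 [← hnn]; ring
  rw [e, div_mul_eq_mul_div, div_le_iff₀ (by positivity), ← le_div_iff₀ hsq]
  rw [show n * r ^ 2 - n * (2 * (√P * r) * (v / √q)) + n * P =
    n * (r ^ 2 - 2 * (√P * r) * (v / √q) + P) by ring, mul_le_mul_iff_right₀ hn]
  rw [show v * (2 * (√P * r)) / √q = 2 * (√P * r) * (v / √q) by ring]
  constructor <;> intro h <;> linarith

/-- The cosine of the largest angle between a codeword of power `s - D` and a source sequence of
power `s * (1 + 2 * t)` at distortion `D`. -/
noncomputable def coverCos (s D t : ℝ) : ℝ := (s - D + s * t) / (√(s - D) * √(s * (1 + 2 * t)))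

lemma coverCos_sq {s D t : ℝ} (hD : D < s) (hs : 0 < s) (ht : 0 < 1 + 2 * t) :
    coverCos s D t ^ 2 = (s - D + s * t) ^ 2 / ((s - D) * (s * (1 + 2 * t))) := by
  rw [coverCos, div_pow, mul_pow, Real.sq_sqrt (sub_nonneg.2 hD.le), Real.sq_sqrt (by positivity)]

/-- The covering event is contained in a cone; at the origin, where normalization has a junk value,
the cone condition holds trivially. -/
lemma coverProb_sphericalLaw_le_cone {s D t : ℝ} (hD : D < s) (hs : 0 < s) (ht : 0 < 1 + 2 * t)
    {m : ℕ} {x : Fin (m + 1) → ℝ} (hx : ∑ i, x i ^ 2 = (m + 1 : ℕ) * (s * (1 + 2 * t))) :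
    coverProb (sphericalLaw (s - D) (m + 1)) D x ≤
      (stdGaussianVec (m + 1)).real {y | coverCos s D t * √(∑ i, y i ^ 2) ≤ y 0} := by
  have hP : 0 < s - D := sub_pos.2 hD
  have hn0 : (0 : ℝ) < (m + 1 : ℕ) := by positivity
  have hr : 0 < √(s * (1 + 2 * t)) := Real.sqrt_pos.2 (by positivity)
  rw [coverProb_sphericalLaw_eq hP.le, hx]
  refine measureReal_mono fun y hy => ?_
  simp only [Set.mem_ofPred_eq] at hy ⊢
  rcases (Finset.sum_nonneg fun i _ => sq_nonneg (y i) : 0 ≤ ∑ i, y i ^ 2).eq_or_lt with hq | hq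
  · have h0 := (Finset.sum_eq_zero_iff_of_nonneg fun i _ => sq_nonneg (y i)).1 hq.symm 0
      (Finset.mem_univ _)
    rw [← hq, Real.sqrt_zero, mul_zero, pow_eq_zero_iff two_ne_zero |>.1 h0]
  · rw [← Finset.sum_div] at hy
    have hrr : √(s * (1 + 2 * t)) ^ 2 = s * (1 + 2 * t) := Real.sq_sqrt (by positivity)
    have h := (spherical_cover_iff (D := D) (v := y 0) hn0 hP hr hq)
    rw [hrr, show s * (1 + 2 * t) + (s - D) - D = 2 * (s - D + s * t) by ring,
      mul_div_mul_left _ _ (two_ne_zero' ℝ)] at h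
    exact h.1 hy

/-- The window whose squared radius is `(s - D) / s * (1 / c² - 1)` lies in the cone of cosine
`c = coverCos s D t`. -/
lemma window_le_coverProb_sphericalLaw {s D t : ℝ} (hD0 : 0 < D) (hD : D < s) (ht : 0 < 1 + 2 * t)
    (hc : 0 < s - D + s * t) {m : ℕ} {x : Fin (m + 1) → ℝ}
    (hx : ∑ i, x i ^ 2 = (m + 1 : ℕ) * (s * (1 + 2 * t))) :
    (stdGaussianVec (m + 1)).real (window m √((s - D) / s)
      ((s - D) / s * ((s - D) * (s * (1 + 2 * t)) / (s - D + s * t) ^ 2 - 1))) ≤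
        coverProb (sphericalLaw (s - D) (m + 1)) D x := by
  have hs : 0 < s := hD0.trans hD
  have hP : 0 < s - D := sub_pos.2 hD
  have hn0 : (0 : ℝ) < (m + 1 : ℕ) := by positivity
  have hr : 0 < √(s * (1 + 2 * t)) := Real.sqrt_pos.2 (by positivity)
  have hcc := coverCos_sq hD hs ht
  have hc0 : 0 < coverCos s D t :=
    div_pos hc (mul_pos (Real.sqrt_pos.2 hP) hr)
  rw [coverProb_sphericalLaw_eq hP.le, hx]
  refine measureReal_mono fun y hy => ?_
  obtain ⟨⟨hy0, -⟩, hyS⟩ := hy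
  have ha : 0 < √((m + 1 : ℕ) : ℝ) * √((s - D) / s) := by positivity
  have hy00 : 0 < y 0 := ha.trans_le hy0
  have hsum := Fin.sum_univ_succ (fun i => y i ^ 2)
  have hq : 0 < ∑ i, y i ^ 2 := by
    rw [hsum]
    exact add_pos_of_pos_of_nonneg (by positivity) (Finset.sum_nonneg fun i _ => sq_nonneg _)
  have hkey : coverCos s D t * √(∑ i, y i ^ 2) ≤ y 0 := by
    refine (sq_le_sq₀ (by positivity) hy00.le).1 ?_
    rw [mul_pow, Real.sq_sqrt hq.le, hsum]
    have h1 : (m + 1 : ℕ) * ((s - D) / s) ≤ y 0 ^ 2 := by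
      have := pow_le_pow_left₀ ha.le hy0 2
      rwa [mul_pow, Real.sq_sqrt hn0.le, Real.sq_sqrt (by positivity)] at this
    have hinv : (s - D) * (s * (1 + 2 * t)) / (s - D + s * t) ^ 2 = (coverCos s D t ^ 2)⁻¹ := by
      rw [hcc, inv_div]
    rw [hinv] at hyS
    set κ := coverCos s D t ^ 2
    have hκ : 0 < κ := by positivity
    set S := ∑ i : Fin m, y i.succ ^ 2
    have hS0 : 0 ≤ S := Finset.sum_nonneg fun i _ => sq_nonneg _
    have hκ1 : 0 ≤ κ⁻¹ - 1 := by
      by_contra hneg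
      have : (m + 1 : ℕ) * ((s - D) / s * (κ⁻¹ - 1)) < 0 :=
        mul_neg_of_pos_of_neg hn0 (mul_neg_of_pos_of_neg (by positivity) (not_le.1 hneg))
      linarith
    have h2 : S ≤ y 0 ^ 2 * (κ⁻¹ - 1) := by
      refine hyS.trans ?_
      rw [← mul_assoc]
      gcongr
    have h3 := mul_le_mul_of_nonneg_left h2 hκ.le
    have h4 : κ * (y 0 ^ 2 * (κ⁻¹ - 1)) = y 0 ^ 2 * (1 - κ) := by field_simp
    linarith
  simp only [Set.mem_ofPred_eq]
  rw [← Finset.sum_div]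
  have hrr : √(s * (1 + 2 * t)) ^ 2 = s * (1 + 2 * t) := Real.sq_sqrt (by positivity)
  have h := (spherical_cover_iff (D := D) (v := y 0) hn0 hP hr hq)
  rw [hrr, show s * (1 + 2 * t) + (s - D) - D = 2 * (s - D + s * t) by ring,
    mul_div_mul_left _ _ (two_ne_zero' ℝ)] at h
  exact h.2 hkey

lemma isProbabilityMeasure_sphericalLaw (P : ℝ) (n : ℕ) [NeZero n] :
    IsProbabilityMeasure (sphericalLaw P n) := by
  rw [sphericalLaw_eq_map]
  exact Measure.isProbabilityMeasure_map (by fun_prop)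

lemma hasCoverEstimate_sphericalLaw {s D : ℝ} (hD0 : 0 < D) (hD : D < s) :
    HasCoverEstimate (sphericalLaw (s - D)) s D := by
  have hs : 0 < s := hD0.trans hD
  have hP : 0 < s - D := sub_pos.2 hD
  have hone : HasDerivAt (fun t : ℝ => 1 + 2 * t) 2 0 := by
    simpa using ((hasDerivAt_id (0 : ℝ)).const_mul 2).const_add 1
  have hnum : HasDerivAt (fun t : ℝ => s - D + s * t) s 0 := by
    simpa using ((hasDerivAt_id (0 : ℝ)).const_mul s).const_add (s - D)
  have hsq : HasDerivAt (fun t : ℝ => (s - D + s * t) ^ 2) (2 * (s - D) * s) 0 :=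
    (hnum.pow 2).congr_deriv (by norm_num)
  have hprod : HasDerivAt (fun t : ℝ => (s - D) * (s * (1 + 2 * t))) ((s - D) * (s * 2)) 0 :=
    (hone.const_mul s).const_mul (s - D)
  have hpos : ∀ᶠ t in 𝓝 (0 : ℝ), 0 < 1 + 2 * t :=
    hone.continuousAt.eventually (lt_mem_nhds (by norm_num))
  have hnpos : ∀ᶠ t in 𝓝 (0 : ℝ), 0 < s - D + s * t :=
    hnum.continuousAt.eventually (lt_mem_nhds (by simpa using hD))
  set g : ℝ → ℝ := fun t => 1 - (s - D + s * t) ^ 2 / ((s - D) * (s * (1 + 2 * t))) with hg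
  have hden : (s - D) * (s * (1 + 2 * (0 : ℝ))) ≠ 0 := by
    simpa using ⟨hP.ne', hs.ne'⟩
  have hg0 : g 0 = D / s := by
    simp only [hg, mul_zero, add_zero, mul_one]
    field_simp
    ring
  have hg' : HasDerivAt g (-2 * (D / s)) 0 := by
    refine ((hsq.div hprod hden).const_sub 1).congr_deriv ?_
    simp only [mul_zero, add_zero, mul_one]
    field_simp
    ring
  have hgc : ContDiffAt ℝ 2 g 0 :=
    contDiffAt_const.sub (ContDiffAt.div (by fun_prop) (by fun_prop) hden)
  have hg00 : 0 < g 0 := by rw [hg0]; positivity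
  have hg01 : g 0 < 1 := by rw [hg0, div_lt_one hs]; exact hD
  obtain ⟨C, hC0, hC⟩ := exists_abs_sub_linear_le
    (f := fun t => 1 / 2 * Real.log (g t)) (B := -1)
    (contDiffAt_const.mul (hgc.log hg00.ne'))
    (((hg'.log hg00.ne').const_mul (1 / 2)).congr_deriv (by rw [hg0]; field_simp))
  have hghalf : ∀ᶠ t in 𝓝 (0 : ℝ), g 0 / 2 < g t :=
    hg'.continuousAt.eventually (lt_mem_nhds (by linarith))
  have hglt : ∀ᶠ t in 𝓝 (0 : ℝ), g t < 1 :=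
    hg'.continuousAt.eventually (gt_mem_nhds hg01)
  have hprob : ∀ᶠ n in atTop, IsProbabilityMeasure (sphericalLaw (s - D) n) := by
    filter_upwards [eventually_ne_atTop 0] with n hn
    have : NeZero n := ⟨hn⟩
    exact isProbabilityMeasure_sphericalLaw _ _
  have hsq0 : (s - D + s * (0 : ℝ)) ^ 2 ≠ 0 := by simpa using hP.ne'
  refine hasCoverEstimate_of_window hD0 hD hprob
    (b := fun t => (s - D) / s * ((s - D) * (s * (1 + 2 * t)) / (s - D + s * t) ^ 2 - 1))
    (contDiffAt_const.mul ((ContDiffAt.div (f := fun t => (s - D) * (s * (1 + 2 * t)))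
      (g := fun t => (s - D + s * t) ^ 2) (by fun_prop) (by fun_prop) hsq0).sub contDiffAt_const))
    ?_ ?_ (N := 0) ?_ (K := max C (1 / 2 + 1 / 2 * |Real.log (g 0 / 2)|)) (le_max_of_le_left hC0) ?_
  · simp only [mul_zero, add_zero, mul_one]
    field_simp
    ring
  · refine (((hprod.div hsq hsq0).sub_const 1).const_mul ((s - D) / s)).congr_deriv ?_
    simp only [mul_zero, add_zero, mul_one]
    field_simp
    ring
  · filter_upwards [hpos, hnpos] with t ht hct m _ x hx
    exact window_le_coverProb_sphericalLaw hD0 hD ht hct hx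
  · filter_upwards [hpos, hnpos, hC, hghalf, hglt] with t ht hct htay hgt hgt1 m hm x hx
    have hcc := coverCos_sq hD hs ht
    have hgc : 1 - coverCos s D t ^ 2 = g t := by rw [hcc]
    have hc0 : 0 < coverCos s D t :=
      div_pos hct (mul_pos (Real.sqrt_pos.2 hP) (Real.sqrt_pos.2 (by positivity)))
    have hc1 : coverCos s D t < 1 := by
      have h : coverCos s D t ^ 2 < 1 ^ 2 := by linarith
      exact lt_of_pow_lt_pow_left₀ 2 zero_le_one h
    refine (coverProb_sphericalLaw_le_cone hD hs ht hx).trans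
      ((stdGaussianVec_cone_le hm hc0 hc1).trans (Real.exp_le_exp.2 ?_))
    rw [hgc]
    set n : ℝ := ((m + 1 : ℕ) : ℝ)
    have hn0 : 0 ≤ n := Nat.cast_nonneg _
    have hlogn : 0 ≤ Real.log n := Real.log_natCast_nonneg _
    set K := max C (1 / 2 + 1 / 2 * |Real.log (g 0 / 2)|)
    have hKC : C ≤ K := le_max_left _ _
    have hKh : 1 / 2 + 1 / 2 * |Real.log (g 0 / 2)| ≤ K := le_max_right _ _
    have habs := abs_nonneg (Real.log (g 0 / 2))
    have hR : 1 / 2 * Real.log (g 0) = -firstOrderRate s D := by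
      rw [hg0, firstOrderRate, ← inv_div s D, Real.log_inv]
      ring
    rw [hR] at htay
    have h1 : 1 / 2 * Real.log (g t) ≤ -(firstOrderRate s D + t) + C * t ^ 2 := by
      have := (abs_le.1 htay).2
      linarith
    have h2 := mul_le_mul_of_nonneg_left h1 hn0
    have h3 : -Real.log (g t) ≤ |Real.log (g 0 / 2)| := by
      have := Real.log_le_log (by positivity) hgt.le
      have := neg_abs_le (Real.log (g 0 / 2))
      linarith
    have h4 : C * (n * t ^ 2) ≤ K * (n * t ^ 2) := by gcongr
    have h5 : 1 / 2 * Real.log n ≤ K * Real.log n := by gcongr; linarith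
    nlinarith

end GaussianCodebook

/-! ### The second-order asymptotics -/

theorem theorem1 (μ : MeasureTheory.Measure ℝ) [MeasureTheory.IsProbabilityMeasure μ]
    (σ ζ D : ℝ)
    (h2 : ∫ x, x ^ 2 ∂μ = σ ^ 2)
    (h4i : MeasureTheory.Integrable (fun x : ℝ => x ^ 4) μ)
    (h4 : ∫ x, x ^ 4 ∂μ = ζ)
    (h6 : MeasureTheory.Integrable (fun x : ℝ => x ^ 6) μ)
    (hD0 : 0 < D) (hD : D < σ ^ 2) :
    (∀ ε : ℝ, 0 ≤ ε → ε < 1 → (ε = 0 → 0 < GaussianCodebook.dispersion (σ ^ 2) ζ) →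
      GaussianCodebook.secondOrderRate μ (GaussianCodebook.sphericalLaw (σ ^ 2 - D)) (σ ^ 2) D ε =
          ((Real.sqrt (GaussianCodebook.dispersion (σ ^ 2) ζ) : ℝ) : EReal) *
            GaussianCodebook.gaussianQInv ε ∧
      GaussianCodebook.secondOrderRate μ (GaussianCodebook.iidGaussianLaw (σ ^ 2 - D))
            (σ ^ 2) D ε =
          ((Real.sqrt (GaussianCodebook.dispersion (σ ^ 2) ζ) : ℝ) : EReal) *
            GaussianCodebook.gaussianQInv ε) ∧
    (∀ ε : ℝ, 0 < ε → ε < 1 →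
      GaussianCodebook.HasSecondOrderExpansion μ (GaussianCodebook.sphericalLaw (σ ^ 2 - D))
          (σ ^ 2) ζ D ε ∧
      GaussianCodebook.HasSecondOrderExpansion μ (GaussianCodebook.iidGaussianLaw (σ ^ 2 - D))
          (σ ^ 2) ζ D ε) := by
  have hsp := GaussianCodebook.hasCoverEstimate_sphericalLaw hD0 hD
  have hiid := GaussianCodebook.hasCoverEstimate_iidGaussianLaw hD0 hD
  exact ⟨fun ε h0 h1 hV =>
      ⟨GaussianCodebook.secondOrderRate_of_coverEstimate hD0 hD h2 h4i h4 h6 h0 h1 hV hsp,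
        GaussianCodebook.secondOrderRate_of_coverEstimate hD0 hD h2 h4i h4 h6 h0 h1 hV hiid⟩,
    fun ε h0 h1 =>
      ⟨GaussianCodebook.hasSecondOrderExpansion_of_coverEstimate hD0 hD h2 h4i h4 h6 h0 h1 hsp,
        GaussianCodebook.hasSecondOrderExpansion_of_coverEstimate hD0 hD h2 h4i h4 h6 h0 h1 hiid⟩⟩
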